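/- All graphs are finite, simple and undirected. A graph is \emph{strongly chordal} if every cycle of length at least four has a chord and every even cycle of length at least six has a chord dividing the cycle into two paths of odd length at least three. The \emph{strongly chordal treewidth} of a graph $G$ is the minimum $k$ such that $G$ is a subgraph of a strongly chordal graph with clique number $k+1$. A graph is \emph{2-connected} if it has at least three vertices and remains connected after deleting any set of at most one vertex. A \emph{block} of $G$ is a maximal connected (nonempty) subgraph without a cut vertex. The \emph{cell completion} $\widetilde G$ of a 2-connected graph $G=(V,E)$ is obtained from $G$ by adding an edge $vw$ for all pairs of nonadjacent distinct vertices $v,w$ such that $G[V\setminus\{v,w\}]$ has at least three connected components. \emph{Trees of cycles} are defined recursively: every cycle is a tree of cycles; and if $G$ is a tree of cycles and $C$ a cycle, then the graph obtained from the disjoint union of $G$ and $C$ by identifying an edge and its end vertices in $G$ with an edge and its end vertices in $C$ is a tree of cycles. An \emph{edge separator} of a tree of cycles is an edge contained in at least two distinct chordless cycles (triangles count as chordless cycles). A \emph{tree of two-boundaried cycles} is a tree of cycles in which each chordless cycle has at most two edge separators. A \emph{minor} of $G$ is a graph obtained from $G$ by a series of vertex deletions, edge deletions and edge contractions. $K_4$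 is the complete graph on four vertices, and $S_3$ (the 3-sun) is the cycle $v_1v_2v_3v_4v_5v_6v_1$ together with the edges $v_2v_4$, $v_4v_6$, $v_6v_2$. \textbf{Theorem.} Let $G$ be a graph. The following are equivalent. (1) $G$ has strongly chordal treewidth at most two. (2) Each block of $G$ is either a 2-connected subgraph whose cell completion is a tree of two-boundaried cycles, or a single edge, or an isolated vertex. (3) $G$ has no minor isomorphic to $K_4$ or $S_3$. Moreover, if $G$ is 2-connected, then $G$ has strongly chordal treewidth two if and only if its cell completion $\widetilde G$ is a tree of two-boundaried cycles, and also if and only if $G$ has no minor isomorphic to $K_4$ or $S_3$. -/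

import Mathlib

namespace SimpleGraph

universe u v

/-! ### Strongly chordal graphs and strongly chordal treewidth -/

/-- Every cycle of length at least four has a chord. -/
def IsChordalGraph {V : Type u} (G : SimpleGraph V) : Prop :=
  ∀ (a : V) (p : G.Walk a a), p.IsCycle → 4 ≤ p.length → ∃ e, p.IsChord e

/-- The cycle `p` has an odd chord: two vertices of the cycle, at positions `i < j`, are adjacent,
and the two arcs of the cycle between them both have odd length at least three. -/
def HasOddChord {V : Type u} (G : SimpleGraph V) {a : V} (p : G.Walk a a) : Prop :=
  ∃ i j : ℕ, i < j ∧ j < p.length ∧ G.Adj (p.getVert i) (p.getVert j) ∧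
    Odd (j - i) ∧ 3 ≤ j - i ∧ Odd (p.length - (j - i)) ∧ 3 ≤ p.length - (j - i)

/-- A graph is strongly chordal if it is chordal and every even cycle of length at least six has
an odd chord. -/
def IsStronglyChordal {V : Type u} (G : SimpleGraph V) : Prop :=
  G.IsChordalGraph ∧
    ∀ (a : V) (p : G.Walk a a), p.IsCycle → Even p.length → 6 ≤ p.length → G.HasOddChord p

/-- The strongly chordal treewidth: the minimum `k` such that `G` is (isomorphic to) a subgraph of
a finite strongly chordal graph with clique number `k + 1`. For finite `G` the set is nonempty. -/
noncomputable def sctw {V : Type u} (G : SimpleGraph V) : ℕ :=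
  sInf {k : ℕ | ∃ (n : ℕ) (H : SimpleGraph (Fin n)),
    H.IsStronglyChordal ∧ G.IsContained H ∧ H.cliqueNum = k + 1}

/-! ### 2-connected graphs, blocks, cell completion -/

/-- At least three vertices, and deleting any set of at most one vertex leaves a connected graph. -/
def IsTwoConnected {V : Type u} (G : SimpleGraph V) : Prop :=
  3 ≤ ENat.card V ∧ ∀ X : Set V, X.encard ≤ 1 → (G.induce Xᶜ).Connected

/-- `a` is a cut vertex of the (connected) graph `G`: some two vertices of `G - a` are not joined
by a path. (The graph without vertices is not disconnected, so the vertex of a one-vertex graph is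
not a cut vertex.) -/
def IsCutVertex {V : Type u} (G : SimpleGraph V) (a : V) : Prop :=
  ¬ (G.induce ({a}ᶜ : Set V)).Preconnected

/-- A block is a maximal connected subgraph without a cut vertex. -/
def IsBlock {V : Type u} (G : SimpleGraph V) (B : G.Subgraph) : Prop :=
  Maximal (fun C : G.Subgraph => C.coe.Connected ∧ ∀ a : C.verts, ¬ C.coe.IsCutVertex a) B

/-- The cell completion: join all pairs of distinct nonadjacent vertices `a`, `b` such that
`G - {a, b}` has at least three connected components. -/
def cellCompletion {V : Type u} (G : SimpleGraph V) : SimpleGraph V where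
  Adj a b := G.Adj a b ∨
    (a ≠ b ∧ 3 ≤ ENat.card (G.induce ({a, b}ᶜ : Set V)).ConnectedComponent)
  symm := ⟨by
    intro a b h
    rcases h with h | ⟨hne, h⟩
    · exact Or.inl h.symm
    · refine Or.inr ⟨hne.symm, ?_⟩
      rw [Set.pair_comm]
      exact h⟩
  loopless := ⟨by
    intro a h
    rcases h with h | h
    · exact G.loopless.irrefl a h
    · exact h.1 rfl⟩

/-! ### Trees of cycles -/

/-- The subgraph `C` of `G` is a cycle. -/
def IsCycleSubgraph {V : Type u} {G : SimpleGraph V} (C : G.Subgraph) : Prop :=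
  ∃ (a : V) (p : G.Walk a a), p.IsCycle ∧ p.toSubgraph = C

/-- The subgraph `C` of `G` is a cycle of `G` without a chord in `G`. -/
def IsChordlessCycle {V : Type u} {G : SimpleGraph V} (C : G.Subgraph) : Prop :=
  ∃ (a : V) (p : G.Walk a a), p.IsCycle ∧ p.IsChordless ∧ p.toSubgraph = C

/-- The subgraph of `G` is, as a graph, a tree of cycles: it is a cycle, or it arises from a tree
of cycles `H` and a cycle `C` by identifying an edge and its ends. The latter means that it is the
union of `H` and `C`, and `H` and `C` have exactly one edge and its two ends in common. -/
inductive IsTreeOfCyclesSubgraph {V : Type u} {G : SimpleGraph V} : G.Subgraph → Prop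
  | cycle (C : G.Subgraph) (hC : IsCycleSubgraph C) : IsTreeOfCyclesSubgraph C
  | glue (H C : G.Subgraph) (hH : IsTreeOfCyclesSubgraph H) (hC : IsCycleSubgraph C)
      (a b : V) (hab : G.Adj a b) (hHC : H ⊓ C = G.subgraphOfAdj hab) :
      IsTreeOfCyclesSubgraph (H ⊔ C)

/-- `G` is a tree of cycles. -/
def IsTreeOfCycles {V : Type u} (G : SimpleGraph V) : Prop :=
  IsTreeOfCyclesSubgraph (⊤ : G.Subgraph)

/-- An edge separator is an edge contained in at least two distinct chordless cycles. -/
def IsEdgeSeparator {V : Type u} (G : SimpleGraph V) (e : Sym2 V) : Prop :=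
  ∃ C D : G.Subgraph, IsChordlessCycle C ∧ IsChordlessCycle D ∧ C ≠ D ∧
    e ∈ C.edgeSet ∧ e ∈ D.edgeSet

/-- A tree of cycles in which each chordless cycle has at most two edge separators. -/
def IsTreeOfTwoBoundariedCycles {V : Type u} (G : SimpleGraph V) : Prop :=
  G.IsTreeOfCycles ∧
    ∀ C : G.Subgraph, IsChordlessCycle C → {e ∈ C.edgeSet | G.IsEdgeSeparator e}.encard ≤ 2

/-! ### Minors -/

/-- Contraction of the edge `ab`: the vertex `b` is merged into `a`; the loop and parallel edges
are discarded. -/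
def contractEdge {V : Type u} (G : SimpleGraph V) (a b : V) :
    SimpleGraph ({b}ᶜ : Set V) where
  Adj x y := x ≠ y ∧
    (G.Adj x y ∨ ((x : V) = a ∧ G.Adj b y) ∨ ((y : V) = a ∧ G.Adj x b))
  symm := ⟨by
    rintro x y ⟨hne, h | ⟨hx, h⟩ | ⟨hy, h⟩⟩
    · exact ⟨hne.symm, Or.inl h.symm⟩
    · exact ⟨hne.symm, Or.inr (Or.inr ⟨hx, h.symm⟩)⟩
    · exact ⟨hne.symm, Or.inr (Or.inl ⟨hy, h.symm⟩)⟩⟩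
  loopless := ⟨fun _ h => h.1 rfl⟩

/-- `HasMinor H V G`: the graph `G` on `V` has a minor isomorphic to `H`, that is, a graph
isomorphic to `H` can be obtained from `G` by a series of vertex deletions, edge deletions and
edge contractions. -/
inductive HasMinor {W : Type v} (H : SimpleGraph W) : (V : Type u) → SimpleGraph V → Prop
  | iso {V : Type u} (G : SimpleGraph V) (e : H ≃g G) : HasMinor H V G
  | deleteVertex {V : Type u} (G : SimpleGraph V) (a : V)
      (h : HasMinor H ({a}ᶜ : Set V) (G.induce ({a}ᶜ : Set V))) : HasMinor H V G
  | deleteEdge {V : Type u} (G : SimpleGraph V) (e : Sym2 V) (he : e ∈ G.edgeSet)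
      (h : HasMinor H V (G.deleteEdges {e})) : HasMinor H V G
  | contract {V : Type u} (G : SimpleGraph V) (a b : V) (hab : G.Adj a b)
      (h : HasMinor H ({b}ᶜ : Set V) (G.contractEdge a b)) : HasMinor H V G

/-- The complete graph on four vertices. -/
def K4 : SimpleGraph (Fin 4) := completeGraph (Fin 4)

/-- The 3-sun: the hexagon `0 1 2 3 4 5` together with the triangle `1 3 5`. -/
def S3 : SimpleGraph (Fin 6) :=
  fromEdgeSet {s(0, 1), s(1, 2), s(2, 3), s(3, 4), s(4, 5), s(5, 0), s(1, 3), s(3, 5), s(5, 1)}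

end SimpleGraph

namespace SimpleGraph

universe u v w

/-! ### Connected sets of vertices -/

/-! The cycle of implications is (1) ⇒ (3) ⇒ (2) ⇒ (1). Two translations make it workable. Minors
are handled as branch sets (`HasModel`). Finite strongly chordal graphs of clique number at most
three are exactly the finite tame ones (`IsTame`): chordal, without `K4`, and with no triangle whose
three edges all lie in further triangles. So treewidth at most two means being a subgraph of a tame
graph (`sctw_le_two_iff`).

(1) ⇒ (3): tameness survives the contraction of an edge (`IsEdgeContraction.isTame`), so subgraphs
of tame graphs are closed under minors, and neither `K4` nor `S3` is one of them.

(3) ⇒ (2): blocks inherit the absence of both minors, so let `G` be 2-connected. Without a `K4`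
minor, three disjoint links between `a` and `b` lie in different components of `G - {a, b}`. Adding
the edge `ab` then creates neither minor: the remaining branch sets of a model miss one of the three
components, and a path through it simulates the edge (`HasModel.of_sup_edge`). Hence the cell
completion has neither minor, and all its pairs with three disjoint links are adjacent
(`cellCompletion_properties`). In such a graph a component outside a 2-connected set is attached
exactly at the two ends of an edge (`TwoConn.exists_attachment`): nonadjacent attachments would have
three links, and three attachments give `K4`. So induced cycles can be glued on along edges until a
tree of cycles is exhausted. Three edge separators on one chordless cycle give `S3`: the components
beyond them are the tips, the arcs of the cycle between them the inner triangle.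

(2) ⇒ (1): a polygon with at most two marked edges has a triangulation in which every triangle owns
an unmarked polygon edge. With the separators marked, these triangulations glue to a tame graph
(`IsTreeOfCyclesSubgraph.exists_isMarkedTame`), and tame graphs glue at cut vertices
(`exists_isTame_of_isBlock`). For the 2-connected case, a chordal host of a 2-connected graph
contains a triangle, so the treewidth is at least two. -/

theorem three_le_encard_iff {α : Type*} {s : Set α} :
    3 ≤ s.encard ↔ ∃ a ∈ s, ∃ b ∈ s, ∃ c ∈ s, a ≠ b ∧ a ≠ c ∧ b ≠ c := by
  constructor
  · intro h
    obtain ⟨t, hts, ht⟩ := Set.exists_subset_encard_eq h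
    obtain ⟨a, b, c, hab, hac, hbc, rfl⟩ := Set.encard_eq_three.1 ht
    exact ⟨a, hts (by simp), b, hts (by simp), c, hts (by simp), hab, hac, hbc⟩
  · rintro ⟨a, ha, b, hb, c, hc, hab, hac, hbc⟩
    have h3 : ({a, b, c} : Set α).encard = 3 :=
      Set.encard_eq_three.2 ⟨a, b, c, hab, hac, hbc, rfl⟩
    rw [← h3]
    apply Set.encard_le_encard
    rintro x (rfl | rfl | rfl) <;> assumption

/-- The set `S` of vertices is nonempty and induces a connected subgraph, expressed by closed
sets of vertices. -/
def Conn {V : Type u} (G : SimpleGraph V) (S : Set V) : Prop :=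
  S.Nonempty ∧ ∀ A : Set V, (∃ x ∈ S, x ∈ A) →
    (∀ x ∈ S, x ∈ A → ∀ y ∈ S, G.Adj x y → y ∈ A) → S ⊆ A

/-- Some connected set of vertices inside `S` contains `x` and `y`. -/
def Joined {V : Type u} (G : SimpleGraph V) (S : Set V) (x y : V) : Prop :=
  ∃ K ⊆ S, Conn G K ∧ x ∈ K ∧ y ∈ K

/-- The vertex `x` has a neighbour in `S`. -/
def Att {V : Type u} (G : SimpleGraph V) (S : Set V) (x : V) : Prop :=
  ∃ y ∈ S, G.Adj x y

/-- The connected component of `x` in the subgraph induced on `S`. -/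
def comp {V : Type u} (G : SimpleGraph V) (S : Set V) (x : V) : Set V :=
  {y | Joined G S x y}

section Conn

variable {V : Type u} {W : Type v} {G G' : SimpleGraph V} {S T A : Set V} {x y z : V}

theorem conn_iff_connected_induce : Conn G S ↔ (G.induce S).Connected := by
  constructor
  · rintro ⟨⟨x, hx⟩, h⟩
    rw [connected_iff_exists_forall_reachable]
    refine ⟨⟨x, hx⟩, ?_⟩
    have := h {y | ∃ hy : y ∈ S, (G.induce S).Reachable ⟨x, hx⟩ ⟨y, hy⟩}
      ⟨x, hx, hx, Reachable.refl _⟩ (by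
        rintro y hy ⟨_, hxy⟩ z hz hyz
        exact ⟨hz, hxy.trans (Adj.reachable (by simpa using hyz))⟩)
    rintro ⟨y, hy⟩
    exact (this hy).2
  · intro h
    obtain ⟨⟨x, hx⟩⟩ := h.nonempty
    refine ⟨⟨x, hx⟩, ?_⟩
    rintro A ⟨a, haS, haA⟩ hA b hb
    obtain ⟨p⟩ := h.preconnected ⟨a, haS⟩ ⟨b, hb⟩
    have key : ∀ (a b : S) (p : (G.induce S).Walk a b), (a : V) ∈ A → (b : V) ∈ A := by
      intro a b p
      induction p with
      | nil => exact id
      | cons hab _ ih => exact fun ha => ih (hA _ (Subtype.coe_prop _) ha _ (Subtype.coe_prop _)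
          (by simpa using hab))
    exact key _ _ p haA

theorem Conn.nonempty (h : Conn G S) : S.Nonempty := h.1

theorem Conn.mono (h : Conn G S) (hG : G ≤ G') : Conn G' S :=
  ⟨h.1, fun A hx hA => h.2 A hx fun x hx hxA y hy hxy => hA x hx hxA y hy (hG hxy)⟩

theorem conn_singleton (x : V) : Conn G {x} := by
  refine ⟨⟨x, rfl⟩, ?_⟩
  rintro A ⟨y, rfl, hy⟩ - z rfl
  exact hy

/-- The contrapositive of closedness. This crossing edge is the standard way below to find where a
set is left. -/
theorem Conn.exists_adj (h : Conn G S) (hx : x ∈ S) (hxA : x ∈ A) (hy : y ∈ S) (hyA : y ∉ A) :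
    ∃ u ∈ S, u ∈ A ∧ ∃ v ∈ S, v ∉ A ∧ G.Adj u v := by
  by_contra hcon
  refine hyA (h.2 A ⟨x, hx, hxA⟩ ?_ hy)
  intro u hu huA v hv huv
  by_contra hvA
  exact hcon ⟨u, hu, huA, v, hv, hvA, huv⟩

theorem Conn.exists_adj_of_ne (h : Conn G S) (hx : x ∈ S) (hy : y ∈ S) (hxy : x ≠ y) :
    ∃ z ∈ S, G.Adj x z := by
  obtain ⟨u, -, hu, v, hv, -, huv⟩ := h.exists_adj (A := {x}) hx rfl hy (fun h => hxy h.symm)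
  cases hu
  exact ⟨v, hv, huv⟩

theorem Conn.union (hS : Conn G S) (hT : Conn G T) (hx : x ∈ S) (hx' : x ∈ T) :
    Conn G (S ∪ T) := by
  refine ⟨hS.1.inl, ?_⟩
  rintro A ⟨y, hy, hyA⟩ hA
  have hS' : (∃ x ∈ S, x ∈ A) → S ⊆ A := fun h =>
    hS.2 A h fun x hx hxA y hy => hA x (Or.inl hx) hxA y (Or.inl hy)
  have hT' : (∃ x ∈ T, x ∈ A) → T ⊆ A := fun h =>
    hT.2 A h fun x hx hxA y hy => hA x (Or.inr hx) hxA y (Or.inr hy)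
  rcases hy with hy | hy
  · have := hS' ⟨y, hy, hyA⟩
    exact Set.union_subset this (hT' ⟨x, hx', this hx⟩)
  · have := hT' ⟨y, hy, hyA⟩
    exact Set.union_subset (hS' ⟨x, hx, this hx'⟩) this

theorem conn_pair (h : G.Adj x y) : Conn G {x, y} := by
  refine ⟨⟨x, by simp⟩, ?_⟩
  rintro A ⟨z, hz, hzA⟩ hA
  rcases hz with rfl | rfl
  · rintro w (rfl | rfl)
    · exact hzA
    · exact hA _ (by simp) hzA _ (by simp) h
  · rintro w (rfl | rfl)
    · exact hA _ (by simp) hzA _ (by simp) h.symm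
    · exact hzA

theorem Conn.union_of_adj (hS : Conn G S) (hT : Conn G T) (hx : x ∈ S) (hy : y ∈ T)
    (h : G.Adj x y) : Conn G (S ∪ T) := by
  have h1 := (hS.union (conn_pair h) hx (by simp)).union hT (x := y) (by simp) hy
  convert h1 using 1
  ext z
  simp only [Set.mem_union, Set.mem_insert_iff, Set.mem_singleton_iff]
  grind

theorem Conn.insert_of_adj (hS : Conn G S) (hx : x ∈ S) (h : G.Adj x y) :
    Conn G (insert y S) := by
  rw [Set.insert_eq, Set.union_comm]
  exact hS.union_of_adj (conn_singleton y) hx rfl h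

theorem Conn.union_of_att (hS : Conn G S) (hT : Conn G T) (hx : x ∈ S) (h : Att G T x) :
    Conn G (S ∪ T) := by
  obtain ⟨y, hy, hxy⟩ := h
  exact hS.union_of_adj hT hx hy hxy

theorem Conn.insert_of_att (hS : Conn G S) (h : Att G S x) : Conn G (insert x S) := by
  obtain ⟨y, hy, hxy⟩ := h
  exact hS.insert_of_adj hy hxy.symm

/-- Edges may collapse to a point, so that the lemma also serves contractions. -/
theorem Conn.image {G' : SimpleGraph W} (h : Conn G S) (f : V → W)
    (hf : ∀ x ∈ S, ∀ y ∈ S, G.Adj x y → f x = f y ∨ G'.Adj (f x) (f y)) : Conn G' (f '' S) := by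
  refine ⟨h.1.image f, ?_⟩
  rintro A ⟨_, ⟨x, hx, rfl⟩, hxA⟩ hA
  rw [Set.image_subset_iff]
  refine h.2 _ ⟨x, hx, hxA⟩ ?_
  intro a ha haA b hb hab
  rcases hf a ha b hb hab with h | h
  · rw [Set.mem_preimage, ← h]
    exact haA
  · exact hA _ ⟨a, ha, rfl⟩ haA _ ⟨b, hb, rfl⟩ h

theorem Att.mono (h : Att G S x) (hS : S ⊆ T) : Att G T x := by
  obtain ⟨y, hy, hxy⟩ := h
  exact ⟨y, hS hy, hxy⟩

theorem Att.mono_graph (h : Att G S x) (hG : G ≤ G') : Att G' S x := by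
  obtain ⟨y, hy, hxy⟩ := h
  exact ⟨y, hy, hG hxy⟩

theorem Joined.right_mem (h : Joined G S x y) : y ∈ S := by
  obtain ⟨K, hK, -, -, hx⟩ := h
  exact hK hx

theorem Joined.refl (hx : x ∈ S) : Joined G S x x :=
  ⟨{x}, by simpa using hx, conn_singleton x, rfl, rfl⟩

theorem Joined.symm (h : Joined G S x y) : Joined G S y x := by
  obtain ⟨K, hK, hc, hx, hy⟩ := h
  exact ⟨K, hK, hc, hy, hx⟩

theorem Joined.trans (h : Joined G S x y) (h' : Joined G S y z) : Joined G S x z := by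
  obtain ⟨K, hK, hc, hx, hy⟩ := h
  obtain ⟨L, hL, hc', hy', hz⟩ := h'
  exact ⟨K ∪ L, Set.union_subset hK hL, hc.union hc' hy hy', Or.inl hx, Or.inr hz⟩

theorem Joined.of_adj (hx : x ∈ S) (hy : y ∈ S) (h : G.Adj x y) : Joined G S x y :=
  ⟨{x, y}, by rintro z (rfl | rfl) <;> assumption, conn_pair h, by simp, by simp⟩

theorem Joined.mono (h : Joined G S x y) (hG : G ≤ G') (hS : S ⊆ T) : Joined G' T x y := by
  obtain ⟨K, hK, hc, hx, hy⟩ := h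
  exact ⟨K, hK.trans hS, hc.mono hG, hx, hy⟩

theorem Conn.joined (h : Conn G A) (hA : A ⊆ S) (hx : x ∈ A) (hy : y ∈ A) : Joined G S x y :=
  ⟨A, hA, h, hx, hy⟩

theorem mem_comp_self (hx : x ∈ S) : x ∈ comp G S x := Joined.refl hx

theorem comp_subset : comp G S x ⊆ S := fun _ h => h.right_mem

theorem mem_comp_of_adj (hy : y ∈ comp G S x) (hz : z ∈ S) (h : G.Adj y z) :
    z ∈ comp G S x :=
  Joined.trans hy (Joined.of_adj (comp_subset hy) hz h)

theorem conn_comp (hx : x ∈ S) : Conn G (comp G S x) := by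
  refine ⟨⟨x, mem_comp_self hx⟩, ?_⟩
  rintro A ⟨y, hy, hyA⟩ hA z hz
  obtain ⟨K, hK, hc, hyK, hzK⟩ := Joined.trans (Joined.symm hy) hz
  have hKc : K ⊆ comp G S x := fun w hw => Joined.trans hy ⟨K, hK, hc, hyK, hw⟩
  exact hc.2 A ⟨y, hyK, hyA⟩ (fun a ha haA b hb hab => hA a (hKc ha) haA b (hKc hb) hab) hzK

theorem Conn.subset_comp (h : Conn G A) (hA : A ⊆ S) (hx : x ∈ A) : A ⊆ comp G S x :=
  fun _ hy => h.joined hA hx hy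

theorem comp_eq_of_mem (hy : y ∈ comp G S x) : comp G S y = comp G S x := by
  ext z
  exact ⟨fun h => Joined.trans hy h, fun h => Joined.trans (Joined.symm hy) h⟩

theorem joined_iff_reachable (hx : x ∈ S) (hy : y ∈ S) :
    Joined G S x y ↔ (G.induce S).Reachable ⟨x, hx⟩ ⟨y, hy⟩ := by
  constructor
  · rintro ⟨K, hK, hc, hxK, hyK⟩
    have h := (conn_iff_connected_induce.1 hc).preconnected ⟨x, hxK⟩ ⟨y, hyK⟩
    exact h.map (G.induceHomOfLE hK).toHom
  · rintro ⟨p⟩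
    have key : ∀ (a b : S) (p : (G.induce S).Walk a b), Joined G S a b := by
      intro a b p
      induction p with
      | nil => exact Joined.refl (Subtype.coe_prop _)
      | cons hab _ ih => exact Joined.trans (Joined.of_adj (Subtype.coe_prop _)
          (Subtype.coe_prop _) (by simpa using hab)) ih
    exact key _ _ p

theorem conn_univ_iff : Conn G Set.univ ↔ G.Connected := by
  rw [conn_iff_connected_induce]
  exact (induceUnivIso G).connected_iff

/-- Three pairwise separated vertices witness three components. -/
theorem three_le_card_connectedComponent_induce :
    3 ≤ ENat.card (G.induce S).ConnectedComponent ↔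
      ∃ x ∈ S, ∃ y ∈ S, ∃ z ∈ S, ¬ Joined G S x y ∧ ¬ Joined G S y z ∧ ¬ Joined G S x z := by
  constructor
  · intro h
    rw [← Set.encard_univ, three_le_encard_iff] at h
    obtain ⟨a, -, b, -, c, -, hab, hac, hbc⟩ := h
    obtain ⟨⟨x, hx⟩, rfl⟩ := a.exists_rep
    obtain ⟨⟨y, hy⟩, rfl⟩ := b.exists_rep
    obtain ⟨⟨z, hz⟩, rfl⟩ := c.exists_rep
    refine ⟨x, hx, y, hy, z, hz, ?_, ?_, ?_⟩
    · rw [joined_iff_reachable hx hy, ← ConnectedComponent.eq]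
      exact hab
    · rw [joined_iff_reachable hy hz, ← ConnectedComponent.eq]
      exact hbc
    · rw [joined_iff_reachable hx hz, ← ConnectedComponent.eq]
      exact hac
  · rintro ⟨x, hx, y, hy, z, hz, hxy, hyz, hxz⟩
    rw [joined_iff_reachable hx hy, ← ConnectedComponent.eq] at hxy
    rw [joined_iff_reachable hy hz, ← ConnectedComponent.eq] at hyz
    rw [joined_iff_reachable hx hz, ← ConnectedComponent.eq] at hxz
    rw [← Set.encard_univ, three_le_encard_iff]
    exact ⟨_, trivial, _, trivial, _, trivial, hxy, hxz, hyz⟩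

/-- The image of an interval under a sequence of consecutively adjacent vertices. -/
theorem conn_image_Icc {c : ℕ → V} {l r : ℕ} (hlr : l ≤ r)
    (hc : ∀ i, l ≤ i → i < r → G.Adj (c i) (c (i + 1))) : Conn G (c '' Set.Icc l r) := by
  induction r, hlr using Nat.le_induction with
  | base => simpa using conn_singleton (c l)
  | succ r hlr ih =>
    have h := (ih fun i hi hir => hc i hi (by omega)).insert_of_adj (x := c r) (y := c (r + 1))
      ⟨r, ⟨hlr, le_rfl⟩, rfl⟩ (hc r hlr (by omega))
    convert h using 1
    rw [← Set.image_insert_eq]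
    congr 1
    ext i
    simp only [Set.mem_Icc, Set.mem_insert_iff]
    omega

end Conn

/-! ### Branch sets -/

/-- A model of `W` in `G` by branch sets. -/
structure IsModel {V : Type u} {ι : Type v} (W : SimpleGraph ι) (G : SimpleGraph V)
    (B : ι → Set V) : Prop where
  conn : ∀ i, Conn G (B i)
  disj : ∀ i j, i ≠ j → Disjoint (B i) (B j)
  adj : ∀ i j, W.Adj i j → ∃ x ∈ B i, ∃ y ∈ B j, G.Adj x y

/-- `G` has a minor isomorphic to `W`, in terms of branch sets. -/
def HasModel {V : Type u} {ι : Type v} (W : SimpleGraph ι) (G : SimpleGraph V) : Prop :=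
  ∃ B : ι → Set V, IsModel W G B

theorem HasModel.mono {V : Type u} {ι : Type v} {W : SimpleGraph ι} {G G' : SimpleGraph V}
    (h : HasModel W G) (hG : G ≤ G') : HasModel W G' := by
  obtain ⟨B, hB⟩ := h
  refine ⟨B, fun i => (hB.conn i).mono hG, hB.disj, fun i j hij => ?_⟩
  obtain ⟨x, hx, y, hy, hxy⟩ := hB.adj i j hij
  exact ⟨x, hx, y, hy, hG hxy⟩

theorem HasModel.map {V : Type u} {X : Type w} {ι : Type v} {W : SimpleGraph ι}
    {G : SimpleGraph V} {G' : SimpleGraph X} (h : HasModel W G) (f : V → X)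
    (hf : Function.Injective f) (hadj : ∀ x y, G.Adj x y → G'.Adj (f x) (f y)) :
    HasModel W G' := by
  obtain ⟨B, hB⟩ := h
  refine ⟨fun i => f '' B i, fun i => (hB.conn i).image f fun x _ y _ h => Or.inr (hadj x y h),
    fun i j hij => (Set.disjoint_image_iff hf).2 (hB.disj i j hij), fun i j hij => ?_⟩
  obtain ⟨x, hx, y, hy, hxy⟩ := hB.adj i j hij
  exact ⟨f x, ⟨x, hx, rfl⟩, f y, ⟨y, hy, rfl⟩, hadj x y hxy⟩

/-! ### Links between two vertices, and adding an edge between them. -/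

section Link

variable {V : Type u} {G G' : SimpleGraph V} {a b : V} {K K₁ K₂ K₃ : Set V}

/-- A connected set of vertices that avoids `a` and `b` and has neighbours of both. -/
structure IsLink (G : SimpleGraph V) (a b : V) (K : Set V) : Prop where
  conn : Conn G K
  left_notMem : a ∉ K
  right_notMem : b ∉ K
  att_left : Att G K a
  att_right : Att G K b

theorem IsLink.mono (h : IsLink G a b K) (hG : G ≤ G') : IsLink G' a b K :=
  ⟨h.conn.mono hG, h.left_notMem, h.right_notMem, h.att_left.mono_graph hG,
    h.att_right.mono_graph hG⟩

theorem IsLink.subset (h : IsLink G a b K) : K ⊆ {a, b}ᶜ := by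
  rintro x hx (rfl | rfl)
  · exact h.left_notMem hx
  · exact h.right_notMem hx

theorem Conn.of_forall_adj {S : Set V} (h : Conn G S)
    (hG : ∀ x ∈ S, ∀ y ∈ S, G.Adj x y → G'.Adj x y) : Conn G' S :=
  ⟨h.1, fun A hx hA => h.2 A hx fun x hx hxA y hy hxy => hA x hx hxA y hy (hG x hx y hy hxy)⟩

theorem hasModel_K4 {A₁ A₂ A₃ A₄ : Set V} (h₁ : Conn G A₁) (h₂ : Conn G A₂) (h₃ : Conn G A₃)
    (h₄ : Conn G A₄) (d₁₂ : Disjoint A₁ A₂) (d₁₃ : Disjoint A₁ A₃) (d₁₄ : Disjoint A₁ A₄)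
    (d₂₃ : Disjoint A₂ A₃) (d₂₄ : Disjoint A₂ A₄) (d₃₄ : Disjoint A₃ A₄)
    (t₁₂ : ∃ x ∈ A₁, ∃ y ∈ A₂, G.Adj x y) (t₁₃ : ∃ x ∈ A₁, ∃ y ∈ A₃, G.Adj x y)
    (t₁₄ : ∃ x ∈ A₁, ∃ y ∈ A₄, G.Adj x y) (t₂₃ : ∃ x ∈ A₂, ∃ y ∈ A₃, G.Adj x y)
    (t₂₄ : ∃ x ∈ A₂, ∃ y ∈ A₄, G.Adj x y) (t₃₄ : ∃ x ∈ A₃, ∃ y ∈ A₄, G.Adj x y) :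
    HasModel K4 G := by
  have symm : ∀ {A B : Set V}, (∃ x ∈ A, ∃ y ∈ B, G.Adj x y) → ∃ x ∈ B, ∃ y ∈ A, G.Adj x y := by
    rintro A B ⟨x, hx, y, hy, hxy⟩
    exact ⟨y, hy, x, hx, hxy.symm⟩
  refine ⟨![A₁, A₂, A₃, A₄], ?_, ?_, ?_⟩
  · intro i
    fin_cases i <;> assumption
  · intro i j hij
    fin_cases i <;> fin_cases j <;>
      first | exact absurd rfl hij | assumption | (apply Disjoint.symm; assumption)
  · intro i j hij
    fin_cases i <;> fin_cases j <;>
      first | exact absurd rfl hij.ne | assumption | (apply symm; assumption)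

/-- The branch sets are `{a}`, `K₃ ∪ {b}`, `K₁` and `K₂`; the third link supplies the edge between
the first two. -/
theorem IsLink.hasModel_K4_of_adj (hab : a ≠ b) (h₁ : IsLink G a b K₁)
    (h₂ : IsLink G a b K₂) (h₃ : IsLink G a b K₃) (d₁₂ : Disjoint K₁ K₂)
    (d₁₃ : Disjoint K₁ K₃) (d₂₃ : Disjoint K₂ K₃) (t : ∃ x ∈ K₁, ∃ y ∈ K₂, G.Adj x y) :
    HasModel K4 G := by
  obtain ⟨x₁, hx₁, hax₁⟩ := h₁.att_left
  obtain ⟨y₁, hy₁, hby₁⟩ := h₁.att_right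
  obtain ⟨x₂, hx₂, hax₂⟩ := h₂.att_left
  obtain ⟨y₂, hy₂, hby₂⟩ := h₂.att_right
  obtain ⟨x₃, hx₃, hax₃⟩ := h₃.att_left
  refine hasModel_K4 (conn_singleton a) (h₃.conn.insert_of_att h₃.att_right) h₁.conn h₂.conn
    ?_ ?_ ?_ ?_ ?_ d₁₂ ⟨a, rfl, x₃, Or.inr hx₃, hax₃⟩ ⟨a, rfl, x₁, hx₁, hax₁⟩
    ⟨a, rfl, x₂, hx₂, hax₂⟩ ⟨b, Or.inl rfl, y₁, hy₁, hby₁⟩ ⟨b, Or.inl rfl, y₂, hy₂, hby₂⟩ t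
  · rw [Set.disjoint_singleton_left]
    rintro (h | h)
    · exact hab h
    · exact h₃.left_notMem h
  · rw [Set.disjoint_singleton_left]
    exact h₁.left_notMem
  · rw [Set.disjoint_singleton_left]
    exact h₂.left_notMem
  · rw [Set.disjoint_insert_left]
    exact ⟨h₁.right_notMem, d₁₃.symm⟩
  · rw [Set.disjoint_insert_left]
    exact ⟨h₂.right_notMem, d₂₃.symm⟩

/-- A graph without a `K4` minor has no connection between two of three disjoint links. -/
theorem IsLink.not_joined (hK4 : ¬ HasModel K4 G) (hab : a ≠ b) (h₁ : IsLink G a b K₁)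
    (h₂ : IsLink G a b K₂) (h₃ : IsLink G a b K₃) (d₁₂ : Disjoint K₁ K₂)
    (d₁₃ : Disjoint K₁ K₃) (d₂₃ : Disjoint K₂ K₃) {x y : V} (hx : x ∈ K₁) (hy : y ∈ K₂) :
    ¬ Joined G {a, b}ᶜ x y := by
  rintro ⟨K, hKab, hK, hxK, hyK⟩
  have hK' : Conn G (K₁ ∪ K) := h₁.conn.union hK hx hxK
  have hs : K₁ ⊆ (K₁ ∪ K) \ (K₂ ∪ K₃) := by
    intro z hz
    refine ⟨Or.inl hz, ?_⟩
    rintro (h | h)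
    · exact Set.disjoint_left.1 d₁₂ hz h
    · exact Set.disjoint_left.1 d₁₃ hz h
  have hxs := hs hx
  -- `L` extends `K₁` along `K` as far as possible without touching the other links. It is again a
  -- link, and an edge leaving it lands in `K₂` or `K₃`; either way there is a `K4`.
  set L := comp G ((K₁ ∪ K) \ (K₂ ∪ K₃)) x with hL
  have hKL : K₁ ⊆ L := h₁.conn.subset_comp hs hx
  have hLs : L ⊆ (K₁ ∪ K) \ (K₂ ∪ K₃) := comp_subset
  have hLb : IsLink G a b L := by
    refine ⟨conn_comp hxs, ?_, ?_, h₁.att_left.mono hKL, h₁.att_right.mono hKL⟩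
    · intro h
      rcases (hLs h).1 with h | h
      · exact h₁.left_notMem h
      · exact hKab h (by simp)
    · intro h
      rcases (hLs h).1 with h | h
      · exact h₁.right_notMem h
      · exact hKab h (by simp)
  have hd₂ : Disjoint L K₂ := Set.disjoint_left.2 fun z hz hz' => (hLs hz).2 (Or.inl hz')
  have hd₃ : Disjoint L K₃ := Set.disjoint_left.2 fun z hz hz' => (hLs hz).2 (Or.inr hz')
  obtain ⟨p, hp, hpL, q, hq, hqL, hpq⟩ := hK'.exists_adj (A := L) (Or.inl hx) (hKL hx)
    (Or.inr hyK) (fun h => (hLs h).2 (Or.inl hy))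
  have hq' : q ∈ K₂ ∪ K₃ := by
    by_contra hq'
    exact hqL (mem_comp_of_adj hpL ⟨hq, hq'⟩ hpq)
  rcases hq' with hq' | hq'
  · exact hK4 (hasModel_K4_of_adj hab hLb h₂ h₃ hd₂ hd₃ d₂₃ ⟨p, hpL, q, hq', hpq⟩)
  · exact hK4 (hasModel_K4_of_adj hab hLb h₃ h₂ hd₃ hd₂ d₂₃.symm ⟨p, hpL, q, hq', hpq⟩)

/-- Any three vertices outside `{i, j}`, where `i = j` or `ij` is an edge, contain two that are
close to each other outside `{i, j}`; so removing `{i, j}` leaves at most two components. -/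
def TwoSplit {ι : Type v} (W : SimpleGraph ι) : Prop :=
  ∀ i j, (i = j ∨ W.Adj i j) → ∀ l : Fin 3 → ι, (∀ s, l s ≠ i ∧ l s ≠ j) →
    ∃ s t, s ≠ t ∧ (l s = l t ∨ W.Adj (l s) (l t) ∨
      ∃ r, r ≠ i ∧ r ≠ j ∧ W.Adj (l s) r ∧ W.Adj r (l t))

/-- Joining two vertices that have three separated links creates no new minor `W`. -/
theorem HasModel.of_sup_edge {ι : Type v} {W : SimpleGraph ι} (hW : TwoSplit W) (hab : a ≠ b)
    {K : Fin 3 → Set V} (hK : ∀ s, IsLink G a b (K s))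
    (hsep : ∀ s t, s ≠ t → ∀ x ∈ K s, ∀ y ∈ K t, ¬ Joined G {a, b}ᶜ x y)
    (h : HasModel W (G ⊔ edge a b)) : HasModel W G := by
  classical
  obtain ⟨B, hB⟩ := h
  have hadj : ∀ {x y}, (G ⊔ edge a b).Adj x y → G.Adj x y ∨ (x = a ∧ y = b) ∨ (x = b ∧ y = a) := by
    intro x y hxy
    rw [sup_adj, edge_adj] at hxy
    rcases hxy with hxy | ⟨hxy, -⟩
    · exact Or.inl hxy
    · exact Or.inr hxy
  -- Unless `a` and `b` lie in the same branch set or in adjacent ones, the model does not need the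
  -- new edge.
  by_cases hij : ∃ i j, a ∈ B i ∧ b ∈ B j ∧ (i = j ∨ W.Adj i j)
  swap
  · refine ⟨B, fun i => ?_, hB.disj, fun i j hWij => ?_⟩
    · refine (hB.conn i).of_forall_adj fun x hx y hy hxy => ?_
      rcases hadj hxy with h | ⟨rfl, rfl⟩ | ⟨rfl, rfl⟩
      · exact h
      · exact absurd ⟨i, i, hx, hy, Or.inl rfl⟩ hij
      · exact absurd ⟨i, i, hy, hx, Or.inl rfl⟩ hij
    · obtain ⟨x, hx, y, hy, hxy⟩ := hB.adj i j hWij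
      rcases hadj hxy with h | ⟨rfl, rfl⟩ | ⟨rfl, rfl⟩
      · exact ⟨x, hx, y, hy, h⟩
      · exact absurd ⟨i, j, hx, hy, Or.inr hWij⟩ hij
      · exact absurd ⟨j, i, hy, hx, Or.inr hWij.symm⟩ hij
  obtain ⟨i, j, hai, hbj, hij⟩ := hij
  choose k hk using fun s => (hK s).conn.nonempty
  have hkab : ∀ s, k s ∈ ({a, b}ᶜ : Set V) := fun s => (hK s).subset (hk s)
  set L : Fin 3 → Set V := fun s => comp G {a, b}ᶜ (k s) with hLdef
  have hKL : ∀ s, K s ⊆ L s := fun s => (hK s).conn.subset_comp (hK s).subset (hk s)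
  have hLs : ∀ s, L s ⊆ {a, b}ᶜ := fun s => comp_subset
  have hLc : ∀ s, Conn G (L s) := fun s => conn_comp (hkab s)
  have hLcl : ∀ s, ∀ x ∈ L s, ∀ y, y ≠ a → y ≠ b → G.Adj x y → y ∈ L s := by
    intro s x hx y hya hyb hxy
    exact mem_comp_of_adj hx (by simp [hya, hyb]) hxy
  have hBc : ∀ l, l ≠ i → l ≠ j → Conn G (B l) ∧ B l ⊆ {a, b}ᶜ := by
    intro l hli hlj
    have ha : a ∉ B l := fun h => Set.disjoint_left.1 (hB.disj _ _ hli) h hai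
    have hb : b ∉ B l := fun h => Set.disjoint_left.1 (hB.disj _ _ hlj) h hbj
    refine ⟨(hB.conn l).of_forall_adj fun x hx y hy hxy => ?_, ?_⟩
    · rcases hadj hxy with h | ⟨rfl, rfl⟩ | ⟨rfl, rfl⟩
      · exact h
      · exact absurd hx ha
      · exact absurd hy ha
    · rintro x hx (rfl | rfl)
      · exact ha hx
      · exact hb hx
  have hBadj : ∀ l l', l ≠ i → l ≠ j → l' ≠ i → l' ≠ j → W.Adj l l' →
      ∀ x ∈ B l, ∀ y ∈ B l', Joined G {a, b}ᶜ x y := by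
    intro l l' h1 h2 h3 h4 hll x hx y hy
    obtain ⟨p, hp, q, hq, hpq⟩ := hB.adj l l' hll
    obtain ⟨hc, hs⟩ := hBc l h1 h2
    obtain ⟨hc', hs'⟩ := hBc l' h3 h4
    have hpq' : G.Adj p q := by
      rcases hadj hpq with h | ⟨rfl, rfl⟩ | ⟨rfl, rfl⟩
      · exact h
      · exact absurd (hs hp) (by simp)
      · exact absurd (hs hp) (by simp)
    exact (hc.joined hs hx hp).trans
      ((Joined.of_adj (hs hp) (hs' hq) hpq').trans (hc'.joined hs' hq hy))
  -- Otherwise each of the three components would meet some branch set other than `B i` and `B j`;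
  -- by `TwoSplit` two of these are connected off `{a, b}`, which would join two components.
  obtain ⟨m, hm⟩ : ∃ m, ∀ l, l ≠ i → l ≠ j → Disjoint (B l) (L m) := by
    by_contra hcon
    push Not at hcon
    choose l hli hlj hlL using hcon
    simp only [Set.not_disjoint_iff] at hlL
    choose x hxB hxL using hlL
    obtain ⟨s, t, hst, h⟩ := hW i j hij l fun s => ⟨hli s, hlj s⟩
    have hj : Joined G {a, b}ᶜ (x s) (x t) := by
      rcases h with h | h | ⟨r, hri, hrj, h1, h2⟩
      · obtain ⟨hc, hs⟩ := hBc (l s) (hli s) (hlj s)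
        exact hc.joined hs (hxB s) (h ▸ hxB t)
      · exact hBadj _ _ (hli s) (hlj s) (hli t) (hlj t) h _ (hxB s) _ (hxB t)
      · obtain ⟨z, hz⟩ := (hB.conn r).nonempty
        exact (hBadj _ _ (hli s) (hlj s) hri hrj h1 _ (hxB s) _ hz).trans
          (hBadj _ _ hri hrj (hli t) (hlj t) h2 _ hz _ (hxB t))
    exact hsep s t hst _ (hk s) _ (hk t) ((Joined.trans (hxL s) hj).trans (Joined.symm (hxL t)))
  have haL : a ∉ L m := fun h => hLs m h (by simp)
  have hbL : b ∉ L m := fun h => hLs m h (by simp)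
  have haA : Att G (L m) a := (hK m).att_left.mono (hKL m)
  have hbA : Att G (L m) b := (hK m).att_right.mono (hKL m)
  -- Edges of the model at the other branch sets avoid `L m`.
  have hedge : ∀ l, l ≠ i → l ≠ j → ∀ x ∈ B l, ∀ y, (G ⊔ edge a b).Adj x y →
      G.Adj x y ∧ y ∉ L m := by
    intro l hli hlj x hx y hxy
    have hxab := (hBc l hli hlj).2 hx
    simp only [Set.mem_compl_iff, Set.mem_insert_iff, Set.mem_singleton_iff, not_or] at hxab
    have hxy' : G.Adj x y := by
      rcases hadj hxy with h | ⟨rfl, rfl⟩ | ⟨rfl, rfl⟩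
      · exact h
      · exact absurd rfl hxab.1
      · exact absurd rfl hxab.2
    refine ⟨hxy', fun hy => ?_⟩
    exact Set.disjoint_left.1 (hm l hli hlj) hx (hLcl m y hy x hxab.1 hxab.2 hxy'.symm)
  rcases eq_or_ne i j with rfl | hne
  -- With `a` and `b` in one branch set, this set absorbs `L m`, which reconnects `a` to `b` without
  -- the new edge.
  · refine ⟨fun l => if l = i then B i ∪ L m else B l, ?_, ?_, ?_⟩
    · intro l
      by_cases hl : l = i
      · subst hl
        simp only [if_true]
        refine ⟨⟨a, Or.inl hai⟩, ?_⟩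
        intro A hA hcl
        have hLA : (∃ x ∈ L m, x ∈ A) → L m ⊆ A := fun h =>
          (hLc m).2 A h fun x hx hxA y hy => hcl x (Or.inr hx) hxA y (Or.inr hy)
        have habA : a ∈ A ↔ b ∈ A := by
          obtain ⟨p, hp, hap⟩ := haA
          obtain ⟨q, hq, hbq⟩ := hbA
          constructor
          · intro h
            have := hLA ⟨p, hp, hcl a (Or.inl hai) h p (Or.inr hp) hap⟩
            exact hcl q (Or.inr hq) (this hq) b (Or.inl hbj) hbq.symm
          · intro h
            have := hLA ⟨q, hq, hcl b (Or.inl hbj) h q (Or.inr hq) hbq⟩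
            exact hcl p (Or.inr hp) (this hp) a (Or.inl hai) hap.symm
        have hBA : (∃ x ∈ B l, x ∈ A) → B l ⊆ A := fun h =>
          (hB.conn l).2 A h fun x hx hxA y hy hxy => by
            rcases hadj hxy with h | ⟨rfl, rfl⟩ | ⟨rfl, rfl⟩
            · exact hcl x (Or.inl hx) hxA y (Or.inl hy) h
            · exact habA.1 hxA
            · exact habA.2 hxA
        obtain ⟨p, hp, hap⟩ := haA
        obtain ⟨x, hx | hx, hxA⟩ := hA
        · have h1 := hBA ⟨x, hx, hxA⟩
          exact Set.union_subset h1
            (hLA ⟨p, hp, hcl a (Or.inl hai) (h1 hai) p (Or.inr hp) hap⟩)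
        · have h1 := hLA ⟨x, hx, hxA⟩
          exact Set.union_subset
            (hBA ⟨a, hai, hcl p (Or.inr hp) (h1 hp) a (Or.inl hai) hap.symm⟩) h1
      · simp only [hl, if_false]
        exact (hBc l hl hl).1
    · intro l l' hll
      have key : ∀ l, l ≠ i → Disjoint (B i ∪ L m) (B l) := fun l hl =>
        Set.disjoint_union_left.2 ⟨hB.disj _ _ (Ne.symm hl), (hm l hl hl).symm⟩
      by_cases hl : l = i
      · subst hl
        simpa [Ne.symm hll] using key l' (Ne.symm hll)
      · by_cases hl' : l' = i
        · subst hl'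
          simpa [hl] using (key l hl).symm
        · simpa [hl, hl'] using hB.disj l l' hll
    · intro l l' hll
      have key : ∀ l l', l ≠ i → W.Adj l l' →
          ∃ x ∈ B l, ∃ y ∈ (if l' = i then B i ∪ L m else B l'), G.Adj x y := by
        intro l l' hl hll
        obtain ⟨x, hx, y, hy, hxy⟩ := hB.adj l l' hll
        refine ⟨x, hx, y, ?_, (hedge l hl hl x hx y hxy).1⟩
        split_ifs with h
        · exact Or.inl (h ▸ hy)
        · exact hy
      by_cases hl : l = i
      · subst hl
        obtain ⟨x, hx, y, hy, hxy⟩ := key l' l hll.ne.symm hll.symm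
        exact ⟨y, hy, x, by simpa [hll.ne.symm] using hx, hxy.symm⟩
      · obtain ⟨x, hx, y, hy, hxy⟩ := key l l' hl hll
        exact ⟨x, by simpa [hl] using hx, y, hy, hxy⟩
  · have hbi : b ∉ B i := fun h => Set.disjoint_left.1 (hB.disj _ _ hne) h hbj
    have haj : a ∉ B j := fun h => Set.disjoint_left.1 (hB.disj _ _ hne) hai h
    -- With `a` and `b` in different branch sets, the whole of `L m` is handed over to the set of
    -- `b`. It touches `a`, which replaces the new edge between the two sets.
    set B' : ι → Set V := fun l => if l = i then B i \ L m else if l = j then B j ∪ L m else B l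
      with hB'
    have hBi : B' i = B i \ L m := by simp [hB']
    have hBj : B' j = B j ∪ L m := by simp [hB', hne.symm]
    have hBl : ∀ l, l ≠ i → l ≠ j → B' l = B l := fun l h h' => by simp [hB', h, h']
    have hsub : ∀ l, B l \ L m ⊆ B' l := by
      intro l x hx
      by_cases hl : l = i
      · subst hl; rw [hBi]; exact hx
      by_cases hl' : l = j
      · subst hl'; rw [hBj]; exact Or.inl hx.1
      · rw [hBl l hl hl']; exact hx.1
    have hdij : Disjoint (B' i) (B' j) := by
      rw [hBi, hBj, Set.disjoint_left]
      rintro x hx (h | h)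
      · exact Set.disjoint_left.1 (hB.disj _ _ hne) hx.1 h
      · exact hx.2 h
    have hdi : ∀ l, l ≠ i → l ≠ j → Disjoint (B' i) (B' l) := by
      intro l hl hl'
      rw [hBi, hBl l hl hl', Set.disjoint_left]
      exact fun x hx hx' => Set.disjoint_left.1 (hB.disj _ _ hl.symm) hx.1 hx'
    have hdj : ∀ l, l ≠ i → l ≠ j → Disjoint (B' j) (B' l) := by
      intro l hl hl'
      rw [hBj, hBl l hl hl']
      exact Set.disjoint_union_left.2 ⟨hB.disj _ _ hl'.symm, (hm l hl hl').symm⟩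
    have hci : Conn G (B i) := (hB.conn i).of_forall_adj fun x hx y hy hxy => by
      rcases hadj hxy with h | ⟨rfl, rfl⟩ | ⟨rfl, rfl⟩
      · exact h
      · exact absurd hy hbi
      · exact absurd hx hbi
    have hcj : Conn G (B j) := (hB.conn j).of_forall_adj fun x hx y hy hxy => by
      rcases hadj hxy with h | ⟨rfl, rfl⟩ | ⟨rfl, rfl⟩
      · exact h
      · exact absurd hx haj
      · exact absurd hy haj
    have htij : ∃ x ∈ B' i, ∃ y ∈ B' j, G.Adj x y := by
      obtain ⟨p, hp, hap⟩ := haA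
      rw [hBi, hBj]
      exact ⟨a, ⟨hai, haL⟩, p, Or.inr hp, hap⟩
    have htl : ∀ l l', l ≠ i → l ≠ j → W.Adj l l' → ∃ x ∈ B' l, ∃ y ∈ B' l', G.Adj x y := by
      intro l l' hl hl' hll
      obtain ⟨x, hx, y, hy, hxy⟩ := hB.adj l l' hll
      obtain ⟨h1, h2⟩ := hedge l hl hl' x hx y hxy
      exact ⟨x, by rwa [hBl l hl hl'], y, hsub l' ⟨hy, h2⟩, h1⟩
    refine ⟨B', ?_, ?_, ?_⟩
    · intro l
      by_cases hl : l = i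
      · subst hl
        rw [hBi]
        refine ⟨⟨a, hai, haL⟩, ?_⟩
        rintro A ⟨x, hx, hxA⟩ hcl
        -- Inside this branch set `L m` can be entered only through `a`, as `b` is elsewhere. So a
        -- closed set is extended over `L m` or not according to whether it contains `a`.
        have h1 : B l ⊆ (A \ L m) ∪ {z | z ∈ L m ∧ a ∈ A} := by
          refine hci.2 _ ⟨x, hx.1, Or.inl ⟨hxA, hx.2⟩⟩ ?_
          rintro p hp hpA q hq hpq
          by_cases hqL : q ∈ L m
          · refine Or.inr ⟨hqL, ?_⟩
            rcases hpA with hpA | hpA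
            · by_cases hpa : p = a
              · exact hpa ▸ hpA.1
              · have hpb : p ≠ b := fun h => hbi (h ▸ hp)
                exact absurd (hLcl m q hqL p hpa hpb hpq.symm) hpA.2
            · exact hpA.2
          · refine Or.inl ⟨?_, hqL⟩
            rcases hpA with hpA | hpA
            · exact hcl p ⟨hp, hpA.2⟩ hpA.1 q ⟨hq, hqL⟩ hpq
            · by_cases hqa : q = a
              · exact hqa ▸ hpA.2
              · have hqb : q ≠ b := fun h => hbi (h ▸ hq)
                exact absurd (hLcl m p hpA.1 q hqa hqb hpq) hqL
        rintro z ⟨hz, hzL⟩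
        rcases h1 hz with h | h
        · exact h.1
        · exact absurd h.1 hzL
      by_cases hl' : l = j
      · subst hl'
        rw [hBj]
        exact hcj.union_of_att (hLc m) hbj hbA
      · rw [hBl l hl hl']
        exact (hBc l hl hl').1
    · intro l l' hll
      by_cases hl : l = i
      · subst hl
        by_cases hl' : l' = j
        · subst hl'; exact hdij
        · exact hdi l' hll.symm hl'
      by_cases hl' : l = j
      · subst hl'
        by_cases h : l' = i
        · subst h; exact hdij.symm
        · exact hdj l' h hll.symm
      by_cases h1 : l' = i
      · subst h1; exact (hdi l hl hl').symm
      by_cases h2 : l' = j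
      · subst h2; exact (hdj l hl hl').symm
      rw [hBl l hl hl', hBl l' h1 h2]
      exact hB.disj l l' hll
    · have symm : ∀ {A B : Set V}, (∃ x ∈ A, ∃ y ∈ B, G.Adj x y) →
          ∃ x ∈ B, ∃ y ∈ A, G.Adj x y := by
        rintro A B ⟨x, hx, y, hy, hxy⟩
        exact ⟨y, hy, x, hx, hxy.symm⟩
      intro l l' hll
      by_cases hl : l ≠ i ∧ l ≠ j
      · exact htl l l' hl.1 hl.2 hll
      by_cases hl' : l' ≠ i ∧ l' ≠ j
      · exact symm (htl l' l hl'.1 hl'.2 hll.symm)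
      have h1 : l = i ∨ l = j := by tauto
      have h2 : l' = i ∨ l' = j := by tauto
      rcases h1 with rfl | rfl <;> rcases h2 with rfl | rfl
      · exact absurd rfl hll.ne
      · exact htij
      · exact symm htij
      · exact absurd rfl hll.ne

end Link

/-! ### The two forbidden minors have the splitting property. -/

/-- The constant is the adjacency matrix written as a binary number, with bit `6 * x + y` for the
pair `x`, `y`. Adjacency is decided through it in the finite check below. -/
theorem S3_adj_iff (x y : Fin 6) : S3.Adj x y ↔ Nat.testBit 29676317538 (6 * x + y) = true := by
  simp only [S3, fromEdgeSet_adj, Set.mem_insert_iff, Set.mem_singleton_iff]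
  revert x y
  decide
/-- In the 3-sun without `i` and `j`, the vertices `x` and `y` have distance at most two. -/
def S3Close (i j x y : Fin 6) : Prop :=
  x = y ∨ S3.Adj x y ∨ ∃ r, r ≠ i ∧ r ≠ j ∧ S3.Adj x r ∧ S3.Adj r y

instance : DecidableRel S3.Adj := fun x y => decidable_of_iff _ (S3_adj_iff x y).symm

instance (i j x y : Fin 6) : Decidable (S3Close i j x y) :=
  inferInstanceAs (Decidable (x = y ∨ S3.Adj x y ∨
    ∃ r, r ≠ i ∧ r ≠ j ∧ S3.Adj x r ∧ S3.Adj r y))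

/-- An exhaustive check. The tight case is an inner edge, whose removal leaves one isolated tip and
a path on three vertices. -/
theorem S3_pigeonhole : ∀ i j : Fin 6, (i = j ∨ S3.Adj i j) →
    ∀ x : Fin 6, x ≠ i → x ≠ j → ∀ y : Fin 6, y ≠ i → y ≠ j → ∀ z : Fin 6, z ≠ i → z ≠ j →
    S3Close i j x y ∨ S3Close i j y z ∨ S3Close i j x z := by
  set_option maxRecDepth 100000 in
  decide

theorem twoSplit_S3 : TwoSplit S3 := by
  intro i j hij l hl
  rcases S3_pigeonhole i j hij (l 0) (hl 0).1 (hl 0).2 (l 1) (hl 1).1 (hl 1).2 (l 2)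
    (hl 2).1 (hl 2).2 with h | h | h
  · exact ⟨0, 1, by decide, h⟩
  · exact ⟨1, 2, by decide, h⟩
  · exact ⟨0, 2, by decide, h⟩

theorem twoSplit_K4 : TwoSplit K4 := by
  intro i j _ l _
  refine ⟨0, 1, by decide, ?_⟩
  by_cases h : l 0 = l 1
  · exact Or.inl h
  · exact Or.inr (Or.inl h)

/-- The set `U` induces a 2-connected subgraph. -/
structure TwoConn {V : Type u} (G : SimpleGraph V) (U : Set V) : Prop where
  three : ∃ x ∈ U, ∃ y ∈ U, ∃ z ∈ U, x ≠ y ∧ x ≠ z ∧ y ≠ z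
  conn_diff : ∀ x, Conn G (U \ {x})

/-- Any two vertices with three disjoint links between them are adjacent. -/
def LinksAdj {V : Type u} (G : SimpleGraph V) : Prop :=
  ∀ a b, a ≠ b → ∀ K₁ K₂ K₃, IsLink G a b K₁ → IsLink G a b K₂ → IsLink G a b K₃ →
    Disjoint K₁ K₂ → Disjoint K₁ K₃ → Disjoint K₂ K₃ → G.Adj a b

/-! ### The cell completion of a 2-connected graph. -/

section

variable {V : Type u} {G G' : SimpleGraph V} {U : Set V} {a b x : V}

theorem TwoConn.conn (h : TwoConn G U) : Conn G U := by
  obtain ⟨x, hx, y, hy, z, hz, hxy, hxz, hyz⟩ := h.three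
  have := (h.conn_diff x).union (h.conn_diff y) (x := z) ⟨hz, hxz.symm⟩ ⟨hz, hyz.symm⟩
  convert this using 1
  ext w
  simp only [Set.mem_union, Set.mem_sdiff, Set.mem_singleton_iff]
  grind

theorem TwoConn.mono (h : TwoConn G U) (hG : G ≤ G') : TwoConn G' U :=
  ⟨h.three, fun x => (h.conn_diff x).mono hG⟩

/-- A 2-connected set has a vertex outside any two vertices. -/
theorem TwoConn.exists_ne (h : TwoConn G U) (a b : V) : ∃ x ∈ U, x ≠ a ∧ x ≠ b := by
  obtain ⟨x, hx, y, hy, z, hz, hxy, hxz, hyz⟩ := h.three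
  by_contra hcon
  push Not at hcon
  have h1 := hcon x hx
  have h2 := hcon y hy
  have h3 := hcon z hz
  by_cases x = a <;> by_cases y = a <;> grind

theorem IsTwoConnected.twoConn (h : G.IsTwoConnected) : TwoConn G Set.univ := by
  refine ⟨?_, fun x => ?_⟩
  · have := h.1
    rwa [← Set.encard_univ, three_le_encard_iff] at this
  · rw [conn_iff_connected_induce, ← Set.compl_eq_univ_sdiff]
    exact h.2 {x} (by simp)

/-- In a 2-connected set, a component of the complement of two vertices is a link. -/
theorem TwoConn.isLink_comp (h : TwoConn G U) (ha : a ∈ U) (hb : b ∈ U) (hab : a ≠ b)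
    (hx : x ∈ U \ {a, b}) : IsLink G a b (comp G (U \ {a, b}) x) := by
  have hs : comp G (U \ {a, b}) x ⊆ U \ {a, b} := comp_subset
  have key : ∀ c d, U \ {a, b} = U \ {c, d} → c ∈ U → c ≠ d → Att G (comp G (U \ {a, b}) x) c := by
    intro c d hcd hc hne
    have hxd : x ∈ U \ {c, d} := hcd ▸ hx
    simp only [Set.mem_sdiff, Set.mem_insert_iff, Set.mem_singleton_iff, not_or] at hxd
    obtain ⟨p, hp, hpK, q, hq, hqK, hpq⟩ := (h.conn_diff d).exists_adj
      (A := comp G (U \ {a, b}) x) (x := x) (y := c) ⟨hxd.1, hxd.2.2⟩ (mem_comp_self hx)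
      ⟨hc, hne⟩ (fun h => (hcd ▸ hs h).2 (by simp))
    have hqc : q = c := by
      by_contra hqc
      refine hqK (mem_comp_of_adj hpK ?_ hpq)
      rw [hcd]
      exact ⟨hq.1, by simp [hqc, show q ≠ d from hq.2]⟩
    exact ⟨p, hpK, hqc ▸ hpq.symm⟩
  exact ⟨conn_comp hx, fun h => (hs h).2 (by simp), fun h => (hs h).2 (by simp),
    key a b rfl ha hab, key b a (by rw [Set.pair_comm]) hb hab.symm⟩

theorem le_cellCompletion : G ≤ G.cellCompletion := fun _ _ h => Or.inl h

/-- By 2-connectedness three components of `G - {a, b}` are three disjoint links, and they remain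
links in the larger graph. -/
theorem LinksAdj.cellCompletion_le (hG : TwoConn G Set.univ) (hG' : LinksAdj G') (h : G ≤ G') :
    G.cellCompletion ≤ G' := by
  rintro a b (hab | ⟨hab, hc⟩)
  · exact h hab
  · rw [three_le_card_connectedComponent_induce] at hc
    rw [Set.compl_eq_univ_sdiff] at hc
    obtain ⟨x, hx, y, hy, z, hz, hxy, hyz, hxz⟩ := hc
    have hd : ∀ {x y}, ¬ Joined G (Set.univ \ {a, b}) x y →
        Disjoint (comp G (Set.univ \ {a, b}) x) (comp G (Set.univ \ {a, b}) y) := by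
      intro x y hxy
      rw [Set.disjoint_left]
      exact fun p hp hp' => hxy (Joined.trans hp (Joined.symm hp'))
    have hl : ∀ {x}, x ∈ Set.univ \ {a, b} → IsLink G' a b (comp G (Set.univ \ {a, b}) x) :=
      fun hx => (hG.isLink_comp trivial trivial hab hx).mono h
    exact hG' a b hab _ _ _ (hl hx) (hl hy) (hl hz) (hd hxy) (hd hxz) (hd hyz)

theorem IsLink.not_joined_pairwise {K₁ K₂ K₃ : Set V} (hK4 : ¬ HasModel K4 G) (hab : a ≠ b)
    (h₁ : IsLink G a b K₁) (h₂ : IsLink G a b K₂) (h₃ : IsLink G a b K₃) (d₁₂ : Disjoint K₁ K₂)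
    (d₁₃ : Disjoint K₁ K₃) (d₂₃ : Disjoint K₂ K₃) (s t : Fin 3) (hst : s ≠ t) :
    ∀ x ∈ ![K₁, K₂, K₃] s, ∀ y ∈ ![K₁, K₂, K₃] t, ¬ Joined G {a, b}ᶜ x y := by
  intro x hx y hy
  fin_cases s <;> fin_cases t
  · exact absurd rfl hst
  · exact h₁.not_joined hK4 hab h₂ h₃ d₁₂ d₁₃ d₂₃ hx hy
  · exact h₁.not_joined hK4 hab h₃ h₂ d₁₃ d₁₂ d₂₃.symm hx hy
  · exact h₂.not_joined hK4 hab h₁ h₃ d₁₂.symm d₂₃ d₁₃ hx hy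
  · exact absurd rfl hst
  · exact h₂.not_joined hK4 hab h₃ h₁ d₂₃ d₁₂.symm d₁₃.symm hx hy
  · exact h₃.not_joined hK4 hab h₁ h₂ d₁₃.symm d₂₃.symm d₁₂ hx hy
  · exact h₃.not_joined hK4 hab h₂ h₁ d₂₃.symm d₁₃.symm d₁₂.symm hx hy
  · exact absurd rfl hst

/-- Take a maximal supergraph without the two minors. For a pair with three disjoint links
`HasModel.of_sup_edge` allows one more edge, so by maximality this edge is present. -/
theorem exists_linksAdj_supergraph [Finite V] (h4 : ¬ HasModel K4 G) (h3 : ¬ HasModel S3 G) :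
    ∃ H : SimpleGraph V, G ≤ H ∧ ¬ HasModel K4 H ∧ ¬ HasModel S3 H ∧ LinksAdj H := by
  obtain ⟨H, hGH, ⟨h4H, h3H⟩, hmax⟩ := Finite.exists_le_maximal
    (p := fun H : SimpleGraph V => ¬ HasModel K4 H ∧ ¬ HasModel S3 H) ⟨h4, h3⟩
  refine ⟨H, hGH, h4H, h3H, ?_⟩
  intro a b hab K₁ K₂ K₃ h₁ h₂ h₃ d₁₂ d₁₃ d₂₃
  have hK : ∀ s, IsLink H a b (![K₁, K₂, K₃] s) := by
    intro s
    fin_cases s <;> assumption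
  have hsep := IsLink.not_joined_pairwise h4H hab h₁ h₂ h₃ d₁₂ d₁₃ d₂₃
  have hle := hmax (y := H ⊔ edge a b)
    ⟨fun h => h4H (h.of_sup_edge twoSplit_K4 hab hK hsep),
      fun h => h3H (h.of_sup_edge twoSplit_S3 hab hK hsep)⟩ le_sup_left
  refine hle ?_
  rw [sup_adj, edge_adj]
  exact Or.inr ⟨Or.inl ⟨rfl, rfl⟩, hab⟩

/-- The cell completion of a 2-connected graph without minors `K4` and `S3` has no such minors
either, and its vertices with three disjoint links are adjacent. -/
theorem cellCompletion_properties [Finite V] (hG : TwoConn G Set.univ) (h4 : ¬ HasModel K4 G)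
    (h3 : ¬ HasModel S3 G) : ¬ HasModel K4 G.cellCompletion ∧ ¬ HasModel S3 G.cellCompletion ∧
      LinksAdj G.cellCompletion := by
  obtain ⟨H, hGH, h4H, h3H, hH⟩ := exists_linksAdj_supergraph h4 h3
  have hle := LinksAdj.cellCompletion_le hG hH hGH
  have h4T : ¬ HasModel K4 G.cellCompletion := fun h => h4H (h.mono hle)
  refine ⟨h4T, fun h => h3H (h.mono hle), ?_⟩
  intro a b hab K₁ K₂ K₃ h₁ h₂ h₃ d₁₂ d₁₃ d₂₃
  refine Or.inr ⟨hab, ?_⟩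
  rw [three_le_card_connectedComponent_induce]
  obtain ⟨x, hx⟩ := h₁.conn.nonempty
  obtain ⟨y, hy⟩ := h₂.conn.nonempty
  obtain ⟨z, hz⟩ := h₃.conn.nonempty
  have hsep := IsLink.not_joined_pairwise h4T hab h₁ h₂ h₃ d₁₂ d₁₃ d₂₃
  -- Links separated in the cell completion are separated in the subgraph `G`, so the pair was
  -- already joined by definition: completing once suffices.
  have hsep' : ∀ s t, s ≠ t → ∀ x ∈ ![K₁, K₂, K₃] s, ∀ y ∈ ![K₁, K₂, K₃] t,
      ¬ Joined G {a, b}ᶜ x y := fun s t hst x hx y hy h =>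
    hsep s t hst x hx y hy (h.mono le_cellCompletion le_rfl)
  exact ⟨x, h₁.subset hx, y, h₂.subset hy, z, h₃.subset hz, hsep' 0 1 (by decide) x hx y hy,
    hsep' 1 2 (by decide) y hy z hz, hsep' 0 2 (by decide) x hx z hz⟩

end

/-! ### Disjoint links in 2-connected sets, and attachments of outside components. -/

section

variable {V : Type u} {G : SimpleGraph V} {U : Set V} {a b c : V}

/-- Two nonadjacent vertices of a 2-connected set have two disjoint links between them. -/
theorem TwoConn.exists_two_links [Finite V] (h : TwoConn G U) (ha : a ∈ U) (hb : b ∈ U)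
    (hab : a ≠ b) (hadj : ¬ G.Adj a b) :
    ∃ A₁ A₂, A₁ ⊆ U ∧ A₂ ⊆ U ∧ IsLink G a b A₁ ∧ IsLink G a b A₂ ∧ Disjoint A₁ A₂ := by
  -- Menger's theorem for two paths, with sets: `M` grows from `b` while the component of `a`
  -- outside `M` keeps a neighbour of `b`. A maximal `M` is used.
  set p : Set V → Prop := fun M => M ⊆ U ∧ Conn G M ∧ b ∈ M ∧ a ∉ M ∧
    ∃ n ∈ comp G (U \ M) a, G.Adj n b with hp
  have h0 : p {b} := by
    refine ⟨by simpa using hb, conn_singleton b, rfl, hab, ?_⟩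
    obtain ⟨n, hn, hbn⟩ := h.conn.exists_adj_of_ne hb ha hab.symm
    exact ⟨n, (h.conn_diff b).subset_comp le_rfl ⟨ha, hab⟩ ⟨hn, hbn.ne.symm⟩, hbn.symm⟩
  obtain ⟨M, -, ⟨hMU, hM, hbM, haM, n, hnX, hnb⟩, hmax⟩ := Finite.exists_le_maximal (p := p) h0
  set X := comp G (U \ M) a with hX
  have hXs : X ⊆ U \ M := comp_subset
  have haX : a ∈ X := mem_comp_self ⟨ha, haM⟩
  have hXc : Conn G X := conn_comp ⟨ha, haM⟩
  have hna : n ≠ a := fun h => hadj (h ▸ hnb)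
  -- If `M` touches `a`, one link runs inside `M` from a neighbour of `a` to `b`, the other inside
  -- `X` from `a` to the neighbour `n` of `b`.
  by_cases haN : Att G M a
  · obtain ⟨m, hm, ham⟩ := haN
    have hmb : m ≠ b := fun h => hadj (h ▸ ham)
    have hmM : m ∈ M \ {b} := ⟨hm, hmb⟩
    have hnXa : n ∈ X \ {a} := ⟨hnX, hna⟩
    have h1s : comp G (X \ {a}) n ⊆ X \ {a} := comp_subset
    have h2s : comp G (M \ {b}) m ⊆ M \ {b} := comp_subset
    refine ⟨comp G (X \ {a}) n, comp G (M \ {b}) m, fun x hx => (hXs (h1s hx).1).1,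
      fun x hx => hMU (h2s hx).1, ?_, ?_, ?_⟩
    · refine ⟨conn_comp hnXa, fun h => (h1s h).2 rfl, fun h => (hXs (h1s h).1).2 hbM, ?_,
        ⟨n, mem_comp_self hnXa, hnb.symm⟩⟩
      obtain ⟨p, hp, hpA, q, hq, hqA, hpq⟩ := hXc.exists_adj (A := comp G (X \ {a}) n) hnX
        (mem_comp_self hnXa) haX (fun h => (h1s h).2 rfl)
      have : q = a := by
        by_contra hqa
        exact hqA (mem_comp_of_adj hpA ⟨hq, hqa⟩ hpq)
      exact ⟨p, hpA, this ▸ hpq.symm⟩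
    · refine ⟨conn_comp hmM, fun h => haM (h2s h).1, fun h => (h2s h).2 rfl,
        ⟨m, mem_comp_self hmM, ham⟩, ?_⟩
      obtain ⟨p, hp, hpA, q, hq, hqA, hpq⟩ := hM.exists_adj (A := comp G (M \ {b}) m) hm
        (mem_comp_self hmM) hbM (fun h => (h2s h).2 rfl)
      have : q = b := by
        by_contra hqa
        exact hqA (mem_comp_of_adj hpA ⟨hq, hqa⟩ hpq)
      exact ⟨p, hpA, this ▸ hpq.symm⟩
    · rw [Set.disjoint_left]
      exact fun x hx hx' => (hXs (h1s hx).1).2 (h2s hx').1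
  · exfalso
    -- `Y` is the region around `a` without neighbours in `M`. By 2-connectedness it has two
    -- different exits, each attached to `M`, so that either could be added to `M`.
    set Y := comp G {x ∈ X | ¬ Att G M x} a with hY
    have hYs : Y ⊆ {x ∈ X | ¬ Att G M x} := comp_subset
    have haY : a ∈ Y := mem_comp_self ⟨haX, haN⟩
    have hYc : Conn G Y := conn_comp ⟨haX, haN⟩
    have hexit : ∀ d, d ∈ U \ Y → ∃ m ∈ X, m ≠ d ∧ Att G M m ∧ ∃ y ∈ Y, G.Adj y m := by
      intro d hd
      have : ∃ e ∈ U, e ∉ Y ∧ e ≠ d := by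
        by_cases hdb : d = b
        · refine ⟨n, (hXs hnX).1, fun h => (hYs h).2 ⟨b, hbM, hnb⟩, ?_⟩
          rintro rfl
          exact (hXs hnX).2 (hdb ▸ hbM)
        · exact ⟨b, hb, fun h => (hXs (hYs h).1).2 hbM, fun h => hdb h.symm⟩
      obtain ⟨e, heU, heY, hed⟩ := this
      obtain ⟨p, hp, hpY, q, hq, hqY, hpq⟩ := (h.conn_diff d).exists_adj (A := Y)
        (x := a) ⟨ha, fun h => hd.2 (h ▸ haY)⟩ haY (y := e) ⟨heU, hed⟩ heY
      have hqM : q ∉ M := fun h => (hYs hpY).2 ⟨q, h, hpq⟩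
      have hqX : q ∈ X := mem_comp_of_adj (hYs hpY).1 ⟨hq.1, hqM⟩ hpq
      refine ⟨q, hqX, hq.2, ?_, p, hpY, hpq⟩
      by_contra hqN
      exact hqY (mem_comp_of_adj hpY ⟨hqX, hqN⟩ hpq)
    have hbY : b ∉ Y := fun h => (hXs (hYs h).1).2 hbM
    obtain ⟨m₁, hm₁X, -, hm₁N, y₁, hy₁, hym₁⟩ := hexit b ⟨hb, hbY⟩
    obtain ⟨m₂, hm₂X, hm₁₂, hm₂N, y₂, hy₂, hym₂⟩ := hexit m₁
      ⟨(hXs hm₁X).1, fun h => (hYs h).2 hm₁N⟩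
    -- By maximality, adding an exit to `M` must cut `a` off from all neighbours of `b`. The two
    -- exits cannot both do so.
    have hstep : ∀ m ∈ X, Att G M m → ∀ n ∈ comp G (U \ insert m M) a, ¬ G.Adj n b := by
      intro m hmX hmN n hn hnb
      have := hmax (y := insert m M) ⟨Set.insert_subset (hXs hmX).1 hMU, hM.insert_of_att hmN,
        Or.inr hbM, ?_, n, hn, hnb⟩ (Set.subset_insert m M)
      · exact (hXs hmX).2 (this (Set.mem_insert m M))
      · rintro (h | h)
        · exact haN (h ▸ hmN)
        · exact haM h
    -- The other exit of `Y` is still reached after removing one exit.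
    have hreach : ∀ m m' y, m ∈ X → Att G M m → m' ∈ X → m' ≠ m → y ∈ Y → G.Adj y m' →
        m' ∈ comp G (U \ insert m M) a := by
      intro m m' y hmX hmN hm'X hne hy hym
      have hsub : Y ⊆ U \ insert m M := by
        intro z hz
        refine ⟨(hXs (hYs hz).1).1, ?_⟩
        rintro (rfl | h)
        · exact (hYs hz).2 hmN
        · exact (hXs (hYs hz).1).2 h
      refine mem_comp_of_adj (hYc.subset_comp hsub haY hy) ⟨(hXs hm'X).1, ?_⟩ hym
      rintro (h | h)
      · exact hne h
      · exact (hXs hm'X).2 h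
    have hm₂R := hreach m₁ m₂ y₂ hm₁X hm₁N hm₂X hm₁₂ hy₂ hym₂
    have hm₁R := hreach m₂ m₁ y₁ hm₂X hm₂N hm₁X hm₁₂.symm hy₁ hym₁
    have hn₁ : n ≠ m₁ := by
      rintro rfl
      exact hstep _ hm₂X hm₂N _ hm₁R hnb
    have hnX₁ : n ∈ X \ {m₁} := ⟨hnX, hn₁⟩
    set C := comp G (X \ {m₁}) n with hC
    have hCs : C ⊆ X \ {m₁} := comp_subset
    have hCc : Conn G C := conn_comp hnX₁
    have hnC : n ∈ C := mem_comp_self hnX₁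
    have hCU : C ⊆ U \ insert m₁ M := by
      intro z hz
      refine ⟨(hXs (hCs hz).1).1, ?_⟩
      rintro (h | h)
      · exact (hCs hz).2 h
      · exact (hXs (hCs hz).1).2 h
    -- Since `m₁` cuts `n` off from `a`, the component `C` of `n` off `m₁` misses `m₂`. Hence `n` is
    -- reached from `m₁`, and so from `a`, without `m₂`.
    have hm₂C : m₂ ∉ C := by
      intro hm
      exact hstep m₁ hm₁X hm₁N n (Joined.trans hm₂R (hCc.joined hCU hm hnC)) hnb
    obtain ⟨p, hp, hpC, q, hq, hqC, hpq⟩ := hXc.exists_adj (A := C) hnX hnC hm₁X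
      (fun h => (hCs h).2 rfl)
    have hqm : q = m₁ := by
      by_contra hqm
      exact hqC (mem_comp_of_adj hpC ⟨hq, hqm⟩ hpq)
    subst hqm
    have hsub : insert q C ⊆ U \ insert m₂ M := by
      rintro z (rfl | hz)
      · refine ⟨(hXs hq).1, ?_⟩
        rintro (h | h)
        · exact hm₁₂ h.symm
        · exact (hXs hq).2 h
      · refine ⟨(hCU hz).1, ?_⟩
        rintro (rfl | h)
        · exact hm₂C hz
        · exact (hCU hz).2 (Or.inr h)
    exact hstep m₂ hm₂X hm₂N n (Joined.trans hm₁R ((hCc.insert_of_adj hpC hpq).joined hsub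
      (Or.inl rfl) (Or.inr hnC))) hnb

/-- In a 2-connected set, one of two disjoint links can be chosen through a given vertex. -/
theorem TwoConn.exists_two_links_mem [Finite V] (h : TwoConn G U) (ha : a ∈ U) (hb : b ∈ U)
    (hc : c ∈ U) (hab : a ≠ b) (hca : c ≠ a) (hcb : c ≠ b) (hadj : ¬ G.Adj a b) :
    ∃ A₁ A₂, A₁ ⊆ U ∧ A₂ ⊆ U ∧ IsLink G a b A₁ ∧ IsLink G a b A₂ ∧ Disjoint A₁ A₂ ∧ c ∈ A₁ := by
  obtain ⟨A₁, A₂, h₁, h₂, l₁, l₂, d⟩ := h.exists_two_links ha hb hab hadj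
  have hcs : c ∈ U \ {a, b} := ⟨hc, by simp [hca, hcb]⟩
  have hL := h.isLink_comp ha hb hab hcs
  have hLs : comp G (U \ {a, b}) c ⊆ U \ {a, b} := comp_subset
  set L := comp G (U \ {a, b}) c with hLdef
  have hcL : c ∈ L := mem_comp_self hcs
  -- If the component `L` of `c` misses one of the links, `L` itself is the link through `c`.
  -- Otherwise it contains both.
  by_cases d₂ : Disjoint L A₂
  · exact ⟨L, A₂, fun x hx => (hLs hx).1, h₂, hL, l₂, d₂, hcL⟩
  by_cases d₁ : Disjoint L A₁
  · exact ⟨L, A₁, fun x hx => (hLs hx).1, h₁, hL, l₁, d₁, hcL⟩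
  have hsub : ∀ {A}, A ⊆ U → IsLink G a b A → ¬ Disjoint L A → A ⊆ L := by
    intro A hA lA hd
    rw [Set.not_disjoint_iff] at hd
    obtain ⟨x, hxL, hxA⟩ := hd
    rw [hLdef, ← comp_eq_of_mem hxL]
    exact lA.conn.subset_comp (fun y hy => ⟨hA hy, lA.subset hy⟩) hxA
  by_cases hc₁ : c ∈ A₁
  · exact ⟨A₁, A₂, h₁, h₂, l₁, l₂, d, hc₁⟩
  by_cases hc₂ : c ∈ A₂
  · exact ⟨A₂, A₁, h₂, h₁, l₂, l₁, d.symm, hc₂⟩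
  have hcs' : c ∈ L \ (A₁ ∪ A₂) := ⟨hcL, by simp [hc₁, hc₂]⟩
  -- The part of `L` around `c` off both links is left through one of them, and is merged with that
  -- one.
  set C := comp G (L \ (A₁ ∪ A₂)) c with hC
  have hCs : C ⊆ L \ (A₁ ∪ A₂) := comp_subset
  have hcC : c ∈ C := mem_comp_self hcs'
  have hCc : Conn G C := conn_comp hcs'
  obtain ⟨z, hz⟩ := l₁.conn.nonempty
  obtain ⟨p, hp, hpC, q, hq, hqC, hpq⟩ := hL.conn.exists_adj (A := C) hcL hcC
    (hsub h₁ l₁ d₁ hz) (fun h => (hCs h).2 (Or.inl hz))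
  have hq' : q ∈ A₁ ∪ A₂ := by
    by_contra hq'
    exact hqC (mem_comp_of_adj hpC ⟨hq, hq'⟩ hpq)
  have key : ∀ A A', A ⊆ U → A' ⊆ U → IsLink G a b A → IsLink G a b A' → Disjoint A A' →
      Disjoint C A' → q ∈ A →
      ∃ A₁ A₂, A₁ ⊆ U ∧ A₂ ⊆ U ∧ IsLink G a b A₁ ∧ IsLink G a b A₂ ∧ Disjoint A₁ A₂ ∧ c ∈ A₁ := by
    intro A A' hA hA' lA lA' dA dC hqA
    refine ⟨C ∪ A, A', Set.union_subset (fun x hx => (hLs (hCs hx).1).1) hA, hA',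
      ⟨hCc.union_of_adj lA.conn hpC hqA hpq, ?_, ?_, lA.att_left.mono Set.subset_union_right,
        lA.att_right.mono Set.subset_union_right⟩, lA', Set.disjoint_union_left.2 ⟨dC, dA⟩,
      Or.inl hcC⟩
    · rintro (h | h)
      · exact (hLs (hCs h).1).2 (by simp)
      · exact lA.left_notMem h
    · rintro (h | h)
      · exact (hLs (hCs h).1).2 (by simp)
      · exact lA.right_notMem h
  rcases hq' with hq' | hq'
  · exact key A₁ A₂ h₁ h₂ l₁ l₂ d (Set.disjoint_left.2 fun x hx hx' => (hCs hx).2 (Or.inr hx')) hq'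
  · exact key A₂ A₁ h₂ h₁ l₂ l₁ d.symm
      (Set.disjoint_left.2 fun x hx hx' => (hCs hx).2 (Or.inl hx')) hq'

/-- Three disjoint connected subsets of `U` that contain `a`, `b`, `c` and are pairwise
adjacent. -/
def HasRootedTriangle (G : SimpleGraph V) (U : Set V) (a b c : V) : Prop :=
  ∃ A B C, A ⊆ U ∧ B ⊆ U ∧ C ⊆ U ∧ Conn G A ∧ Conn G B ∧ Conn G C ∧ a ∈ A ∧ b ∈ B ∧ c ∈ C ∧
    Disjoint A B ∧ Disjoint A C ∧ Disjoint B C ∧ (∃ x ∈ A, ∃ y ∈ B, G.Adj x y) ∧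
    (∃ x ∈ A, ∃ y ∈ C, G.Adj x y) ∧ ∃ x ∈ B, ∃ y ∈ C, G.Adj x y

theorem HasRootedTriangle.rotate (h : HasRootedTriangle G U a b c) :
    HasRootedTriangle G U c a b := by
  obtain ⟨A, B, C, hA, hB, hC, cA, cB, cC, ha, hb, hc, dAB, dAC, dBC, tAB, ⟨x, hx, y, hy, hxy⟩,
    ⟨z, hz, w, hw, hzw⟩⟩ := h
  exact ⟨C, A, B, hC, hA, hB, cC, cA, cB, hc, ha, hb, dAC.symm, dBC.symm, dAB,
    ⟨y, hy, x, hx, hxy.symm⟩, ⟨w, hw, z, hz, hzw.symm⟩, tAB⟩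

/-- Of two disjoint links between `a` and `b`, the one through `c` is the third set; the other one,
joined to `a`, reaches `{b}`. -/
theorem TwoConn.hasRootedTriangle_of_not_adj [Finite V] (h : TwoConn G U) (ha : a ∈ U)
    (hb : b ∈ U) (hc : c ∈ U) (hab : a ≠ b) (hca : c ≠ a) (hcb : c ≠ b) (hadj : ¬ G.Adj a b) :
    HasRootedTriangle G U a b c := by
  obtain ⟨C, A, hC, hA, lC, lA, d, hcC⟩ := h.exists_two_links_mem ha hb hc hab hca hcb hadj
  obtain ⟨x, hx, hbx⟩ := lA.att_right
  obtain ⟨y, hy, hay⟩ := lC.att_left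
  obtain ⟨z, hz, hbz⟩ := lC.att_right
  refine ⟨insert a A, {b}, C, Set.insert_subset ha hA, by simpa using hb, hC,
    lA.conn.insert_of_att lA.att_left, conn_singleton b, lC.conn, Or.inl rfl, rfl, hcC, ?_, ?_, ?_,
    ⟨x, Or.inr hx, b, rfl, hbx.symm⟩, ⟨a, Or.inl rfl, y, hy, hay⟩, ⟨b, rfl, z, hz, hbz⟩⟩
  · rw [Set.disjoint_singleton_right]
    rintro (h | h)
    · exact hab h.symm
    · exact lA.right_notMem h
  · rw [Set.disjoint_insert_left]
    exact ⟨lC.left_notMem, d.symm⟩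
  · rw [Set.disjoint_singleton_left]
    exact lC.right_notMem

theorem TwoConn.hasRootedTriangle [Finite V] (h : TwoConn G U) (ha : a ∈ U) (hb : b ∈ U)
    (hc : c ∈ U) (hab : a ≠ b) (hac : a ≠ c) (hbc : b ≠ c) : HasRootedTriangle G U a b c := by
  by_cases h1 : G.Adj a b
  swap
  · exact h.hasRootedTriangle_of_not_adj ha hb hc hab hac.symm hbc.symm h1
  by_cases h2 : G.Adj b c
  swap
  · exact (h.hasRootedTriangle_of_not_adj hb hc ha hbc hab hac h2).rotate
  by_cases h3 : G.Adj c a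
  swap
  · exact (h.hasRootedTriangle_of_not_adj hc ha hb hac.symm hbc hab.symm h3).rotate.rotate
  exact ⟨{a}, {b}, {c}, by simpa, by simpa, by simpa, conn_singleton a, conn_singleton b,
    conn_singleton c, rfl, rfl, rfl, by simpa using hab, by simpa using hac, by simpa using hbc,
    ⟨a, rfl, b, rfl, h1⟩, ⟨a, rfl, c, rfl, h3.symm⟩, ⟨b, rfl, c, rfl, h2⟩⟩

/-- A component of the complement of a 2-connected set is attached to the two ends of an edge. -/
theorem TwoConn.exists_attachment [Finite V] (hG : TwoConn G Set.univ) (h4 : ¬ HasModel K4 G)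
    (hl : LinksAdj G) (h : TwoConn G U) {Z : Set V} (hZ : Conn G Z) (hd : Disjoint Z U)
    (hcl : ∀ z ∈ Z, ∀ y, y ∉ U → G.Adj z y → y ∈ Z) :
    ∃ a ∈ U, ∃ b ∈ U, G.Adj a b ∧ Att G Z a ∧ Att G Z b ∧ ∀ c ∈ U, Att G Z c → c = a ∨ c = b := by
  obtain ⟨z, hz⟩ := hZ.nonempty
  have hzU : z ∉ U := Set.disjoint_left.1 hd hz
  have hexit : ∀ d ∈ U, ∃ a ∈ U, a ≠ d ∧ Att G Z a := by
    intro d hd'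
    obtain ⟨e, he, hed, -⟩ := h.exists_ne d d
    obtain ⟨p, hp, hpZ, q, hq, hqZ, hpq⟩ := (hG.conn_diff d).exists_adj (A := Z) (x := z)
      (y := e) ⟨trivial, fun h => hzU (h ▸ hd')⟩ hz ⟨trivial, hed⟩
      (fun h => Set.disjoint_left.1 hd h he)
    refine ⟨q, ?_, hq.2, p, hpZ, hpq.symm⟩
    by_contra hqU
    exact hqZ (hcl p hpZ q hqU hpq)
  obtain ⟨u, hu⟩ := h.conn.nonempty
  obtain ⟨a, ha, -, haZ⟩ := hexit u hu
  obtain ⟨b, hb, hba, hbZ⟩ := hexit a ha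
  have hnot : ∀ x ∈ U, x ∉ Z := fun x hx hx' => Set.disjoint_left.1 hd hx' hx
  refine ⟨a, ha, b, hb, ?_, haZ, hbZ, ?_⟩
  -- Nonadjacent `a` and `b` have two disjoint links inside `U`, and `Z` is a third one.
  · by_contra hadj
    obtain ⟨A₁, A₂, h₁, h₂, l₁, l₂, d⟩ := h.exists_two_links ha hb hba.symm hadj
    exact hadj (hl a b hba.symm A₁ A₂ Z l₁ l₂ ⟨hZ, hnot a ha, hnot b hb, haZ, hbZ⟩ d
      (Set.disjoint_left.2 fun x hx => hnot x (h₁ hx))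
      (Set.disjoint_left.2 fun x hx => hnot x (h₂ hx)))
  · intro c hc hcZ
    by_contra hcon
    push Not at hcon
    -- A third attachment makes `Z` the fourth branch set over a triangle of sets rooted at `a`,
    -- `b`, `c`.
    obtain ⟨A, B, C, hA, hB, hC, cA, cB, cC, haA, hbB, hcC, dAB, dAC, dBC, tAB, tAC, tBC⟩ :=
      h.hasRootedTriangle ha hb hc hba.symm hcon.1.symm hcon.2.symm
    obtain ⟨x, hx, hax⟩ := haZ
    obtain ⟨y, hy, hby⟩ := hbZ
    obtain ⟨w, hw, hcw⟩ := hcZ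
    exact h4 (hasModel_K4 cA cB cC hZ dAB dAC (Set.disjoint_left.2 fun x hx => hnot x (hA hx)) dBC
      (Set.disjoint_left.2 fun x hx => hnot x (hB hx))
      (Set.disjoint_left.2 fun x hx => hnot x (hC hx)) tAB tAC ⟨a, haA, x, hx, hax⟩ tBC
      ⟨b, hbB, y, hy, hby⟩ ⟨c, hcC, w, hw, hcw⟩)

end

/-! ### Cycles as subgraphs, and induced cycles. -/

section

variable {V : Type u} {G : SimpleGraph V} {U : Set V} {a b : V} {C D : G.Subgraph}

theorem isChordlessCycle_iff : IsChordlessCycle C ↔ IsCycleSubgraph C ∧ C.IsInduced := by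
  constructor
  · rintro ⟨a, p, hp, hc, rfl⟩
    exact ⟨⟨a, p, hp, rfl⟩, Walk.isInduced_toSubgraph.2 hc⟩
  · rintro ⟨⟨a, p, hp, rfl⟩, h⟩
    exact ⟨a, p, hp, Walk.isInduced_toSubgraph.1 h, rfl⟩

/-- The subgraph `C` is the cycle through `c 0, …, c (n - 1)`. -/
structure IsPolygon (C : G.Subgraph) (n : ℕ) (c : ℕ → V) : Prop where
  three : 3 ≤ n
  inj : ∀ i j, i < n → j < n → c i = c j → i = j
  mem_verts : ∀ x, x ∈ C.verts ↔ ∃ i < n, c i = x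
  adj : ∀ x y, C.Adj x y ↔ (∃ i, i + 1 < n ∧ s(c i, c (i + 1)) = s(x, y)) ∨
    s(c (n - 1), c 0) = s(x, y)

/-- By rotation and reversal any edge can be made the closing edge. Removing one or both of its ends
then leaves an interval of indices. -/
theorem IsCycleSubgraph.exists_isPolygon {x y : V} (hC : IsCycleSubgraph C) (hxy : C.Adj x y) :
    ∃ n c, IsPolygon C n c ∧ c (n - 1) = x ∧ c 0 = y := by
  classical
  obtain ⟨a, p, hp, rfl⟩ := hC
  obtain ⟨q, hq, hqC, hqy⟩ : ∃ q : G.Walk x x, q.IsCycle ∧ q.toSubgraph = p.toSubgraph ∧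
      q.snd = y := by
    have hx : x ∈ p.support := (Walk.mem_verts_toSubgraph p).1 hxy.fst_mem
    have h1 : (p.rotate x hx).IsCycle := hp.rotate hx
    have h2 : (p.rotate x hx).toSubgraph = p.toSubgraph := p.toSubgraph_rotate hx
    have h3 : y ∈ (p.rotate x hx).toSubgraph.neighborSet x := by rw [h2]; exact hxy
    rw [h1.neighborSet_toSubgraph_endpoint] at h3
    rcases h3 with h3 | h3
    · exact ⟨_, h1, h2, h3.symm⟩
    · refine ⟨_, h1.reverse, by rw [Walk.toSubgraph_reverse, h2], ?_⟩
      rw [Walk.snd_reverse]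
      exact h3.symm
  have hlen := hq.three_le_length
  -- The shift by one puts the base point `x` last and its successor `y` first.
  refine ⟨q.length, fun i => q.getVert (i + 1), ⟨hlen, ?_, ?_, ?_⟩, ?_, hqy⟩
  · intro i j hi hj hij
    have := hq.getVert_injOn (x₁ := i + 1) (x₂ := j + 1) ⟨by omega, by omega⟩
      ⟨by omega, by omega⟩ hij
    omega
  · intro z
    rw [← hqC, Walk.mem_verts_toSubgraph, Walk.mem_support_iff_exists_getVert]
    constructor
    · rintro ⟨i, rfl, hi⟩
      rcases Nat.eq_zero_or_pos i with rfl | hi0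
      · exact ⟨q.length - 1, by omega, by
          rw [Nat.sub_add_cancel (by omega), Walk.getVert_length, Walk.getVert_zero]⟩
      · exact ⟨i - 1, by omega, by rw [Nat.sub_add_cancel hi0]⟩
    · rintro ⟨i, hi, rfl⟩
      exact ⟨i + 1, rfl, by omega⟩
  · intro z w
    rw [← hqC, Walk.toSubgraph_adj_iff]
    constructor
    · rintro ⟨i, hi, hlt⟩
      rcases Nat.eq_zero_or_pos i with rfl | hi0
      · right
        rw [← hi, Nat.sub_add_cancel (by omega), Walk.getVert_length, Walk.getVert_zero]
      · left
        refine ⟨i - 1, by omega, ?_⟩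
        rw [Nat.sub_add_cancel hi0, hi]
    · rintro (⟨i, hi, h⟩ | h)
      · exact ⟨i + 1, h, hi⟩
      · refine ⟨0, ?_, by omega⟩
        rw [← h, Nat.sub_add_cancel (by omega), Walk.getVert_length, Walk.getVert_zero]
  · change q.getVert (q.length - 1 + 1) = x
    rw [Nat.sub_add_cancel (by omega), Walk.getVert_length]

theorem IsPolygon.mem {n : ℕ} {c : ℕ → V} (h : IsPolygon C n c) {i : ℕ} (hi : i < n) :
    c i ∈ C.verts := (h.mem_verts _).2 ⟨i, hi, rfl⟩

theorem IsPolygon.adj_succ {n : ℕ} {c : ℕ → V} (h : IsPolygon C n c) {i : ℕ} (hi : i + 1 < n) :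
    C.Adj (c i) (c (i + 1)) := (h.adj _ _).2 (Or.inl ⟨i, hi, rfl⟩)

theorem IsPolygon.adj_last {n : ℕ} {c : ℕ → V} (h : IsPolygon C n c) :
    C.Adj (c (n - 1)) (c 0) := (h.adj _ _).2 (Or.inr rfl)

theorem IsPolygon.conn_Icc {n : ℕ} {c : ℕ → V} (h : IsPolygon C n c) {l r : ℕ} (hlr : l ≤ r)
    (hr : r < n) : Conn C.spanningCoe (c '' Set.Icc l r) :=
  conn_image_Icc hlr fun _ _ hi => h.adj_succ (by omega)

theorem IsCycleSubgraph.exists_adj (hC : IsCycleSubgraph C) : ∃ x y, C.Adj x y := by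
  obtain ⟨a, p, hp, rfl⟩ := hC
  have := hp.three_le_length
  exact ⟨_, _, (Walk.toSubgraph_adj_iff p).2 ⟨0, rfl, by omega⟩⟩

theorem IsCycleSubgraph.exists_adj_of_mem (hC : IsCycleSubgraph C) {x : V} (hx : x ∈ C.verts) :
    ∃ y, C.Adj x y := by
  obtain ⟨u, v, huv⟩ := hC.exists_adj
  obtain ⟨n, c, hc, -, -⟩ := hC.exists_isPolygon huv
  obtain ⟨i, hi, rfl⟩ := (hc.mem_verts x).1 hx
  rcases Nat.eq_zero_or_pos i with rfl | hi0
  · exact ⟨_, hc.adj_last.symm⟩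
  · have := hc.adj_succ (i := i - 1) (by omega)
    rw [Nat.sub_add_cancel hi0] at this
    exact ⟨_, this.symm⟩

/-- Only the edges of the cycle itself are used, not all of `G`; `IsCycleSubgraph.eq_of_le` depends
on this. -/
theorem IsCycleSubgraph.twoConn_spanningCoe (hC : IsCycleSubgraph C) :
    TwoConn C.spanningCoe C.verts := by
  obtain ⟨u, v, huv⟩ := hC.exists_adj
  obtain ⟨n, c, hc, -, -⟩ := hC.exists_isPolygon huv
  have h3 := hc.three
  refine ⟨⟨c 0, hc.mem (by omega), c 1, hc.mem (by omega), c 2, hc.mem (by omega), ?_, ?_, ?_⟩, ?_⟩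
  · intro h; have := hc.inj _ _ (by omega) (by omega) h; omega
  · intro h; have := hc.inj _ _ (by omega) (by omega) h; omega
  · intro h; have := hc.inj _ _ (by omega) (by omega) h; omega
  · intro x
    by_cases hx : x ∈ C.verts
    · obtain ⟨y, hxy⟩ := hC.exists_adj_of_mem hx
      obtain ⟨n, c, hc, rfl, -⟩ := hC.exists_isPolygon hxy
      have h3 := hc.three
      convert hc.conn_Icc (l := 0) (r := n - 2) (by omega) (by omega) using 1
      ext z
      simp only [Set.mem_sdiff, hc.mem_verts, Set.mem_singleton_iff, Set.mem_image, Set.mem_Icc]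
      constructor
      · rintro ⟨⟨i, hi, rfl⟩, hne⟩
        have : i ≠ n - 1 := fun h => hne (h ▸ rfl)
        exact ⟨i, by omega, rfl⟩
      · rintro ⟨i, hi, rfl⟩
        refine ⟨⟨i, by omega, rfl⟩, fun h => ?_⟩
        have := hc.inj _ _ (by omega) (by omega) h
        omega
    · rw [Set.sdiff_singleton_eq_self hx]
      convert hc.conn_Icc (l := 0) (r := n - 1) (by omega) (by omega) using 1
      ext z
      simp only [hc.mem_verts, Set.mem_image, Set.mem_Icc]
      constructor
      · rintro ⟨i, hi, rfl⟩
        exact ⟨i, by omega, rfl⟩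
      · rintro ⟨i, hi, rfl⟩
        exact ⟨i, by omega, rfl⟩

theorem IsCycleSubgraph.twoConn (hC : IsCycleSubgraph C) : TwoConn G C.verts :=
  hC.twoConn_spanningCoe.mono C.spanningCoe_le

theorem IsCycleSubgraph.conn_diff_pair (hC : IsCycleSubgraph C) (hab : C.Adj a b) :
    Conn G (C.verts \ {a, b}) := by
  obtain ⟨n, c, hc, rfl, rfl⟩ := hC.exists_isPolygon hab
  have h3 := hc.three
  have h := (hc.conn_Icc (l := 1) (r := n - 2) (by omega) (by omega)).mono C.spanningCoe_le
  convert h using 1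
  ext z
  simp only [Set.mem_sdiff, hc.mem_verts, Set.mem_insert_iff, Set.mem_singleton_iff,
    Set.mem_image, Set.mem_Icc]
  constructor
  · rintro ⟨⟨i, hi, rfl⟩, hne⟩
    have h1 : i ≠ n - 1 := fun h => hne (h ▸ Or.inl rfl)
    have h2 : i ≠ 0 := fun h => hne (h ▸ Or.inr rfl)
    exact ⟨i, by omega, rfl⟩
  · rintro ⟨i, hi, rfl⟩
    refine ⟨⟨i, by omega, rfl⟩, ?_⟩
    rintro (h | h)
    · have := hc.inj _ _ (by omega) (by omega) h
      omega
    · have := hc.inj _ _ (by omega) (by omega) h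
      omega

theorem IsCycleSubgraph.ncard_neighborSet (hC : IsCycleSubgraph C) {x : V} (hx : x ∈ C.verts) :
    (C.neighborSet x).ncard = 2 := by
  obtain ⟨a, p, hp, rfl⟩ := hC
  exact hp.ncard_neighborSet_toSubgraph_eq_two ((Walk.mem_verts_toSubgraph p).1 hx)

/-- Both graphs are 2-regular, so at its vertices `D` has all edges of `C`. Its vertex set is
therefore closed in the connected graph `C`. -/
theorem IsCycleSubgraph.eq_of_le (hC : IsCycleSubgraph C) (hD : IsCycleSubgraph D) (h : D ≤ C) :
    D = C := by
  have hn : ∀ x ∈ D.verts, ∀ y, C.Adj x y → D.Adj x y := by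
    intro x hx y hxy
    have h1 := hD.ncard_neighborSet hx
    have h2 := hC.ncard_neighborSet (h.1 hx)
    have h3 : D.neighborSet x = C.neighborSet x :=
      Set.eq_of_subset_of_ncard_le (fun y hy => h.2 hy) (by omega)
        (Set.finite_of_ncard_ne_zero (by omega))
    have h4 : y ∈ C.neighborSet x := hxy
    rw [← h3] at h4
    exact h4
  obtain ⟨x, hx⟩ := hD.twoConn.conn.nonempty
  have hv : C.verts ⊆ D.verts := hC.twoConn_spanningCoe.conn.2 D.verts ⟨x, h.1 hx, hx⟩
    fun x _ hx y _ hxy => (hn x hx y hxy).snd_mem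
  refine le_antisymm h ⟨hv, fun x y hxy => hn x (hv hxy.fst_mem) y hxy⟩

/-- An edge whose ends are both attached to a connected set lies on an induced cycle that
otherwise runs inside this set. -/
theorem exists_induced_cycle {K : Set V} (hab : G.Adj a b) (hK : Conn G K) (haK : a ∉ K)
    (hbK : b ∉ K) (ha : Att G K a) (hb : Att G K b) :
    ∃ C : G.Subgraph, IsCycleSubgraph C ∧ C.IsInduced ∧ C.Adj a b ∧
      C.verts ⊆ insert a (insert b K) := by
  classical
  set S : Set V := insert a (insert b K) with hS
  -- A shortest path from `b` to `a` in this graph, which is `G` on `S` without the edge `ab`, is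
  -- induced there and closes up with `ab` to an induced cycle.
  let G' : SimpleGraph V :=
    { Adj := fun x y => G.Adj x y ∧ x ∈ S ∧ y ∈ S ∧ s(x, y) ≠ s(a, b)
      symm := ⟨fun x y h => ⟨h.1.symm, h.2.2.1, h.2.1, by rw [Sym2.eq_swap]; exact h.2.2.2⟩⟩
      loopless := ⟨fun x h => G.loopless.irrefl x h.1⟩ }
  have hle : G' ≤ G := fun x y h => h.1
  have hKS : K ⊆ S := fun x hx => Or.inr (Or.inr hx)
  have hne : ∀ x ∈ K, ∀ y, s(x, y) ≠ s(a, b) := by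
    intro x hx y h
    have : x ∈ s(a, b) := h ▸ Sym2.mem_mk_left x y
    rcases Sym2.mem_iff.1 this with rfl | rfl
    · exact haK hx
    · exact hbK hx
  have hK' : Conn G' K := hK.of_forall_adj fun x hx y hy hxy => ⟨hxy, hKS hx, hKS hy, hne x hx y⟩
  have hatt : ∀ c ∈ S, Att G K c → Att G' K c := by
    rintro c hc ⟨y, hy, hcy⟩
    exact ⟨y, hy, hcy, hc, hKS hy, by rw [Sym2.eq_swap]; exact hne y hy c⟩
  have hbS : b ∈ S := Or.inr (Or.inl rfl)
  have haS : a ∈ S := Or.inl rfl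
  have hSc : Conn G' S := by
    refine (hK'.insert_of_att (hatt b hbS hb)).insert_of_att ?_
    exact (hatt a haS ha).mono (Set.subset_insert b K)
  have hreach : G'.Reachable b a :=
    ((joined_iff_reachable hbS haS).1 (hSc.joined le_rfl hbS haS)).map
      (Embedding.induce S).toHom
  obtain ⟨q, hq, hql⟩ := hreach.exists_path_of_dist
  have hqS : ∀ x ∈ q.support, x ∈ S := by
    have key : ∀ (u v : V) (q : G'.Walk u v), u ∈ S → ∀ x ∈ q.support, x ∈ S := by
      intro u v q
      induction q with
      | nil => simp +contextual
      | cons h q ih =>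
        intro hu x hx
        rw [Walk.support_cons, List.mem_cons] at hx
        rcases hx with rfl | hx
        · exact hu
        · exact ih h.2.2.1 x hx
    exact key _ _ q hbS
  -- Any other adjacency along the path would be a shortcut.
  have hshort : ∀ i j, i ≤ j → j ≤ q.length → G'.Adj (q.getVert i) (q.getVert j) →
      j = i + 1 := by
    intro i j hij hj hadj
    have h1 := dist_le ((q.take i).append (Walk.cons hadj (q.drop j)))
    rw [Walk.length_append, Walk.length_cons, Walk.take_length, Walk.drop_length, ← hql] at h1
    have h2 : i ≠ j := fun h => hadj.ne (h ▸ rfl)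
    omega
  have hedge : s(a, b) ∉ q.edges := by
    intro h
    have : G'.Adj a b := q.adj_of_mem_edges h
    exact this.2.2.2 rfl
  have hedges : ∀ u v, u ∈ q.support → v ∈ q.support → G.Adj u v → s(u, v) ≠ s(a, b) →
      s(u, v) ∈ q.edges := by
    intro u v hu hv huv hne
    have hadj : G'.Adj u v := ⟨huv, hqS u hu, hqS v hv, hne⟩
    rw [Walk.mem_support_iff_exists_getVert] at hu hv
    obtain ⟨i, rfl, hi⟩ := hu
    obtain ⟨j, rfl, hj⟩ := hv
    rw [← Walk.mem_edges_toSubgraph, Subgraph.mem_edgeSet, Walk.toSubgraph_adj_iff]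
    rcases le_total i j with hij | hij
    · have := hshort i j hij hj hadj
      subst this
      exact ⟨i, rfl, by omega⟩
    · have := hshort j i hij hi hadj.symm
      subst this
      exact ⟨j, Sym2.eq_swap, by omega⟩
  have hcyc : (Walk.cons hab (q.mapLe hle)).IsCycle := by
    rw [Walk.cons_isCycle_iff, Walk.edges_mapLe_eq_edges]
    exact ⟨hq.mapLe hle, hedge⟩
  refine ⟨_, ⟨a, _, hcyc, rfl⟩, ?_, ?_, ?_⟩
  · rw [Walk.isInduced_toSubgraph, Walk.isChordless_iff_forall_mem_edges]
    intro u v hu hv huv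
    have hsupp : ∀ u, u ∈ (Walk.cons hab (q.mapLe hle)).support → u ∈ q.support := by
      intro u hu
      rw [Walk.support_cons, Walk.support_mapLe_eq_support, List.mem_cons] at hu
      rcases hu with rfl | hu
      · exact q.end_mem_support
      · exact hu
    rw [Walk.edges_cons, Walk.edges_mapLe_eq_edges, List.mem_cons]
    by_cases hne : s(u, v) = s(a, b)
    · exact Or.inl hne
    · exact Or.inr (hedges u v (hsupp u hu) (hsupp v hv) huv hne)
  · rw [Walk.toSubgraph_adj_iff]
    exact ⟨0, by simp, by simp⟩
  · intro x hx
    rw [Walk.mem_verts_toSubgraph, Walk.support_cons, Walk.support_mapLe_eq_support,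
      List.mem_cons] at hx
    rcases hx with rfl | hx
    · exact haS
    · exact hqS x hx

end

/-! ### From the absence of the minors to trees of two-boundaried cycles. -/

section

variable {V : Type u} {G : SimpleGraph V} {U : Set V} {a b : V} {C D : G.Subgraph}

theorem Subgraph.IsInduced.eq_induce_top (h : C.IsInduced) :
    C = (⊤ : G.Subgraph).induce C.verts := by
  ext x y
  · rfl
  · rw [Subgraph.induce_adj, Subgraph.top_adj]
    exact ⟨fun hxy => ⟨hxy.fst_mem, hxy.snd_mem, hxy.adj_sub⟩, fun hxy => h hxy.1 hxy.2.1 hxy.2.2⟩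

/-- An induced cycle through `ab` that otherwise runs inside `Z`, where only `a` and `b` among the
vertices of `U` are attached to `Z`, extends a tree of cycles on `U`. -/
theorem isTreeOfCyclesSubgraph_induce_union {Z : Set V}
    (hU : IsTreeOfCyclesSubgraph ((⊤ : G.Subgraph).induce U)) (ha : a ∈ U) (hb : b ∈ U)
    (hd : Disjoint Z U) (hZ : ∀ c ∈ U, Att G Z c → c = a ∨ c = b) (hC : IsCycleSubgraph C)
    (hCi : C.IsInduced) (hab : C.Adj a b) (hCZ : C.verts ⊆ insert a (insert b Z)) :
    IsTreeOfCyclesSubgraph ((⊤ : G.Subgraph).induce (U ∪ C.verts)) := by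
  have hout : ∀ x ∈ C.verts, x ∈ U → x = a ∨ x = b := by
    intro x hx hxU
    rcases hCZ hx with h | h | h
    · exact Or.inl h
    · exact Or.inr h
    · exact absurd hxU (Set.disjoint_left.1 hd h)
  have hZmem : ∀ x ∈ C.verts, x ∉ U → x ∈ Z := by
    intro x hx hxU
    rcases hCZ hx with rfl | rfl | h
    · exact absurd ha hxU
    · exact absurd hb hxU
    · exact h
  have hmem : ∀ x, x = a ∨ x = b → x ∈ C.verts := by
    rintro x (rfl | rfl)
    · exact hab.fst_mem
    · exact hab.snd_mem
  have hmemU : ∀ x, x = a ∨ x = b → x ∈ U := by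
    rintro x (rfl | rfl) <;> assumption
  have hsup : (⊤ : G.Subgraph).induce (U ∪ C.verts) = (⊤ : G.Subgraph).induce U ⊔ C := by
    ext x y
    · rfl
    · simp only [Subgraph.induce_adj, Subgraph.top_adj, Subgraph.sup_adj]
      constructor
      -- An edge from `U` to a vertex of `C` outside `U` starts at `a` or `b`, so both ends lie on
      -- the induced cycle `C`.
      · have key : ∀ x y, x ∈ U → y ∈ C.verts → y ∉ U → G.Adj x y → C.Adj x y := by
          intro x y hx hy hyU hxy
          exact hCi (hmem x (hZ x hx ⟨y, hZmem y hy hyU, hxy⟩)) hy hxy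
        rintro ⟨hx, hy, hxy⟩
        by_cases hxU : x ∈ U <;> by_cases hyU : y ∈ U
        · exact Or.inl ⟨hxU, hyU, hxy⟩
        · exact Or.inr (key x y hxU (hy.resolve_left hyU) hyU hxy)
        · exact Or.inr (key y x hyU (hx.resolve_left hxU) hxU hxy.symm).symm
        · exact Or.inr (hCi (hx.resolve_left hxU) (hy.resolve_left hyU) hxy)
      · rintro (⟨hx, hy, hxy⟩ | hxy)
        · exact ⟨Or.inl hx, Or.inl hy, hxy⟩
        · exact ⟨Or.inr hxy.fst_mem, Or.inr hxy.snd_mem, hxy.adj_sub⟩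
  rw [hsup]
  refine .glue _ C hU hC a b hab.adj_sub ?_
  ext x y
  · simp only [Subgraph.verts_inf, Subgraph.induce_verts, subgraphOfAdj_verts, Set.mem_inter_iff,
      Set.mem_insert_iff, Set.mem_singleton_iff]
    exact ⟨fun h => hout x h.2 h.1, fun h => ⟨hmemU x h, hmem x h⟩⟩
  · simp only [Subgraph.inf_adj, Subgraph.induce_adj, Subgraph.top_adj, subgraphOfAdj_adj]
    constructor
    · rintro ⟨⟨hx, hy, hxy⟩, hxy'⟩
      rcases hout x hxy'.fst_mem hx with rfl | rfl <;> rcases hout y hxy'.snd_mem hy with rfl | rfl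
      · exact absurd rfl hxy.ne
      · rfl
      · exact Sym2.eq_swap
      · exact absurd rfl hxy.ne
    · intro h
      rcases Sym2.eq_iff.1 h with ⟨rfl, rfl⟩ | ⟨rfl, rfl⟩
      · exact ⟨⟨ha, hb, hab.adj_sub⟩, hab⟩
      · exact ⟨⟨hb, ha, hab.adj_sub.symm⟩, hab.symm⟩

theorem TwoConn.union (hU : TwoConn G U) {U' : Set V} (hU' : TwoConn G U') (hab : a ≠ b)
    (ha : a ∈ U) (hb : b ∈ U) (ha' : a ∈ U') (hb' : b ∈ U') : TwoConn G (U ∪ U') := by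
  obtain ⟨x, hx, y, hy, z, hz, h⟩ := hU.three
  refine ⟨⟨x, Or.inl hx, y, Or.inl hy, z, Or.inl hz, h⟩, fun d => ?_⟩
  rw [Set.union_sdiff_distrib]
  by_cases had : a = d
  · have hbd : b ≠ d := fun h => hab (had.trans h.symm)
    exact (hU.conn_diff d).union (hU'.conn_diff d) ⟨hb, hbd⟩ ⟨hb', hbd⟩
  · exact (hU.conn_diff d).union (hU'.conn_diff d) ⟨ha, had⟩ ⟨ha', had⟩

/-- Take a maximal 2-connected vertex set inducing a tree of cycles. A component outside it is
attached at the ends of an edge, and an induced cycle through this edge and the component can be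
glued on. -/
theorem isTreeOfCycles_of_linksAdj [Finite V] (hG : TwoConn G Set.univ) (h4 : ¬ HasModel K4 G)
    (hl : LinksAdj G) : G.IsTreeOfCycles := by
  set p : Set V → Prop := fun U =>
    IsTreeOfCyclesSubgraph ((⊤ : G.Subgraph).induce U) ∧ TwoConn G U with hp
  obtain ⟨U₀, hU₀⟩ : ∃ U, p U := by
    obtain ⟨a, -, y, -, z, -, hay, -⟩ := hG.three
    obtain ⟨b, -, hab⟩ := hG.conn.exists_adj_of_ne (x := a) (y := y) trivial trivial hay
    obtain ⟨w, -, hwa, hwb⟩ := hG.exists_ne a b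
    have hL := hG.isLink_comp (x := w) trivial trivial hab.ne ⟨trivial, by simp [hwa, hwb]⟩
    obtain ⟨C, hC, hCi, -, -⟩ := exists_induced_cycle hab hL.conn hL.left_notMem hL.right_notMem
      hL.att_left hL.att_right
    refine ⟨C.verts, ?_, hC.twoConn⟩
    rw [← hCi.eq_induce_top]
    exact .cycle C hC
  obtain ⟨U, -, ⟨hUt, hU⟩, hmax⟩ := Finite.exists_le_maximal (p := p) hU₀
  have huniv : U = Set.univ := by
    by_contra hne
    obtain ⟨z, hz⟩ := (Set.ne_univ_iff_exists_notMem U).1 hne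
    set Z := comp G Uᶜ z with hZ
    have hZs : Z ⊆ Uᶜ := comp_subset
    have hZc : Conn G Z := conn_comp hz
    have hd : Disjoint Z U := Set.disjoint_left.2 fun x hx => hZs hx
    obtain ⟨a, ha, b, hb, hab, haZ, hbZ, hZab⟩ := hG.exists_attachment h4 hl hU hZc hd
      fun x hx y hy hxy => mem_comp_of_adj hx hy hxy
    obtain ⟨C, hC, hCi, habC, hCZ⟩ := exists_induced_cycle hab hZc (fun h => hZs h ha)
      (fun h => hZs h hb) haZ hbZ
    have hpU : p (U ∪ C.verts) :=
      ⟨isTreeOfCyclesSubgraph_induce_union hUt ha hb hd hZab hC hCi habC hCZ,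
        hU.union hC.twoConn hab.ne ha hb habC.fst_mem habC.snd_mem⟩
    have hle : C.verts ⊆ U := Set.subset_union_right.trans (hmax hpU Set.subset_union_left)
    obtain ⟨w, hw, hwa, hwb⟩ := hC.twoConn.exists_ne a b
    rcases hCZ hw with h | h | h
    · exact hwa h
    · exact hwb h
    · exact hZs h (hle hw)
  subst huniv
  have : (⊤ : G.Subgraph).induce Set.univ = ⊤ := by
    ext x y <;> simp
  rw [this] at hUt
  exact hUt

/-- Beyond an edge separator of a chordless cycle there is a component attached to it. -/
theorem exists_component_of_isEdgeSeparator [Finite V] (hG : TwoConn G Set.univ)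
    (h4 : ¬ HasModel K4 G) (hl : LinksAdj G) (hC : IsChordlessCycle C) {e : Sym2 V}
    (he : e ∈ C.edgeSet) (hsep : G.IsEdgeSeparator e) :
    ∃ Z : Set V, Conn G Z ∧ Disjoint Z C.verts ∧
      (∀ z ∈ Z, ∀ y, y ∉ C.verts → G.Adj z y → y ∈ Z) ∧
      ∀ c ∈ C.verts, Att G Z c ↔ c ∈ e := by
  obtain ⟨D, hD, hne, heD⟩ : ∃ D, IsChordlessCycle D ∧ D ≠ C ∧ e ∈ D.edgeSet := by
    obtain ⟨D, D', hD, hD', hDD, heD, heD'⟩ := hsep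
    by_cases h : D = C
    · exact ⟨D', hD', fun h' => hDD (h.trans h'.symm), heD'⟩
    · exact ⟨D, hD, h, heD⟩
  rw [isChordlessCycle_iff] at hC hD
  obtain ⟨hC, hCi⟩ := hC
  obtain ⟨hD, hDi⟩ := hD
  -- If all vertices of `D` were on the induced cycle `C`, then `D ≤ C`, and the two cycles would
  -- coincide.
  obtain ⟨y, hyD, hyC⟩ : ∃ y ∈ D.verts, y ∉ C.verts := by
    by_contra hcon
    push Not at hcon
    exact hne (hC.eq_of_le hD ⟨hcon, fun x y hxy =>
      hCi (hcon x hxy.fst_mem) (hcon y hxy.snd_mem) hxy.adj_sub⟩)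
  induction e using Sym2.inductionOn with
  | _ p q =>
  rw [Subgraph.mem_edgeSet] at he heD
  set Z := comp G C.vertsᶜ y with hZ
  have hZs : Z ⊆ C.vertsᶜ := comp_subset
  have hZc : Conn G Z := conn_comp hyC
  have hyZ : y ∈ Z := mem_comp_self hyC
  have hd : Disjoint Z C.verts := Set.disjoint_left.2 fun x hx => hZs hx
  have hcl : ∀ z ∈ Z, ∀ y, y ∉ C.verts → G.Adj z y → y ∈ Z :=
    fun x hx y hy hxy => mem_comp_of_adj hx hy hxy
  obtain ⟨a, ha, b, hb, hab, haZ, hbZ, hZab⟩ := hG.exists_attachment h4 hl hC.twoConn hZc hd hcl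
  -- `Z` can be left only through its two attachments `a` and `b`. Applied to `D` without `b`,
  -- without `a` and without both, this shows that `D` contains both and has no further vertex
  -- outside `Z`; so `p` and `q` are `a` and `b`.
  have hcross : ∀ S, Conn G S → y ∈ S → (∃ x ∈ S, x ∉ Z) → a ∈ S ∨ b ∈ S := by
    rintro S hS hyS ⟨x, hxS, hxZ⟩
    obtain ⟨u, hu, huZ, v, hv, hvZ, huv⟩ := hS.exists_adj hyS hyZ hxS hxZ
    have hvC : v ∈ C.verts := by
      by_contra hvC
      exact hvZ (hcl u huZ v hvC huv)
    rcases hZab v hvC ⟨u, huZ, huv.symm⟩ with rfl | rfl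
    · exact Or.inl hv
    · exact Or.inr hv
  have hpZ : p ∉ Z := fun h => hZs h he.fst_mem
  have hqZ : q ∉ Z := fun h => hZs h he.snd_mem
  have hpq : p ≠ q := he.adj_sub.ne
  have hend : ∀ c, ∃ x ∈ D.verts \ {c}, x ∉ Z := by
    intro c
    by_cases hpc : p = c
    · exact ⟨q, ⟨heD.snd_mem, fun h => hpq (hpc.trans (Eq.symm h))⟩, hqZ⟩
    · exact ⟨p, ⟨heD.fst_mem, hpc⟩, hpZ⟩
  have hyc : ∀ c ∈ C.verts, y ≠ c := by
    rintro c hc rfl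
    exact hyC hc
  have haD : a ∈ D.verts := by
    rcases hcross _ (hD.twoConn.conn_diff b) ⟨hyD, hyc b hb⟩ (hend b) with h | h
    · exact h.1
    · exact absurd rfl h.2
  have hbD : b ∈ D.verts := by
    rcases hcross _ (hD.twoConn.conn_diff a) ⟨hyD, hyc a ha⟩ (hend a) with h | h
    · exact absurd rfl h.2
    · exact h.1
  have hDZ : ∀ x ∈ D.verts, x ∉ Z → x = a ∨ x = b := by
    intro x hx hxZ
    by_contra hcon
    rcases hcross _ (hD.conn_diff_pair (hDi haD hbD hab))
      ⟨hyD, by simp [hyc a ha, hyc b hb]⟩ ⟨x, ⟨hx, hcon⟩, hxZ⟩ with h | h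
    · exact h.2 (by simp)
    · exact h.2 (by simp)
  have hp := hDZ p heD.fst_mem hpZ
  have hq := hDZ q heD.snd_mem hqZ
  have hiff : ∀ c, (c = a ∨ c = b) ↔ (c = p ∨ c = q) := by
    intro c
    rcases hp with rfl | rfl <;> rcases hq with rfl | rfl
    · exact absurd rfl hpq
    · rfl
    · exact or_comm
    · exact absurd rfl hpq
  refine ⟨Z, hZc, hd, hcl, fun c hc => ?_⟩
  rw [Sym2.mem_iff, ← hiff]
  refine ⟨hZab c hc, ?_⟩
  rintro (rfl | rfl) <;> assumption

theorem hasModel_S3 {Z₀ A₁ Z₂ A₃ Z₄ A₅ : Set V} (c₀ : Conn G Z₀) (c₁ : Conn G A₁)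
    (c₂ : Conn G Z₂) (c₃ : Conn G A₃) (c₄ : Conn G Z₄) (c₅ : Conn G A₅)
    (d₀₁ : Disjoint Z₀ A₁) (d₀₂ : Disjoint Z₀ Z₂) (d₀₃ : Disjoint Z₀ A₃) (d₀₄ : Disjoint Z₀ Z₄)
    (d₀₅ : Disjoint Z₀ A₅) (d₁₂ : Disjoint A₁ Z₂) (d₁₃ : Disjoint A₁ A₃) (d₁₄ : Disjoint A₁ Z₄)
    (d₁₅ : Disjoint A₁ A₅) (d₂₃ : Disjoint Z₂ A₃) (d₂₄ : Disjoint Z₂ Z₄) (d₂₅ : Disjoint Z₂ A₅)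
    (d₃₄ : Disjoint A₃ Z₄) (d₃₅ : Disjoint A₃ A₅) (d₄₅ : Disjoint Z₄ A₅)
    (t₀₁ : ∃ x ∈ Z₀, ∃ y ∈ A₁, G.Adj x y) (t₁₂ : ∃ x ∈ A₁, ∃ y ∈ Z₂, G.Adj x y)
    (t₂₃ : ∃ x ∈ Z₂, ∃ y ∈ A₃, G.Adj x y) (t₃₄ : ∃ x ∈ A₃, ∃ y ∈ Z₄, G.Adj x y)
    (t₄₅ : ∃ x ∈ Z₄, ∃ y ∈ A₅, G.Adj x y) (t₅₀ : ∃ x ∈ A₅, ∃ y ∈ Z₀, G.Adj x y)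
    (t₁₃ : ∃ x ∈ A₁, ∃ y ∈ A₃, G.Adj x y) (t₃₅ : ∃ x ∈ A₃, ∃ y ∈ A₅, G.Adj x y)
    (t₅₁ : ∃ x ∈ A₅, ∃ y ∈ A₁, G.Adj x y) : HasModel S3 G := by
  have symm : ∀ {A B : Set V}, (∃ x ∈ A, ∃ y ∈ B, G.Adj x y) → ∃ x ∈ B, ∃ y ∈ A, G.Adj x y := by
    rintro A B ⟨x, hx, y, hy, hxy⟩
    exact ⟨y, hy, x, hx, hxy.symm⟩
  refine ⟨![Z₀, A₁, Z₂, A₃, Z₄, A₅], ?_, ?_, ?_⟩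
  · intro i
    fin_cases i <;> assumption
  · intro i j hij
    fin_cases i <;> fin_cases j <;>
      first | exact absurd rfl hij | assumption | (apply Disjoint.symm; assumption)
  · intro i j hij
    fin_cases i <;> fin_cases j <;>
      first | assumption | (apply symm; assumption) | exact absurd hij (by decide)

/-- Three components outside a cycle that are attached to three different edges of the cycle
yield a minor `S3`. -/
theorem IsPolygon.hasModel_S3 {n : ℕ} {c : ℕ → V} (hc : IsPolygon C n c) {i j : ℕ} (hij : i < j)
    (hj : j + 1 < n) {Z₀ Z₁ Z₂ : Set V} (c₀ : Conn G Z₀) (c₁ : Conn G Z₁) (c₂ : Conn G Z₂)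
    (d₀ : Disjoint Z₀ C.verts) (d₁ : Disjoint Z₁ C.verts) (d₂ : Disjoint Z₂ C.verts)
    (d₀₁ : Disjoint Z₀ Z₁) (d₀₂ : Disjoint Z₀ Z₂) (d₁₂ : Disjoint Z₁ Z₂)
    (a₀ : Att G Z₀ (c (n - 1))) (b₀ : Att G Z₀ (c 0)) (a₁ : Att G Z₁ (c i))
    (b₁ : Att G Z₁ (c (i + 1))) (a₂ : Att G Z₂ (c j)) (b₂ : Att G Z₂ (c (j + 1))) :
    HasModel S3 G := by
  have hconn : ∀ {l r}, l ≤ r → r < n → Conn G (c '' Set.Icc l r) :=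
    fun h1 h2 => (hc.conn_Icc h1 h2).mono C.spanningCoe_le
  have hsub : ∀ {l r}, r < n → c '' Set.Icc l r ⊆ C.verts := by
    rintro l r hr _ ⟨k, hk, rfl⟩
    exact hc.mem (lt_of_le_of_lt hk.2 hr)
  have hdisj : ∀ {l r l' r'}, r < l' → r' < n →
      Disjoint (c '' Set.Icc l r) (c '' Set.Icc l' r') := by
    intro l r l' r' h1 h2
    rw [Set.disjoint_left]
    rintro _ ⟨k, hk, rfl⟩ ⟨k', hk', h⟩
    have := hc.inj k' k (lt_of_le_of_lt hk'.2 h2)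
      (by have := hk'.1; have := hk'.2; have := hk.2; omega) h
    have := hk.2
    have := hk'.1
    omega
  have hm : ∀ {l r k}, l ≤ k → k ≤ r → c k ∈ c '' Set.Icc l r := fun h1 h2 => ⟨_, ⟨h1, h2⟩, rfl⟩
  have hatt : ∀ {Z : Set V} {l r k}, l ≤ k → k ≤ r → Att G Z (c k) →
      ∃ x ∈ c '' Set.Icc l r, ∃ y ∈ Z, G.Adj x y := by
    rintro Z l r k h1 h2 ⟨y, hy, h⟩
    exact ⟨_, hm h1 h2, y, hy, h⟩
  have hatt' : ∀ {Z : Set V} {l r k}, l ≤ k → k ≤ r → Att G Z (c k) →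
      ∃ x ∈ Z, ∃ y ∈ c '' Set.Icc l r, G.Adj x y := by
    rintro Z l r k h1 h2 ⟨y, hy, h⟩
    exact ⟨y, hy, _, hm h1 h2, h.symm⟩
  have hi1 : i < n := by omega
  have hj1 : j < n := by omega
  have hn1 : n - 1 < n := by omega
  -- Deleting the three edges cuts the cycle into three arcs. They are pairwise adjacent through the
  -- deleted edges and form the inner triangle; the outside components are the tips.
  refine SimpleGraph.hasModel_S3 (Z₀ := Z₀) (A₁ := c '' Set.Icc 0 i) (Z₂ := Z₁)
    (A₃ := c '' Set.Icc (i + 1) j) (Z₄ := Z₂) (A₅ := c '' Set.Icc (j + 1) (n - 1))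
    c₀ (hconn (by omega) hi1) c₁ (hconn (by omega) hj1) c₂ (hconn (by omega) hn1)
    (d₀.mono_right (hsub hi1)) d₀₁ (d₀.mono_right (hsub hj1)) d₀₂ (d₀.mono_right (hsub hn1))
    (d₁.mono_right (hsub hi1)).symm (hdisj (by omega) hj1) (d₂.mono_right (hsub hi1)).symm
    (hdisj (by omega) hn1) (d₁.mono_right (hsub hj1)) d₁₂ (d₁.mono_right (hsub hn1))
    (d₂.mono_right (hsub hj1)).symm (hdisj (by omega) hn1) (d₂.mono_right (hsub hn1))
    (hatt' le_rfl (by omega) b₀) (hatt (by omega) le_rfl a₁) (hatt' le_rfl (by omega) b₁)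
    (hatt (by omega) le_rfl a₂) (hatt' le_rfl (by omega) b₂) (hatt (by omega) le_rfl a₀)
    ⟨_, hm (by omega) le_rfl, _, hm le_rfl (by omega), (hc.adj_succ (by omega)).adj_sub⟩
    ⟨_, hm (by omega) le_rfl, _, hm le_rfl (by omega), (hc.adj_succ (by omega)).adj_sub⟩
    ⟨_, hm (by omega) le_rfl, _, hm le_rfl (by omega), hc.adj_last.adj_sub⟩

/-- Components beyond different separators are attached to different edges, hence distinct and
disjoint. Three of them on one cycle would give `S3`. -/
theorem isTreeOfTwoBoundariedCycles_of_linksAdj [Finite V] (hG : TwoConn G Set.univ)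
    (h4 : ¬ HasModel K4 G) (hS3 : ¬ HasModel S3 G) (hl : LinksAdj G) :
    G.IsTreeOfTwoBoundariedCycles := by
  refine ⟨isTreeOfCycles_of_linksAdj hG h4 hl, fun C hC => ?_⟩
  by_contra hcon
  have h3le : 3 ≤ {e ∈ C.edgeSet | G.IsEdgeSeparator e}.encard :=
    Order.add_one_le_of_lt (not_le.1 hcon)
  rw [three_le_encard_iff] at h3le
  obtain ⟨e₀, ⟨he₀, hs₀⟩, e₁, ⟨he₁, hs₁⟩, e₂, ⟨he₂, hs₂⟩, h₀₁, h₀₂, h₁₂⟩ := h3le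
  obtain ⟨Z₀, c₀, d₀, l₀, a₀⟩ := exists_component_of_isEdgeSeparator hG h4 hl hC he₀ hs₀
  obtain ⟨Z₁, c₁, d₁, l₁, a₁⟩ := exists_component_of_isEdgeSeparator hG h4 hl hC he₁ hs₁
  obtain ⟨Z₂, c₂, d₂, l₂, a₂⟩ := exists_component_of_isEdgeSeparator hG h4 hl hC he₂ hs₂
  have hsub : ∀ {Z Z' : Set V}, Conn G Z → Disjoint Z C.verts →
      (∀ z ∈ Z', ∀ y, y ∉ C.verts → G.Adj z y → y ∈ Z') → (∃ x ∈ Z, x ∈ Z') → Z ⊆ Z' :=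
    fun hZ hd hl hx => hZ.2 _ hx fun x _ hx' y hy hxy =>
      hl x hx' y (Set.disjoint_left.1 hd hy) hxy
  have hdisj : ∀ {Z Z' : Set V} {e e' : Sym2 V}, Conn G Z → Conn G Z' → Disjoint Z C.verts →
      Disjoint Z' C.verts → (∀ z ∈ Z, ∀ y, y ∉ C.verts → G.Adj z y → y ∈ Z) →
      (∀ z ∈ Z', ∀ y, y ∉ C.verts → G.Adj z y → y ∈ Z') → (∀ c ∈ C.verts, Att G Z c ↔ c ∈ e) →
      (∀ c ∈ C.verts, Att G Z' c ↔ c ∈ e') → e ∈ C.edgeSet → e ≠ e' → Disjoint Z Z' := by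
    intro Z Z' e e' hZ hZ' hd hd' hl hl' ha ha' he hne
    rw [Set.disjoint_left]
    intro x hx hx'
    have heq : Z = Z' := (hsub hZ hd hl' ⟨x, hx, hx'⟩).antisymm (hsub hZ' hd' hl ⟨x, hx', hx⟩)
    subst heq
    apply hne
    induction e using Sym2.inductionOn with
    | _ p q =>
    have hp := (ha' p he.fst_mem).1 ((ha p he.fst_mem).2 (by simp))
    have hq := (ha' q he.snd_mem).1 ((ha q he.snd_mem).2 (by simp))
    exact ((Sym2.mem_and_mem_iff he.adj_sub.ne).1 ⟨hp, hq⟩).symm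
  have d₀₁ := hdisj c₀ c₁ d₀ d₁ l₀ l₁ a₀ a₁ he₀ h₀₁
  have d₀₂ := hdisj c₀ c₂ d₀ d₂ l₀ l₂ a₀ a₂ he₀ h₀₂
  have d₁₂ := hdisj c₁ c₂ d₁ d₂ l₁ l₂ a₁ a₂ he₁ h₁₂
  induction e₀ using Sym2.inductionOn with
  | _ p q =>
  obtain ⟨n, c, hc, rfl, rfl⟩ := (isChordlessCycle_iff.1 hC).1.exists_isPolygon he₀
  have h3 := hc.three
  have hidx : ∀ e ∈ C.edgeSet, s(c (n - 1), c 0) ≠ e → ∃ i, i + 1 < n ∧ e = s(c i, c (i + 1)) := by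
    intro e he hne
    induction e using Sym2.inductionOn with
    | _ x y =>
    rcases (hc.adj x y).1 he with ⟨i, hi, h⟩ | h
    · exact ⟨i, hi, h.symm⟩
    · exact absurd h hne
  obtain ⟨i, hi, rfl⟩ := hidx e₁ he₁ h₀₁
  obtain ⟨j, hj, rfl⟩ := hidx e₂ he₂ h₀₂
  have att : ∀ {Z : Set V} {x y : V}, (∀ c ∈ C.verts, Att G Z c ↔ c ∈ s(x, y)) →
      C.Adj x y → Att G Z x ∧ Att G Z y := fun h hxy =>
    ⟨(h _ hxy.fst_mem).2 (by simp), (h _ hxy.snd_mem).2 (by simp)⟩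
  have A₀ := att a₀ he₀
  have A₁ := att a₁ he₁
  have A₂ := att a₂ he₂
  rcases lt_trichotomy i j with hlt | rfl | hlt
  · exact hS3 (hc.hasModel_S3 hlt hj c₀ c₁ c₂ d₀ d₁ d₂ d₀₁ d₀₂ d₁₂ A₀.1 A₀.2 A₁.1 A₁.2 A₂.1 A₂.2)
  · exact h₁₂ rfl
  · exact hS3 (hc.hasModel_S3 hlt hi c₀ c₂ c₁ d₀ d₂ d₁ d₀₂ d₀₁ d₁₂.symm A₀.1 A₀.2 A₂.1 A₂.2
      A₁.1 A₁.2)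

/-- The cell completion of a 2-connected graph without minors `K4` and `S3` is a tree of
two-boundaried cycles. -/
theorem IsTwoConnected.isTreeOfTwoBoundariedCycles_cellCompletion [Finite V]
    (hG : G.IsTwoConnected) (h4 : ¬ HasModel K4 G) (h3 : ¬ HasModel S3 G) :
    G.cellCompletion.IsTreeOfTwoBoundariedCycles := by
  obtain ⟨h4', h3', hl⟩ := cellCompletion_properties hG.twoConn h4 h3
  exact isTreeOfTwoBoundariedCycles_of_linksAdj (hG.twoConn.mono le_cellCompletion) h4' h3' hl

end

/-! ### From branch sets to minors -/

section

variable {V : Type u} {ι : Type v} {W : SimpleGraph ι} {G : SimpleGraph V}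

theorem Conn.preimage_val {s S : Set V} (h : Conn G S) (hS : S ⊆ s) :
    Conn (G.induce s) (Subtype.val ⁻¹' S) := by
  obtain ⟨x, hx⟩ := h.nonempty
  refine ⟨⟨⟨x, hS hx⟩, hx⟩, ?_⟩
  rintro A ⟨y, hy, hyA⟩ hA z hz
  obtain ⟨w, hwA, hw⟩ := h.2 (Subtype.val '' A) ⟨y, hy, y, hyA, rfl⟩ (by
    rintro _ hp ⟨p, hpA, rfl⟩ q hq hpq
    exact ⟨⟨q, hS hq⟩, hA p hp hpA ⟨q, hS hq⟩ hq hpq, rfl⟩) hz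
  rwa [← Subtype.ext hw]

theorem hasMinor_of_iso_le [Finite V] {G' : SimpleGraph V} (e : W ≃g G') (hle : G' ≤ G) :
    HasMinor W V G := by
  induction hn : G.edgeSet.ncard using Nat.strong_induction_on generalizing G with
  | _ n ih =>
  by_cases hG : G ≤ G'
  · obtain rfl := le_antisymm hle hG
    exact .iso G' e
  · rw [← edgeSet_subset_edgeSet, Set.not_subset] at hG
    obtain ⟨d, hd, hd'⟩ := hG
    refine .deleteEdge G d hd (ih _ ?_ ?_ rfl)
    · rw [← hn, edgeSet_deleteEdges]
      exact Set.ncard_sdiff_singleton_lt_of_mem hd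
    · intro x y hxy
      rw [deleteEdges_adj]
      refine ⟨hle hxy, ?_⟩
      rintro rfl
      exact hd' hxy

open Classical in
/-- The map that merges the vertex `b` into `a`. -/
noncomputable def mergeInto {V : Type u} (a b : V) (hab : a ≠ b) (x : V) : ({b}ᶜ : Set V) :=
  if h : x = b then ⟨a, hab⟩ else ⟨x, h⟩

open Classical in
theorem mergeInto_val {a b : V} (hab : a ≠ b) (x : V) :
    (mergeInto a b hab x : V) = if x = b then a else x := by
  unfold mergeInto
  split_ifs <;> rfl

theorem mergeInto_eq_iff {a b : V} (hab : a ≠ b) (x y : V) :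
    mergeInto a b hab x = mergeInto a b hab y ↔ x = y ∨ (x = a ∧ y = b) ∨ (x = b ∧ y = a) := by
  rw [Subtype.ext_iff, mergeInto_val, mergeInto_val]
  split_ifs <;> grind

theorem contractEdge_adj_mergeInto {a b : V} (hab : a ≠ b) {x y : V} (h : G.Adj x y) :
    mergeInto a b hab x = mergeInto a b hab y ∨
      (G.contractEdge a b).Adj (mergeInto a b hab x) (mergeInto a b hab y) := by
  by_cases hne : mergeInto a b hab x = mergeInto a b hab y
  · exact Or.inl hne
  refine Or.inr ⟨hne, ?_⟩
  unfold mergeInto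
  by_cases hx : x = b <;> by_cases hy : y = b
  · subst hx hy
    exact absurd rfl h.ne
  · subst hx
    simp [hy, h]
  · subst hy
    simp [hx, h]
  · simp [hx, hy, h]

/-- Induction on the number of vertices: delete a vertex outside all branch sets, or contract an
edge inside one. When neither exists, the branch sets are singletons covering `V`, and only edges
are left to delete. -/
theorem HasModel.hasMinor [Finite V] (h : HasModel W G) : HasMinor W V G := by
  induction hn : Nat.card V using Nat.strong_induction_on generalizing V with
  | _ n ih =>
  obtain ⟨B, hB⟩ := h
  have hcard : ∀ b : V, Nat.card ({b}ᶜ : Set V) < n := by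
    intro b
    rw [← hn]
    exact Finite.card_subtype_lt (p := fun x => x ∈ ({b}ᶜ : Set V)) (x := b) (by simp)
  by_cases h1 : ∃ a, ∀ i, a ∉ B i
  · obtain ⟨a, ha⟩ := h1
    have hs : ∀ i, B i ⊆ {a}ᶜ := by
      rintro i x hx rfl
      exact ha i hx
    refine .deleteVertex G a (ih _ (hcard a) ⟨fun i => Subtype.val ⁻¹' B i, ?_, ?_, ?_⟩ rfl)
    · exact fun i => (hB.conn i).preimage_val (hs i)
    · exact fun i j hij => (hB.disj i j hij).preimage _
    · intro i j hij
      obtain ⟨x, hx, y, hy, hxy⟩ := hB.adj i j hij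
      exact ⟨⟨x, hs i hx⟩, hx, ⟨y, hs j hy⟩, hy, hxy⟩
  push Not at h1
  by_cases h2 : ∃ i, ∃ a ∈ B i, ∃ b ∈ B i, a ≠ b
  · obtain ⟨i, a, ha, b, hb, hab⟩ := h2
    obtain ⟨c, hc, hac⟩ := (hB.conn i).exists_adj_of_ne ha hb hab
    have himg : ∀ j k, j ≠ k → ∀ x ∈ B j, ∀ y ∈ B k,
        mergeInto a c hac.ne x ≠ mergeInto a c hac.ne y := by
      intro j k hjk x hx y hy h
      rw [mergeInto_eq_iff] at h
      have hmem : ∀ l z, z ∈ B l → z ∈ B i → l = i := by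
        intro l z hz hz'
        by_contra hli
        exact Set.disjoint_left.1 (hB.disj l i hli) hz hz'
      rcases h with rfl | ⟨rfl, rfl⟩ | ⟨rfl, rfl⟩
      · exact Set.disjoint_left.1 (hB.disj j k hjk) hx hy
      · exact hjk ((hmem j _ hx ha).trans (hmem k _ hy hc).symm)
      · exact hjk ((hmem j _ hx hc).trans (hmem k _ hy ha).symm)
    refine .contract G a c hac
      (ih _ (hcard c) ⟨fun j => mergeInto a c hac.ne '' B j, ?_, ?_, ?_⟩ rfl)
    · exact fun j => (hB.conn j).image _ fun x _ y _ h => contractEdge_adj_mergeInto hac.ne h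
    · intro j k hjk
      rw [Set.disjoint_left]
      rintro _ ⟨x, hx, rfl⟩ ⟨y, hy, h⟩
      exact himg j k hjk x hx y hy h.symm
    · intro j k hjk
      obtain ⟨x, hx, y, hy, hxy⟩ := hB.adj j k hjk
      refine ⟨_, ⟨x, hx, rfl⟩, _, ⟨y, hy, rfl⟩, ?_⟩
      exact (contractEdge_adj_mergeInto hac.ne hxy).resolve_left (himg j k hjk.ne x hx y hy)
  push Not at h2
  choose e he using fun i => (hB.conn i).nonempty
  have hbij : Function.Bijective e := by
    constructor
    · intro i j hij
      by_contra hne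
      exact Set.disjoint_left.1 (hB.disj i j hne) (he i) (hij ▸ he j)
    · intro x
      obtain ⟨i, hi⟩ := h1 x
      exact ⟨i, h2 i _ (he i) x hi⟩
  refine hasMinor_of_iso_le (Iso.map (Equiv.ofBijective e hbij) W) ?_
  intro x y hxy
  obtain ⟨-, i, j, hij, rfl, rfl⟩ := hxy
  obtain ⟨x, hx, y, hy, hxy⟩ := hB.adj i j hij
  have hxi := h2 i _ (he i) x hx
  have hyj := h2 j _ (he j) y hy
  change G.Adj (e i) (e j)
  rwa [hxi, hyj]

end

/-! ### Chordal graphs without `K4` and without 3-suns -/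

/-- Chordal graphs (in terms of connected sets) without `K4` in which no triangle shares all its
edges with other triangles. -/
structure IsTame {V : Type u} (H : SimpleGraph V) : Prop where
  chordal : ∀ x y K, H.Adj x y → Conn H K → x ∉ K → y ∉ K → Att H K x → Att H K y →
    ∃ z ∈ K, H.Adj x z ∧ H.Adj y z
  cliqueFree : ∀ x y z w, H.Adj x y → H.Adj x z → H.Adj x w → H.Adj y z → H.Adj y w → ¬ H.Adj z w
  sunFree : ∀ x y z p q r, H.Adj x y → H.Adj y z → H.Adj x z → p ≠ z → H.Adj x p → H.Adj y p →
    q ≠ x → H.Adj y q → H.Adj z q → r ≠ y → H.Adj x r → ¬ H.Adj z r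

/-! ### Contracting an edge preserves tameness. -/

section Contraction

variable {V : Type u} {W : Type v} {H : SimpleGraph V} {H' : SimpleGraph W} {f : V → W}

/-- The map `f` contracts at most one edge of `H` and its image is the graph `H'`. -/
structure IsEdgeContraction (H : SimpleGraph V) (H' : SimpleGraph W) (f : V → W) : Prop where
  surj : Function.Surjective f
  map_adj : ∀ u v, H.Adj u v → f u = f v ∨ H'.Adj (f u) (f v)
  exists_adj : ∀ x y, H'.Adj x y → ∃ u v, f u = x ∧ f v = y ∧ H.Adj u v
  fiber : ∀ u v, f u = f v → u = v ∨ H.Adj u v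
  fiber_unique : ∀ u u' v v', f u = f u' → u ≠ u' → f v = f v' → v ≠ v' → f u = f v

/-- Fibres are cliques, so a closed part of the preimage is a union of fibres and projects to a
closed part of `K`. -/
theorem IsEdgeContraction.conn_preimage (h : IsEdgeContraction H H' f) {K : Set W}
    (hK : Conn H' K) : Conn H (f ⁻¹' K) := by
  obtain ⟨x, hx⟩ := hK.nonempty
  obtain ⟨u, rfl⟩ := h.surj x
  refine ⟨⟨u, hx⟩, ?_⟩
  rintro A ⟨v, hv, hvA⟩ hA
  have hfib : ∀ u u', f u ∈ K → f u = f u' → u ∈ A → u' ∈ A := by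
    intro u u' hu huu' huA
    rcases h.fiber u u' huu' with rfl | hadj
    · exact huA
    · exact hA u hu huA u' (by rwa [Set.mem_preimage, ← huu']) hadj
  have h1 := hK.2 (f '' A) ⟨f v, hv, v, hvA, rfl⟩ (by
    rintro _ hs ⟨s, hsA, rfl⟩ y hy hsy
    obtain ⟨s', t, hs', rfl, hst⟩ := h.exists_adj _ _ hsy
    have hs'A := hfib s s' hs hs'.symm hsA
    exact ⟨t, hA s' (by rwa [Set.mem_preimage, hs']) hs'A t hy hst, rfl⟩)
  intro w hw
  obtain ⟨w', hw'A, hw'⟩ := h1 hw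
  exact hfib w' w (by rw [hw']; exact hw) hw' hw'A

theorem IsEdgeContraction.adj_of_ne (h : IsEdgeContraction H H' f) {u v : V} (huv : H.Adj u v)
    (hne : f u ≠ f v) : H'.Adj (f u) (f v) := (h.map_adj u v huv).resolve_left hne

/-- Lift `xy` to an edge `uv` and `K` to its preimage. If the vertex attached to `K` is not `u` or
`v` but another one of its fibre, it is first added to the preimage. A common neighbour then lies in
the preimage or is this vertex, which can replace its partner. At most one fibre is nontrivial, so
this happens on one side only. -/
theorem IsEdgeContraction.chordal (h : IsEdgeContraction H H' f) (hH : IsTame H) (x y : W)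
    (K : Set W) (hxy : H'.Adj x y) (hK : Conn H' K) (hx : x ∉ K) (hy : y ∉ K) (ax : Att H' K x)
    (ay : Att H' K y) : ∃ z ∈ K, H'.Adj x z ∧ H'.Adj y z := by
  have hKc := h.conn_preimage hK
  obtain ⟨u, v, rfl, rfl, huv⟩ := h.exists_adj x y hxy
  have hatt : ∀ u, Att H' K (f u) → ∃ u', f u' = f u ∧ Att H (f ⁻¹' K) u' := by
    rintro u ⟨s, hs, hus⟩
    obtain ⟨u', s', hu', rfl, h'⟩ := h.exists_adj _ _ hus
    exact ⟨u', hu', s', hs, h'⟩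
  obtain ⟨u', hu', au'⟩ := hatt u ax
  obtain ⟨v', hv', av'⟩ := hatt v ay
  have hfin : ∀ u₁ v₁ z, f u₁ = f u → f v₁ = f v → z ∈ f ⁻¹' K → H.Adj u₁ z → H.Adj v₁ z →
      ∃ z ∈ K, H'.Adj (f u) z ∧ H'.Adj (f v) z := by
    intro u₁ v₁ z hu₁ hv₁ hz h1 h2
    refine ⟨f z, hz, ?_, ?_⟩
    · rw [← hu₁]
      exact h.adj_of_ne h1 fun h => hx (by rw [← hu₁, h]; exact hz)
    · rw [← hv₁]
      exact h.adj_of_ne h2 fun h => hy (by rw [← hv₁, h]; exact hz)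
  have hdirect : ∀ u₁ v₁, f u₁ = f u → f v₁ = f v → H.Adj u₁ v₁ → Att H (f ⁻¹' K) u₁ →
      Att H (f ⁻¹' K) v₁ → ∃ z ∈ K, H'.Adj (f u) z ∧ H'.Adj (f v) z := by
    intro u₁ v₁ hu₁ hv₁ hadj a₁ a₂
    obtain ⟨z, hz, h1, h2⟩ := hH.chordal u₁ v₁ (f ⁻¹' K) hadj hKc
      (by rw [Set.mem_preimage, hu₁]; exact hx) (by rw [Set.mem_preimage, hv₁]; exact hy) a₁ a₂
    exact hfin u₁ v₁ z hu₁ hv₁ hz h1 h2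
  by_cases huu : u = u'
  · subst huu
    by_cases hvv : v = v'
    · subst hvv
      exact hdirect u v rfl rfl huv au' av'
    · have hvv' : H.Adj v v' := (h.fiber v v' hv'.symm).resolve_left hvv
      obtain ⟨z, hz, h1, h2⟩ := hH.chordal v u (insert v' (f ⁻¹' K)) huv.symm
        (hKc.insert_of_att av') (by
          rintro (h' | h')
          · exact hvv h'
          · exact hy h') (by
          rintro (h' | h')
          · exact hxy.ne (by rw [h', hv'])
          · exact hx h') ⟨v', Or.inl rfl, hvv'⟩ (au'.mono (Set.subset_insert _ _))
      rcases hz with rfl | hz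
      · exact hdirect u z rfl hv' h2 au' av'
      · exact hfin u v z rfl rfl hz h2 h1
  · have hvv : v = v' := by
      by_contra hvv
      exact hxy.ne (h.fiber_unique u u' v v' hu'.symm huu hv'.symm hvv)
    subst hvv
    have huu' : H.Adj u u' := (h.fiber u u' hu'.symm).resolve_left huu
    obtain ⟨z, hz, h1, h2⟩ := hH.chordal u v (insert u' (f ⁻¹' K)) huv
      (hKc.insert_of_att au') (by
        rintro (h' | h')
        · exact huu h'
        · exact hx h') (by
        rintro (h' | h')
        · exact hxy.ne (by rw [h', hu'])
        · exact hy h') ⟨u', Or.inl rfl, huu'⟩ (av'.mono (Set.subset_insert _ _))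
    rcases hz with rfl | hz
    · exact hdirect z v hu' rfl h2.symm au' av'
    · exact hfin u v z rfl rfl hz h1 h2

/-- If `a` and `b` differ, they are adjacent, and chordality is applied to the edge `xy` and the
connected set `{a, b}`. -/
theorem IsTame.exists_common_of_fiber (hH : IsTame H) (h : IsEdgeContraction H H' f)
    {x y a b : V} (hxy : H.Adj x y) (hax : H.Adj a x) (hby : H.Adj b y) (hab : f a = f b)
    (hx : f x ≠ f a) (hy : f y ≠ f a) : ∃ c, f c = f a ∧ H.Adj c x ∧ H.Adj c y := by
  rcases h.fiber a b hab with rfl | hadj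
  · exact ⟨a, rfl, hax, hby⟩
  · obtain ⟨z, hz, h1, h2⟩ := hH.chordal x y {a, b} hxy (conn_pair hadj)
      (by rintro (rfl | rfl) <;> [exact hx rfl; exact hx hab.symm])
      (by rintro (rfl | rfl) <;> [exact hy rfl; exact hy hab.symm])
      ⟨a, by simp, hax.symm⟩ ⟨b, by simp, hby.symm⟩
    refine ⟨z, ?_, h1.symm, h2.symm⟩
    rcases hz with rfl | rfl
    · rfl
    · exact hab.symm

/-- Lifts of the three edges can fail to meet in one fibre only, and there the preceding lemma
supplies a common end. -/
theorem IsEdgeContraction.exists_triangle (h : IsEdgeContraction H H' f) (hH : IsTame H)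
    {x y z : W} (hxy : H'.Adj x y) (hyz : H'.Adj y z) (hxz : H'.Adj x z) :
    ∃ u v w, f u = x ∧ f v = y ∧ f w = z ∧ H.Adj u v ∧ H.Adj v w ∧ H.Adj u w := by
  obtain ⟨u, v, rfl, rfl, huv⟩ := h.exists_adj x y hxy
  obtain ⟨v', w, hv', rfl, hvw⟩ := h.exists_adj _ z hyz
  obtain ⟨u', w', hu', hw', huw⟩ := h.exists_adj _ _ hxz
  by_cases huu : u = u'
  · subst huu
    by_cases hvv : v = v'
    · subst hvv
      obtain ⟨c, hc, h1, h2⟩ := hH.exists_common_of_fiber h (x := u) (y := v) (a := w') (b := w)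
        huv huw.symm hvw.symm hw' (by rw [hw']; exact hxz.ne) (by rw [hw']; exact hyz.ne)
      exact ⟨u, v, c, rfl, rfl, hc.trans hw', huv, h2.symm, h1.symm⟩
    · have hww : w = w' := by
        by_contra hww
        exact hyz.ne (h.fiber_unique v v' w w' hv'.symm hvv hw'.symm hww)
      subst hww
      obtain ⟨c, hc, h1, h2⟩ := hH.exists_common_of_fiber h (x := u) (y := w) (a := v) (b := v')
        huw huv.symm hvw hv'.symm hxy.ne hyz.ne.symm
      exact ⟨u, c, w, rfl, hc, rfl, h1.symm, h2, huw⟩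
  · have hvv : v = v' := by
      by_contra hvv
      exact hxy.ne (h.fiber_unique u u' v v' hu'.symm huu hv'.symm hvv)
    have hww : w = w' := by
      by_contra hww
      exact hxz.ne (h.fiber_unique u u' w w' hu'.symm huu hw'.symm hww)
    subst hvv hww
    obtain ⟨c, hc, h1, h2⟩ := hH.exists_common_of_fiber h (x := v) (y := w) (a := u) (b := u')
      hvw huv huw hu'.symm hxy.ne.symm hxz.ne.symm
    exact ⟨c, v, w, hc, rfl, rfl, h1, hvw, h2⟩

/-- The three triangles at `w` lift with apexes `a`, `b`, `c` in the fibre of `w`. If two apexes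
agree, that vertex sees `x`, `y` and `z`. Otherwise the apexes are pairwise adjacent, and chordality
for `xy` and `{c, b}` provides such a vertex. -/
theorem IsEdgeContraction.cliqueFree_of_fiber (h : IsEdgeContraction H H' f) (hH : IsTame H)
    {x y z : V} {w : W} (hx : ∀ u, f u = f x → u = x) (hy : ∀ u, f u = f y → u = y)
    (hz : ∀ u, f u = f z → u = z) (hxy : H'.Adj (f x) (f y)) (hxz : H'.Adj (f x) (f z))
    (hyz : H'.Adj (f y) (f z)) (hxw : H'.Adj (f x) w) (hyw : H'.Adj (f y) w) :
    ¬ H'.Adj (f z) w := by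
  intro hzw
  have hadj : ∀ {s t : V}, (∀ u, f u = f s → u = s) → (∀ u, f u = f t → u = t) →
      H'.Adj (f s) (f t) → H.Adj s t := by
    intro s t hs ht hst
    obtain ⟨u, v, hu, hv, huv⟩ := h.exists_adj _ _ hst
    rwa [← hs u hu, ← ht v hv]
  have hcommon : ∀ {s t : V}, (∀ u, f u = f s → u = s) → (∀ u, f u = f t → u = t) →
      H'.Adj (f s) (f t) → H'.Adj (f s) w → H'.Adj (f t) w →
      ∃ c, f c = w ∧ H.Adj c s ∧ H.Adj c t := by
    intro s t hs ht hst hsw htw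
    obtain ⟨u, v, c, hu, hv, hc, -, hvc, huc⟩ := h.exists_triangle hH hst htw hsw
    rw [hs u hu] at huc
    rw [ht v hv] at hvc
    exact ⟨c, hc, huc.symm, hvc.symm⟩
  obtain ⟨a, ha, hax, hay⟩ := hcommon hx hy hxy hxw hyw
  obtain ⟨b, hb, hby, hbz⟩ := hcommon hy hz hyz hyw hzw
  obtain ⟨c, hc, hcx, hcz⟩ := hcommon hx hz hxz hxw hzw
  have exy := hadj hx hy hxy
  have exz := hadj hx hz hxz
  have eyz := hadj hy hz hyz
  by_cases hab : a = b
  · subst hab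
    exact hH.cliqueFree a x y z hax hay hbz exy exz eyz
  by_cases hac : a = c
  · subst hac
    exact hH.cliqueFree a x y z hax hay hcz exy exz eyz
  by_cases hbc : b = c
  · subst hbc
    exact hH.cliqueFree b x y z hcx hby hbz exy exz eyz
  have e1 : H.Adj a b := (h.fiber a b (ha.trans hb.symm)).resolve_left hab
  have e2 : H.Adj a c := (h.fiber a c (ha.trans hc.symm)).resolve_left hac
  have e3 : H.Adj b c := (h.fiber b c (hb.trans hc.symm)).resolve_left hbc
  obtain ⟨d, hd, hd1, hd2⟩ := hH.chordal x y {c, b} exy (conn_pair e3.symm)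
    (by rintro (rfl | rfl) <;> exact hxw.ne (by assumption))
    (by rintro (rfl | rfl) <;> exact hyw.ne (by assumption))
    ⟨c, by simp, hcx.symm⟩ ⟨b, by simp, hby.symm⟩
  rcases hd with rfl | rfl
  · exact hH.cliqueFree d x y z hcx hd2.symm hcz exy exz eyz
  · exact hH.cliqueFree d x y z hd1.symm hby hbz exy exz eyz

theorem IsEdgeContraction.isTame (h : IsEdgeContraction H H' f) (hH : IsTame H) : IsTame H' := by
  refine ⟨h.chordal hH, ?_, ?_⟩
  · intro x y z w hxy hxz hxw hyz hyw hzw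
    obtain ⟨x, rfl⟩ := h.surj x
    obtain ⟨y, rfl⟩ := h.surj y
    obtain ⟨z, rfl⟩ := h.surj z
    obtain ⟨w, rfl⟩ := h.surj w
    -- At most one of the four fibres is nontrivial; it takes the role of the fourth vertex in
    -- `IsEdgeContraction.cliqueFree_of_fiber`.
    have hsmall : ∀ s t, f s ≠ f t → ¬ (∀ u, f u = f s → u = s) → ∀ u, f u = f t → u = t := by
      intro s t hst hs u hu
      push Not at hs
      obtain ⟨v, hv, hvs⟩ := hs
      by_contra hut
      exact hst (h.fiber_unique s v t u hv.symm (Ne.symm hvs) hu.symm (Ne.symm hut))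
    by_cases hx : ∀ u, f u = f x → u = x
    swap
    · exact h.cliqueFree_of_fiber hH (hsmall x y hxy.ne hx) (hsmall x z hxz.ne hx)
        (hsmall x w hxw.ne hx) hyz hyw hzw hxy.symm hxz.symm hxw.symm
    by_cases hy : ∀ u, f u = f y → u = y
    swap
    · exact h.cliqueFree_of_fiber hH hx (hsmall y z hyz.ne hy) (hsmall y w hyw.ne hy) hxz hxw hzw
        hxy hyz.symm hyw.symm
    by_cases hz : ∀ u, f u = f z → u = z
    swap
    · exact h.cliqueFree_of_fiber hH hx hy (hsmall z w hzw.ne hz) hxy hxw hyw hxz hyz hzw.symm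
    exact h.cliqueFree_of_fiber hH hx hy hz hxy hxz hyz hxw hyw hzw
  · intro x y z p q r hxy hyz hxz hpz hxp hyp hqx hyq hzq hry hxr hzr
    obtain ⟨u, v, w, rfl, rfl, rfl, huv, hvw, huw⟩ := h.exists_triangle hH hxy hyz hxz
    -- A lift of the triangle on `f u`, `f v`, `p` may use another vertex of a fibre instead of `u`
    -- or `v`. This vertex is then itself a common neighbour of `u` and `v`.
    have key : ∀ u v w p, H.Adj u v → H'.Adj (f u) (f v) → H'.Adj (f u) p → H'.Adj (f v) p →
        f w ≠ f u → f w ≠ f v → p ≠ f w → ∃ p', p' ≠ w ∧ H.Adj u p' ∧ H.Adj v p' := by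
      intro u v w p huv huv' hup hvp hwu hwv hpw
      obtain ⟨u', v', p', hu', hv', rfl, huv'', hvp', hup'⟩ := h.exists_triangle hH huv' hvp hup
      have hp'w : p' ≠ w := fun h => hpw (h ▸ rfl)
      by_cases huu : u = u'
      · subst huu
        by_cases hvv : v = v'
        · subst hvv
          exact ⟨p', hp'w, hup', hvp'⟩
        · exact ⟨v', fun h => hwv (h ▸ hv'), huv'', (h.fiber v v' hv'.symm).resolve_left hvv⟩
      · have hvv : v = v' := by
          by_contra hvv
          exact huv'.ne (h.fiber_unique u u' v v' hu'.symm huu hv'.symm hvv)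
        subst hvv
        exact ⟨u', fun h => hwu (h ▸ hu'), (h.fiber u u' hu'.symm).resolve_left huu, huv''.symm⟩
    obtain ⟨p', hp', h1, h2⟩ := key u v w p huv hxy hxp hyp hxz.ne.symm hyz.ne.symm hpz
    obtain ⟨q', hq', h3, h4⟩ := key v w u q hvw hyz hyq hzq hxy.ne hxz.ne hqx
    obtain ⟨r', hr', h5, h6⟩ := key u w v r huw hxz hxr hzr hxy.ne.symm hyz.ne hry
    exact hH.sunFree u v w p' q' r' huv hvw huw hp' h1 h2 hq' h3 h4 hr' h5 h6

end Contraction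

theorem isEdgeContraction_contractEdge {V : Type u} {H : SimpleGraph V} {a b : V}
    (hab : H.Adj a b) :
    IsEdgeContraction H (H.contractEdge a b) (mergeInto a b hab.ne) := by
  have hval : ∀ x : ({b}ᶜ : Set V), mergeInto a b hab.ne x = x := by
    rintro ⟨x, hx⟩
    have : x ≠ b := hx
    simp [mergeInto, this]
  have hb : mergeInto a b hab.ne b = ⟨a, hab.ne⟩ := by simp [mergeInto]
  refine ⟨fun x => ⟨x, hval x⟩, fun u v h => contractEdge_adj_mergeInto hab.ne h, ?_, ?_, ?_⟩
  · rintro x y ⟨-, h | ⟨hx, h⟩ | ⟨hy, h⟩⟩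
    · exact ⟨x, y, hval x, hval y, h⟩
    · exact ⟨b, y, by rw [hb]; exact Subtype.ext hx.symm, hval y, h⟩
    · exact ⟨x, b, hval x, by rw [hb]; exact Subtype.ext hy.symm, h⟩
  · intro u v huv
    rw [mergeInto_eq_iff] at huv
    rcases huv with h | ⟨rfl, rfl⟩ | ⟨rfl, rfl⟩
    · exact Or.inl h
    · exact Or.inr hab
    · exact Or.inr hab.symm
  · intro u u' v v' huu hu hvv hv
    rw [mergeInto_eq_iff] at huu hvv ⊢
    rcases huu with h | ⟨rfl, rfl⟩ | ⟨rfl, rfl⟩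
    · exact absurd h hu
    all_goals
      rcases hvv with h | ⟨rfl, rfl⟩ | ⟨rfl, rfl⟩
      · exact absurd h hv
      all_goals simp

/-- The graph `G` is a subgraph of a tame graph. -/
def IsSubTame {V : Type u} (G : SimpleGraph V) : Prop :=
  ∃ (X : Type) (H : SimpleGraph X) (f : V → X), IsTame H ∧ Function.Injective f ∧
    ∀ x y, G.Adj x y → H.Adj (f x) (f y)

/-- Deletions keep the host; a contraction is carried out in the host too, which contains the
contracted edge. -/
theorem IsSubTame.of_hasMinor {ι : Type v} {W : SimpleGraph ι} {V : Type u} {G : SimpleGraph V}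
    (h : HasMinor W V G) (hG : IsSubTame G) : IsSubTame W := by
  induction h with
  | iso G e =>
    obtain ⟨X, H, f, hH, hf, hadj⟩ := hG
    exact ⟨X, H, f ∘ e, hH, hf.comp e.injective, fun x y hxy => hadj _ _ (e.map_adj_iff.2 hxy)⟩
  | deleteVertex G a _ ih =>
    obtain ⟨X, H, f, hH, hf, hadj⟩ := hG
    exact ih ⟨X, H, f ∘ Subtype.val, hH, hf.comp Subtype.val_injective,
      fun x y hxy => hadj _ _ hxy⟩
  | deleteEdge G e he _ ih =>
    obtain ⟨X, H, f, hH, hf, hadj⟩ := hG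
    exact ih ⟨X, H, f, hH, hf, fun x y hxy => hadj _ _ (deleteEdges_le {e} hxy)⟩
  | contract G a b hab _ ih =>
    obtain ⟨X, H, f, hH, hf, hadj⟩ := hG
    have hc := isEdgeContraction_contractEdge (hadj a b hab)
    refine ih ⟨_, H.contractEdge (f a) (f b), fun x => ⟨f x, fun h => x.2 (hf h)⟩, hc.isTame hH,
      ?_, ?_⟩
    · intro x y hxy
      exact Subtype.ext (hf (congrArg Subtype.val hxy))
    · rintro x y ⟨hne, h⟩
      refine ⟨fun h => hne (Subtype.ext (hf (congrArg Subtype.val h))), ?_⟩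
      rcases h with h | ⟨hx, h⟩ | ⟨hy, h⟩
      · exact Or.inl (hadj _ _ h)
      · exact Or.inr (Or.inl ⟨congrArg f hx, hadj _ _ h⟩)
      · exact Or.inr (Or.inr ⟨congrArg f hy, hadj _ _ h⟩)

theorem not_isSubTame_K4 : ¬ IsSubTame K4 := by
  rintro ⟨X, H, f, hH, hf, hadj⟩
  have h : ∀ i j : Fin 4, i ≠ j → H.Adj (f i) (f j) := fun i j hij => hadj i j hij
  exact hH.cliqueFree (f 0) (f 1) (f 2) (f 3) (h _ _ (by decide)) (h _ _ (by decide))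
    (h _ _ (by decide)) (h _ _ (by decide)) (h _ _ (by decide)) (h _ _ (by decide))

theorem not_isSubTame_S3 : ¬ IsSubTame S3 := by
  rintro ⟨X, H, f, hH, hf, hadj⟩
  exact hH.sunFree (f 1) (f 3) (f 5) (f 2) (f 4) (f 0) (hadj _ _ (by decide))
    (hadj _ _ (by decide)) (hadj _ _ (by decide)) (hf.ne (by decide)) (hadj _ _ (by decide))
    (hadj _ _ (by decide)) (hf.ne (by decide)) (hadj _ _ (by decide)) (hadj _ _ (by decide))
    (hf.ne (by decide)) (hadj _ _ (by decide)) (hadj _ _ (by decide))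

/-! ### Tame graphs and strongly chordal graphs -/

section

variable {V : Type u} {G H : SimpleGraph V} {a b : V}

/-- An induced cycle through `xy` that otherwise runs in `K` must be a triangle; its third vertex is
the common neighbour. -/
theorem IsChordalGraph.exists_common {x y : V} {K : Set V} (hH : H.IsChordalGraph)
    (hxy : H.Adj x y) (hK : Conn H K) (hx : x ∉ K) (hy : y ∉ K) (ax : Att H K x)
    (ay : Att H K y) : ∃ z ∈ K, H.Adj x z ∧ H.Adj y z := by
  obtain ⟨C, hC, hCi, hxyC, hCK⟩ := exists_induced_cycle hxy hK hx hy ax ay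
  obtain ⟨a, p, hp, hpc, rfl⟩ := isChordlessCycle_iff.2 ⟨hC, hCi⟩
  have hlen : p.length = 3 := by
    by_contra hne
    have := hp.three_le_length
    obtain ⟨e, he⟩ := hH a p hp (by omega)
    exact hpc he
  have h01 : H.Adj (p.getVert 0) (p.getVert 1) := p.adj_getVert_succ (by omega)
  have h12 : H.Adj (p.getVert 1) (p.getVert 2) := p.adj_getVert_succ (by omega)
  have h20 : H.Adj (p.getVert 2) (p.getVert 0) := by
    have := p.adj_getVert_succ (i := 2) (by omega)
    rw [Walk.getVert_zero]
    rwa [show 2 + 1 = p.length by omega, Walk.getVert_length] at this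
  have h3 : p.getVert 3 = p.getVert 0 := by
    rw [Walk.getVert_zero, ← hlen, Walk.getVert_length]
  have hmem : ∀ i, p.getVert i ∈ p.toSubgraph.verts := fun i =>
    (Walk.mem_verts_toSubgraph p).2 (p.getVert_mem_support i)
  obtain ⟨z, hz, hxz, hyz⟩ : ∃ z ∈ p.toSubgraph.verts, H.Adj x z ∧ H.Adj y z := by
    rw [Walk.toSubgraph_adj_iff] at hxyC
    obtain ⟨i, hi, hlt⟩ := hxyC
    have key : ∀ u v z, s(u, v) = s(x, y) → H.Adj u z → H.Adj v z → H.Adj x z ∧ H.Adj y z := by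
      intro u v z h h1 h2
      rcases Sym2.eq_iff.1 h with ⟨rfl, rfl⟩ | ⟨rfl, rfl⟩
      · exact ⟨h1, h2⟩
      · exact ⟨h2, h1⟩
    have hi3 : i = 0 ∨ i = 1 ∨ i = 2 := by omega
    rcases hi3 with rfl | rfl | rfl
    · exact ⟨_, hmem 2, key _ _ _ hi h20.symm h12⟩
    · exact ⟨_, hmem 0, key _ _ _ hi h01.symm h20⟩
    · rw [show 2 + 1 = 3 from rfl, h3] at hi
      exact ⟨_, hmem 1, key _ _ _ hi h12.symm h01⟩
  rcases hCK hz with rfl | rfl | hzK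
  · exact absurd rfl hxz.ne
  · exact absurd rfl hyz.ne
  · exact ⟨z, hzK, hxz, hyz⟩

/-- The clique number excludes `K4`. A triangle with further triangles on all its edges has distinct
apexes, again for want of `K4`, and spans a hexagon, whose odd chord produces a `K4`. -/
theorem IsStronglyChordal.isTame [Finite V] (hH : H.IsStronglyChordal) (hn : H.cliqueNum ≤ 3) :
    IsTame H := by
  classical
  have hK4 : ∀ x y z w, H.Adj x y → H.Adj x z → H.Adj x w → H.Adj y z → H.Adj y w →
      ¬ H.Adj z w := by
    intro x y z w hxy hxz hxw hyz hyw hzw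
    have h4 : H.IsClique (({x, y, z, w} : Finset V) : Set V) := by
      intro u hu v hv huv
      simp only [Finset.coe_insert, Finset.coe_singleton, Set.mem_insert_iff,
        Set.mem_singleton_iff] at hu hv
      rcases hu with rfl | rfl | rfl | rfl <;> rcases hv with rfl | rfl | rfl | rfl <;>
        first | exact absurd rfl huv | assumption | (apply Adj.symm; assumption)
    have hc : ({x, y, z, w} : Finset V).card = 4 := by
      rw [Finset.card_insert_of_notMem, Finset.card_insert_of_notMem,
        Finset.card_insert_of_notMem, Finset.card_singleton]
      · simpa using hzw.ne
      · simp [hyz.ne, hyw.ne]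
      · simp [hxy.ne, hxz.ne, hxw.ne]
    have := h4.card_le_cliqueNum
    omega
  refine ⟨fun x y K hxy hK hx hy ax ay => hH.1.exists_common hxy hK hx hy ax ay, hK4, ?_⟩
  intro x y z p q r hxy hyz hxz hpz hxp hyp hqx hyq hzq hry hxr hzr
  have hpq : p ≠ q := by
    rintro rfl
    exact hK4 x y z p hxy hxz hxp hyz hyp hzq
  have hqr : q ≠ r := by
    rintro rfl
    exact hK4 x y z q hxy hxz hxr hyz hyq hzq
  have hpr : p ≠ r := by
    rintro rfl
    exact hK4 x y z p hxy hxz hxp hyz hyp hzr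
  let c : H.Walk x x := .cons hxp (.cons hyp.symm (.cons hyq (.cons hzq.symm (.cons hzr
    (.cons hxr.symm .nil)))))
  have hc : c.IsCycle := by
    rw [Walk.cons_isCycle_iff]
    simp only [Walk.cons_isPath_iff, Walk.isPath_iff_nil, Walk.nil_nil, Walk.support_cons,
      Walk.support_nil,
      Walk.edges_cons, Walk.edges_nil, List.mem_cons, List.not_mem_nil, or_false, Sym2.eq_iff]
    have := hxy.ne
    have := hyz.ne
    have := hxz.ne
    have := hxp.ne
    have := hyp.ne
    have := hyq.ne
    have := hzq.ne
    have := hxr.ne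
    have := hzr.ne
    grind
  have hlen : c.length = 6 := rfl
  obtain ⟨i, j, hij, hj, hadj, -, h1, -, h2⟩ :=
    hH.2 x c hc (by rw [hlen]; decide) (by omega)
  -- Both arcs have length three, so the chord joins a vertex of the triangle to the apex over the
  -- opposite edge.
  have hij3 : j = i + 3 ∧ i < 3 := by omega
  obtain ⟨rfl, hi⟩ := hij3
  interval_cases i
  · have hxq : H.Adj x q := hadj
    exact hK4 x y z q hxy hxz hxq hyz hyq hzq
  · have hpz' : H.Adj p z := hadj
    exact hK4 x y z p hxy hxz hxp hyz hyp hpz'.symm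
  · have hyr : H.Adj y r := hadj
    exact hK4 x y z r hxy hxz hxr hyz hyr hzr

/-- The vertices of a closed walk, indexed periodically. -/
def Walk.cycVert (p : G.Walk a a) (i : ℕ) : V := p.getVert (i % p.length)

theorem Walk.cycVert_add_length (p : G.Walk a a) (i : ℕ) :
    p.cycVert (i + p.length) = p.cycVert i := by
  simp [Walk.cycVert]

theorem Walk.cycVert_mod (p : G.Walk a a) (i : ℕ) : p.cycVert (i % p.length) = p.cycVert i := by
  simp [Walk.cycVert]

theorem Walk.cycVert_of_lt (p : G.Walk a a) {i : ℕ} (hi : i < p.length) :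
    p.cycVert i = p.getVert i := by
  rw [Walk.cycVert, Nat.mod_eq_of_lt hi]

theorem Walk.cycVert_of_le (p : G.Walk a a) {i : ℕ} (hi : i ≤ p.length) :
    p.cycVert i = p.getVert i := by
  rcases hi.lt_or_eq with h | rfl
  · exact p.cycVert_of_lt h
  · simp [Walk.cycVert]

theorem Walk.IsCycle.adj_cycVert {p : G.Walk a a} (hp : p.IsCycle) (i : ℕ) :
    G.Adj (p.cycVert i) (p.cycVert (i + 1)) := by
  have h3 := hp.three_le_length
  have hlt : i % p.length < p.length := Nat.mod_lt _ (by omega)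
  have h := p.adj_getVert_succ hlt
  rw [← p.cycVert_of_lt hlt, ← p.cycVert_of_le (by omega), p.cycVert_mod] at h
  rwa [← p.cycVert_mod (i + 1), ← Nat.mod_add_mod, p.cycVert_mod]

theorem Walk.IsCycle.eq_of_cycVert_eq {p : G.Walk a a} (hp : p.IsCycle) {i k : ℕ} (hik : i ≤ k)
    (hk : k < i + p.length) (h : p.cycVert i = p.cycVert k) : i = k := by
  have h3 := hp.three_le_length
  have h1 : i % p.length < p.length := Nat.mod_lt _ (by omega)
  have h2 : k % p.length < p.length := Nat.mod_lt _ (by omega)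
  have h4 : i % p.length = k % p.length :=
    hp.getVert_injOn' (x₁ := i % p.length) (x₂ := k % p.length)
      (by simp only [Set.mem_ofPred_eq]; omega) (by simp only [Set.mem_ofPred_eq]; omega) h
  have h5 : (k - i) % p.length = 0 := Nat.sub_mod_eq_zero_of_mod_eq h4.symm
  have h6 : (k - i) % p.length = k - i := Nat.mod_eq_of_lt (by omega)
  omega

theorem Walk.IsCycle.mk_mem_edges_iff {p : G.Walk a a} (_ : p.IsCycle) (x y : V) :
    s(x, y) ∈ p.edges ↔ ∃ i < p.length, s(p.cycVert i, p.cycVert (i + 1)) = s(x, y) := by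
  rw [← Walk.mem_edges_toSubgraph, Subgraph.mem_edgeSet, Walk.toSubgraph_adj_iff]
  constructor
  · rintro ⟨i, h, hi⟩
    exact ⟨i, hi, by rwa [p.cycVert_of_lt hi, p.cycVert_of_le (by omega)]⟩
  · rintro ⟨i, hi, h⟩
    exact ⟨i, by rwa [p.cycVert_of_lt hi, p.cycVert_of_le (by omega)] at h, hi⟩

/-- Chordality for the arc strictly between the two positions; the periodic index lets this arc run
past the base point. -/
theorem IsTame.exists_between (hH : IsTame H) {p : H.Walk a a} (hp : p.IsCycle) {i j : ℕ}
    (hij : i + 2 ≤ j) (hj : j < i + p.length) (hadj : H.Adj (p.cycVert i) (p.cycVert j)) :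
    ∃ k, i < k ∧ k < j ∧ H.Adj (p.cycVert i) (p.cycVert k) ∧
      H.Adj (p.cycVert j) (p.cycVert k) := by
  obtain ⟨_, ⟨k, ⟨hk1, hk2⟩, rfl⟩, h1, h2⟩ := hH.chordal _ _
    (p.cycVert '' Set.Icc (i + 1) (j - 1)) hadj
    (conn_image_Icc (by omega) fun k _ _ => hp.adj_cycVert k)
    (by
      rintro ⟨k, ⟨hk1, hk2⟩, hk⟩
      have := hp.eq_of_cycVert_eq (by omega) (by omega) hk.symm
      omega)
    (by
      rintro ⟨k, ⟨hk1, hk2⟩, hk⟩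
      have := hp.eq_of_cycVert_eq (by omega) (by omega) hk
      omega)
    ⟨_, ⟨i + 1, ⟨le_rfl, by omega⟩, rfl⟩, hp.adj_cycVert i⟩
    ⟨_, ⟨j - 1, ⟨by omega, le_rfl⟩, rfl⟩, by
      have := (hp.adj_cycVert (j - 1)).symm
      rwa [Nat.sub_add_cancel (by omega)] at this⟩
  exact ⟨k, by omega, by omega, h1, h2⟩

/-- The edge between positions `0` and `1` has a common neighbour on the rest of the cycle, and this
is next to at most one of them on the cycle. -/
theorem IsTame.isChordalGraph (hH : IsTame H) : H.IsChordalGraph := by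
  intro a p hp h4
  obtain ⟨k, hk1, hk2, h1, h2⟩ := hH.exists_between hp (i := 1) (j := 0 + p.length) (by omega)
    (by omega) (by rw [p.cycVert_add_length]; exact (hp.adj_cycVert 0).symm)
  rw [p.cycVert_add_length] at h2
  have hmem : ∀ i, p.cycVert i ∈ p.support := fun i => p.getVert_mem_support _
  have hnot : ∀ i j, i + 2 ≤ j → j < p.length → j + 1 < i + p.length →
      s(p.cycVert i, p.cycVert j) ∉ p.edges := by
    intro i j hij hj hji h
    rw [hp.mk_mem_edges_iff] at h
    obtain ⟨l, hl, h⟩ := h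
    have hcases : ∀ {s t}, s < p.length → t ≤ p.length → p.cycVert s = p.cycVert t →
        s = t ∨ (s = 0 ∧ t = p.length) := by
      intro s t hs ht hst
      rcases le_total s t with hle | hle
      · by_cases hlt : t < s + p.length
        · exact Or.inl (hp.eq_of_cycVert_eq hle hlt hst)
        · omega
      · exact Or.inl (hp.eq_of_cycVert_eq hle (by omega) hst.symm).symm
    rcases Sym2.eq_iff.1 h with ⟨e1, e2⟩ | ⟨e1, e2⟩
    · have h1 := hcases (by omega) hl.le e1.symm
      have h2 := hcases (by omega) (by omega) e2.symm
      omega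
    · have h1 := hcases (by omega) hl.le e1.symm
      have h2 := hcases (by omega) (by omega) e2.symm
      omega
  by_cases hk : k = 2
  · subst hk
    refine ⟨s(p.cycVert 0, p.cycVert 2), Walk.isChord_sym2Mk.2 ⟨h2, ?_, hmem _, hmem _⟩⟩
    exact hnot 0 2 (by omega) (by omega) (by omega)
  · refine ⟨s(p.cycVert 1, p.cycVert k), Walk.isChord_sym2Mk.2 ⟨h1, ?_, hmem _, hmem _⟩⟩
    exact hnot 1 k (by omega) (by omega) (by omega)

/-- A common neighbour on the arc of a chord yields a chord with a shorter arc, down to arcs of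
length two. -/
theorem IsTame.exists_ear (hH : IsTame H) {p : H.Walk a a} (hp : p.IsCycle) (d : ℕ) :
    ∀ i, 2 ≤ d → d < p.length → H.Adj (p.cycVert i) (p.cycVert (i + d)) →
      ∃ i, H.Adj (p.cycVert i) (p.cycVert (i + 2)) := by
  induction d using Nat.strong_induction_on with
  | _ d ih =>
  intro i hd hdn hadj
  by_cases h2 : d = 2
  · subst h2
    exact ⟨i, hadj⟩
  obtain ⟨k, hk1, hk2, h1, h2⟩ := hH.exists_between hp (by omega) (by omega) hadj
  by_cases hk : k = i + 1
  · subst hk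
    refine ih (d - 1) (by omega) (i + 1) (by omega) (by omega) ?_
    rw [show i + 1 + (d - 1) = i + d by omega]
    exact h2.symm
  · refine ih (k - i) (by omega) i (by omega) (by omega) ?_
    rwa [show i + (k - i) = k by omega]

theorem hasOddChord_of_cycVert {p : H.Walk a a} {i d : ℕ} (hn : Even p.length) (hd : Odd d)
    (h3 : 3 ≤ d) (hdn : d + 3 ≤ p.length) (h : H.Adj (p.cycVert i) (p.cycVert (i + d))) :
    H.HasOddChord p := by
  have hodd : Odd (p.length - d) := Nat.Even.sub_odd (by omega) hn hd
  have hlt : i % p.length < p.length := Nat.mod_lt _ (by omega)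
  rw [← p.cycVert_mod i, ← p.cycVert_mod (i + d), ← Nat.mod_add_mod, p.cycVert_mod (_ + d)] at h
  generalize i % p.length = i at hlt h
  by_cases hid : i + d < p.length
  · refine ⟨i, i + d, by omega, hid, ?_, ?_, by omega, ?_, by omega⟩
    · rwa [p.cycVert_of_lt hlt, p.cycVert_of_lt hid] at h
    · rwa [Nat.add_sub_cancel_left]
    · rwa [Nat.add_sub_cancel_left]
  -- If the arc passes the base point, the two ends and the two arcs exchange roles.
  · obtain ⟨j, hj⟩ : ∃ j, i + d = j + p.length := ⟨i + d - p.length, by omega⟩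
    rw [hj, p.cycVert_add_length, p.cycVert_of_lt hlt, p.cycVert_of_lt (by omega)] at h
    refine ⟨j, i, by omega, hlt, h.symm, ?_, by omega, ?_, by omega⟩
    · rwa [show i - j = p.length - d by omega]
    · rwa [show p.length - (i - j) = d by omega]

/-- Let `i`, `i + 2` be the ends of an ear and `k` their common neighbour on the long arc. If `k` is
next to one end on the cycle, its edge to the other end is an odd chord. Otherwise the triangle on
`i`, `i + 2`, `k` has further triangles on all three edges, contrary to tameness. -/
theorem IsTame.isStronglyChordal (hH : IsTame H) : H.IsStronglyChordal := by
  refine ⟨hH.isChordalGraph, ?_⟩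
  intro a p hp heven h6
  obtain ⟨i, hi⟩ : ∃ i, H.Adj (p.cycVert i) (p.cycVert (i + 2)) := by
    refine hH.exists_ear hp (p.length - 1) 1 (by omega) (by omega) ?_
    rw [show 1 + (p.length - 1) = 0 + p.length by omega, p.cycVert_add_length]
    exact (hp.adj_cycVert 0).symm
  have hi' : H.Adj (p.cycVert (i + 2)) (p.cycVert (i + p.length)) := by
    rw [p.cycVert_add_length]
    exact hi.symm
  obtain ⟨k, hk1, hk2, h1, h2⟩ := hH.exists_between hp (by omega) (by omega) hi'
  by_cases hk3 : k = i + 3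
  · subst hk3
    rw [p.cycVert_add_length] at h2
    exact hasOddChord_of_cycVert heven (by decide) le_rfl (by omega) h2
  by_cases hkn : k + 1 = i + p.length
  · refine hasOddChord_of_cycVert (i := i + 2) (d := p.length - 3) heven
      (Nat.Even.sub_odd (by omega) heven (by decide)) (by omega) (by omega) ?_
    rwa [show i + 2 + (p.length - 3) = k by omega]
  exfalso
  obtain ⟨q, hq1, hq2, h3, h4⟩ := hH.exists_between hp (by omega) (by omega) h1
  obtain ⟨r, hr1, hr2, h5, h6⟩ := hH.exists_between hp (by omega) (by omega) h2.symm
  rw [p.cycVert_add_length] at h2 h6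
  refine hH.sunFree (p.cycVert i) (p.cycVert (i + 2)) (p.cycVert k) (p.cycVert (i + 1))
    (p.cycVert q) (p.cycVert r) hi h1 h2 ?_ (hp.adj_cycVert i) (hp.adj_cycVert (i + 1)).symm ?_
    h3 h4 ?_ h6 h5
  · intro h
    have := hp.eq_of_cycVert_eq (by omega) (by omega) h
    omega
  · intro h
    have := hp.eq_of_cycVert_eq (by omega) (by omega) h.symm
    omega
  · intro h
    have := hp.eq_of_cycVert_eq (by omega) (by omega) h.symm
    omega

theorem IsTame.cliqueNum_le (hH : IsTame H) : H.cliqueNum ≤ 3 := by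
  classical
  by_contra hcon
  obtain ⟨s, hs⟩ := H.exists_isNClique_cliqueNum
  obtain ⟨t, hts, ht⟩ := Finset.exists_subset_card_eq (s := s) (n := 4) (by rw [hs.card_eq]; omega)
  have hcl : H.IsClique t := hs.isClique.subset (by exact_mod_cast hts)
  obtain ⟨x, y, z, w, hxy, hxz, hxw, hyz, hyw, hzw, rfl⟩ := Finset.card_eq_four.1 ht
  have h : ∀ u ∈ ({x, y, z, w} : Set V), ∀ v ∈ ({x, y, z, w} : Set V), u ≠ v → H.Adj u v := by
    intro u hu v hv huv
    exact hcl (by simpa using hu) (by simpa using hv) huv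
  exact hH.cliqueFree x y z w (h _ (by simp) _ (by simp) hxy) (h _ (by simp) _ (by simp) hxz)
    (h _ (by simp) _ (by simp) hxw) (h _ (by simp) _ (by simp) hyz) (h _ (by simp) _ (by simp) hyw)
    (h _ (by simp) _ (by simp) hzw)

theorem IsTame.comap {W : Type v} {f : W → V} (hf : Function.Injective f) (hH : IsTame H) :
    IsTame (H.comap f) := by
  refine ⟨?_, ?_, ?_⟩
  · rintro x y K hxy hK hx hy ⟨s, hs, hxs⟩ ⟨t, ht, hyt⟩
    obtain ⟨_, ⟨z, hz, rfl⟩, h1, h2⟩ := hH.chordal (f x) (f y) (f '' K) hxy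
      (hK.image f fun u _ v _ h => Or.inr h)
      (by rintro ⟨z, hz, h⟩; exact hx (hf h ▸ hz)) (by rintro ⟨z, hz, h⟩; exact hy (hf h ▸ hz))
      ⟨_, ⟨s, hs, rfl⟩, hxs⟩ ⟨_, ⟨t, ht, rfl⟩, hyt⟩
    exact ⟨z, hz, h1, h2⟩
  · intro x y z w
    exact hH.cliqueFree (f x) (f y) (f z) (f w)
  · intro x y z p q r h1 h2 h3 hpz h4 h5 hqx h6 h7 hry
    exact hH.sunFree (f x) (f y) (f z) (f p) (f q) (f r) h1 h2 h3 (hf.ne hpz) h4 h5 (hf.ne hqx)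
      h6 h7 (hf.ne hry)

theorem isTame_bot : IsTame (⊥ : SimpleGraph V) :=
  ⟨fun _ _ _ h => h.elim, fun _ _ _ _ h => h.elim, fun _ _ _ _ _ _ h => h.elim⟩

/-- Complete graphs show that the set whose infimum is `sctw` is nonempty, so that the infimum is
attained. -/
theorem isStronglyChordal_top : (⊤ : SimpleGraph V).IsStronglyChordal := by
  constructor
  · intro a p hp h4
    have hne : ∀ i j, i < p.length → j < p.length → i ≠ j → p.getVert i ≠ p.getVert j := by
      intro i j hi hj hij h
      exact hij (hp.getVert_injOn' (by simp only [Set.mem_ofPred_eq]; omega)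
        (by simp only [Set.mem_ofPred_eq]; omega) h)
    refine ⟨s(p.getVert 0, p.getVert 2), Walk.isChord_sym2Mk.2 ⟨hne 0 2 (by omega) (by omega)
      (by omega), ?_, p.getVert_mem_support _, p.getVert_mem_support _⟩⟩
    rw [← Walk.mem_edges_toSubgraph, Subgraph.mem_edgeSet, Walk.toSubgraph_adj_iff]
    rintro ⟨i, h, hi⟩
    have hlast : i + 1 = p.length → p.getVert (i + 1) = p.getVert 0 := by
      intro h
      rw [h, Walk.getVert_length, Walk.getVert_zero]
    have key : ∀ s t, s < p.length → t < p.length → p.getVert s = p.getVert t → s = t := by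
      intro s t hs ht h
      by_contra hst
      exact hne s t hs ht hst h
    rcases Sym2.eq_iff.1 h with ⟨e1, e2⟩ | ⟨e1, e2⟩
    · have := key _ _ hi (by omega) e1
      subst this
      have := key _ _ (by omega) (by omega) e2
      omega
    · have := key _ _ hi (by omega) e1
      subst this
      have := key _ _ (by omega) (by omega) e2
      omega
  · intro a p hp heven h6
    refine ⟨0, 3, by omega, by omega, ?_, by decide, le_rfl, ?_, by omega⟩
    · intro h
      have := hp.getVert_injOn' (x₁ := 0) (x₂ := 3) (by simp)
        (by simp only [Set.mem_ofPred_eq]; omega) h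
      omega
    · exact Nat.Even.sub_odd (by omega) heven (by decide)

/-! ### Strongly chordal treewidth -/

theorem one_le_cliqueNum [Finite V] [Nonempty V] : 1 ≤ G.cliqueNum := by
  obtain ⟨x⟩ := ‹Nonempty V›
  have h : G.IsClique (({x} : Finset V) : Set V) := by simp
  simpa using h.card_le_cliqueNum

theorem exists_sctw_spec [Finite V] (G : SimpleGraph V) :
    ∃ (n : ℕ) (H : SimpleGraph (Fin n)),
      H.IsStronglyChordal ∧ G.IsContained H ∧ H.cliqueNum = G.sctw + 1 := by
  refine Nat.sInf_mem (s := {k : ℕ | ∃ (n : ℕ) (H : SimpleGraph (Fin n)),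
    H.IsStronglyChordal ∧ G.IsContained H ∧ H.cliqueNum = k + 1}) ?_
  obtain ⟨n, ⟨e⟩⟩ := Finite.exists_equiv_fin V
  -- The extra vertex keeps the host nonempty, so its clique number is positive and the natural
  -- subtraction is exact.
  refine ⟨(⊤ : SimpleGraph (Fin (n + 1))).cliqueNum - 1, n + 1, ⊤, isStronglyChordal_top,
    ⟨⟨⟨fun x => (e x).castSucc, ?_⟩, ?_⟩⟩, ?_⟩
  · intro x y hxy h
    exact hxy.ne (e.injective (Fin.castSucc_injective n h))
  · intro x y h
    exact e.injective (Fin.castSucc_injective n h)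
  · exact (Nat.sub_add_cancel one_le_cliqueNum).symm

/-- The host in `IsSubTame` may be infinite; it is pulled back to the vertices of `G` before these
are numbered. -/
theorem sctw_le_two_iff [Finite V] : G.sctw ≤ 2 ↔ IsSubTame G := by
  constructor
  · intro h
    obtain ⟨n, H, hH, ⟨c⟩, hc⟩ := exists_sctw_spec G
    exact ⟨Fin n, H, c, hH.isTame (by omega), c.injective, fun x y hxy => c.toHom.map_adj hxy⟩
  · rintro ⟨X, H, f, hH, hf, hadj⟩
    obtain ⟨n, H', hH', hn, hG⟩ : ∃ (n : ℕ) (H' : SimpleGraph (Fin n)), IsTame H' ∧ 0 < n ∧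
        G.IsContained H' := by
      -- Even the empty graph needs a host with a vertex, since the clique number must have the form
      -- `k + 1`.
      rcases isEmpty_or_nonempty V with hV | hV
      · exact ⟨1, ⊥, isTame_bot, by omega, ⟨⟨⟨fun x => isEmptyElim x, fun {x} => isEmptyElim x⟩,
          fun x => isEmptyElim x⟩⟩⟩
      · obtain ⟨n, ⟨e⟩⟩ := Finite.exists_equiv_fin V
        refine ⟨n, H.comap (f ∘ e.symm), hH.comap (hf.comp e.symm.injective),
          (e (Classical.arbitrary V)).pos, ⟨⟨⟨e, ?_⟩, e.injective⟩⟩⟩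
        intro x y hxy
        simpa using hadj x y hxy
    have hle := hH'.cliqueNum_le
    have : Nonempty (Fin n) := ⟨⟨0, hn⟩⟩
    have h1 := one_le_cliqueNum (G := H')
    have : G.sctw ≤ H'.cliqueNum - 1 := Nat.sInf_le ⟨n, H', hH'.isStronglyChordal, hG, by omega⟩
    omega

theorem IsTame.sctw_le_two [Finite V] (hH : IsTame H) (hle : G ≤ H) : G.sctw ≤ 2 := by
  obtain ⟨n, ⟨e⟩⟩ := Finite.exists_equiv_fin V
  exact sctw_le_two_iff.2 ⟨Fin n, H.comap e.symm, e, hH.comap e.symm.injective, e.injective,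
    fun x y hxy => by simpa using hle hxy⟩

/-- An edge of `G` and a link between its ends survive in any chordal host, which therefore has a
triangle. -/
theorem IsTwoConnected.two_le_sctw [Finite V] (hG : G.IsTwoConnected) : 2 ≤ G.sctw := by
  obtain ⟨n, H, hH, ⟨c⟩, hc⟩ := exists_sctw_spec G
  have h2 := hG.twoConn
  obtain ⟨x, -, w, -, z, -, hxw, -⟩ := h2.three
  obtain ⟨y, -, hxy⟩ := h2.conn.exists_adj_of_ne (x := x) (y := w) trivial trivial hxw
  obtain ⟨v, -, hvx, hvy⟩ := h2.exists_ne x y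
  have hL := h2.isLink_comp (x := v) trivial trivial hxy.ne ⟨trivial, by simp [hvx, hvy]⟩
  obtain ⟨s, hs, hxs⟩ := hL.att_left
  obtain ⟨t, ht, hyt⟩ := hL.att_right
  have hadj : ∀ {u v}, G.Adj u v → H.Adj (c u) (c v) := fun h => c.toHom.map_adj h
  obtain ⟨d, -, h1, h2⟩ := hH.1.exists_common (hadj hxy)
    (hL.conn.image c fun u _ v _ h => Or.inr (hadj h))
    (by rintro ⟨z, hz, h⟩; exact hL.left_notMem (c.injective h ▸ hz))
    (by rintro ⟨z, hz, h⟩; exact hL.right_notMem (c.injective h ▸ hz))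
    ⟨_, ⟨s, hs, rfl⟩, hadj hxs⟩ ⟨_, ⟨t, ht, rfl⟩, hadj hyt⟩
  have h3 : H.IsNClique 3 {c x, c y, d} := is3Clique_triple_iff.2 ⟨hadj hxy, h1, h2⟩
  have := h3.isClique.card_le_cliqueNum
  rw [h3.card_eq] at this
  omega

end

/-! ### Gluing tame graphs along cliques -/

section

variable {V : Type u} {H H₁ H₂ : SimpleGraph V} {M M' : Set (Sym2 V)} {U₁ U₂ : Set V}

/-- All edges of `H` join vertices of `U`. -/
def IsSupportedOn (H : SimpleGraph V) (U : Set V) : Prop :=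
  ∀ x y, H.Adj x y → x ∈ U

theorem IsSupportedOn.left (h : IsSupportedOn H U₁) {x y : V} (hxy : H.Adj x y) : x ∈ U₁ :=
  h x y hxy

theorem IsSupportedOn.right (h : IsSupportedOn H U₁) {x y : V} (hxy : H.Adj x y) : y ∈ U₁ :=
  h y x hxy.symm

/-- The edge `xy` of the triangle `xyz` is marked, or it lies in another triangle. -/
def IsBusy (H : SimpleGraph V) (M : Set (Sym2 V)) (x y z : V) : Prop :=
  s(x, y) ∈ M ∨ ∃ p, p ≠ z ∧ H.Adj x p ∧ H.Adj y p

/-- A tame graph with marked edges in which each triangle has an edge that is neither marked nor in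
another triangle. -/
structure IsMarkedTame (H : SimpleGraph V) (M : Set (Sym2 V)) : Prop where
  chordal : ∀ x y K, H.Adj x y → Conn H K → x ∉ K → y ∉ K → Att H K x → Att H K y →
    ∃ z ∈ K, H.Adj x z ∧ H.Adj y z
  cliqueFree : ∀ x y z w, H.Adj x y → H.Adj x z → H.Adj x w → H.Adj y z → H.Adj y w → ¬ H.Adj z w
  sunFree : ∀ x y z, H.Adj x y → H.Adj y z → H.Adj x z → IsBusy H M x y z → IsBusy H M y z x →
    ¬ IsBusy H M x z y

theorem IsMarkedTame.isTame (h : IsMarkedTame H M) : IsTame H :=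
  ⟨h.chordal, h.cliqueFree, fun x y z p q r hxy hyz hxz hp h1 h2 hq h3 h4 hr h5 h6 =>
    h.sunFree x y z hxy hyz hxz (Or.inr ⟨p, hp, h1, h2⟩) (Or.inr ⟨q, hq, h3, h4⟩)
      (Or.inr ⟨r, hr, h5, h6⟩)⟩

theorem IsTame.isMarkedTame (h : IsTame H) : IsMarkedTame H ∅ := by
  refine ⟨h.chordal, h.cliqueFree, ?_⟩
  rintro x y z hxy hyz hxz (h1 | ⟨p, hp, h1, h2⟩) (h3 | ⟨q, hq, h3, h4⟩) (h5 | ⟨r, hr, h5, h6⟩)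
  on_goal 8 => exact h.sunFree x y z p q r hxy hyz hxz hp h1 h2 hq h3 h4 hr h5 h6
  all_goals simp_all

theorem IsMarkedTame.anti (h : IsMarkedTame H M') (hM : M ⊆ M') : IsMarkedTame H M := by
  have hb : ∀ {x y z}, IsBusy H M x y z → IsBusy H M' x y z := fun h => h.imp (fun h => hM h) id
  exact ⟨h.chordal, h.cliqueFree, fun x y z hxy hyz hxz h1 h2 h3 =>
    h.sunFree x y z hxy hyz hxz (hb h1) (hb h2) (hb h3)⟩

/-- Two graphs whose supports meet in a common clique. -/
structure IsGluing (H₁ H₂ : SimpleGraph V) (U₁ U₂ : Set V) : Prop where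
  left : IsSupportedOn H₁ U₁
  right : IsSupportedOn H₂ U₂
  adj_left : ∀ x y, x ∈ U₁ ∩ U₂ → y ∈ U₁ ∩ U₂ → x ≠ y → H₁.Adj x y
  adj_right : ∀ x y, x ∈ U₁ ∩ U₂ → y ∈ U₁ ∩ U₂ → x ≠ y → H₂.Adj x y

theorem IsGluing.symm (h : IsGluing H₁ H₂ U₁ U₂) : IsGluing H₂ H₁ U₂ U₁ :=
  ⟨h.right, h.left, fun x y hx hy => h.adj_right x y hx.symm hy.symm,
    fun x y hx hy => h.adj_left x y hx.symm hy.symm⟩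

theorem IsGluing.adj_of_mem (h : IsGluing H₁ H₂ U₁ U₂) {x y : V} (hxy : (H₁ ⊔ H₂).Adj x y)
    (hx : x ∈ U₁) (hy : y ∈ U₁) : H₁.Adj x y := by
  rcases hxy with hxy | hxy
  · exact hxy
  · exact h.adj_left x y ⟨hx, h.right.left hxy⟩ ⟨hy, h.right.right hxy⟩ hxy.ne

theorem IsGluing.adj_of_notMem (h : IsGluing H₁ H₂ U₁ U₂) {x y : V} (hxy : (H₁ ⊔ H₂).Adj x y)
    (hx : x ∉ U₁) : H₂.Adj x y := by
  rcases hxy with hxy | hxy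
  · exact absurd (h.left.left hxy) hx
  · exact hxy

/-- A route that leaves `U₁` does so and returns through the common clique, hence can be
short-circuited there. -/
theorem IsGluing.conn_inter (h : IsGluing H₁ H₂ U₁ U₂) {K : Set V} (hK : Conn (H₁ ⊔ H₂) K)
    (hne : (K ∩ U₁).Nonempty) : Conn H₁ (K ∩ U₁) := by
  refine ⟨hne, ?_⟩
  rintro A ⟨u, ⟨huK, huU⟩, huA⟩ hA
  by_cases hS : ∃ s ∈ A, s ∈ K ∧ s ∈ U₁ ∧ s ∈ U₂
  · obtain ⟨s, hsA, hsK, hs1, hs2⟩ := hS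
    have hSA : ∀ t ∈ K, t ∈ U₁ → t ∈ U₂ → t ∈ A := by
      intro t htK ht1 ht2
      by_cases hst : s = t
      · exact hst ▸ hsA
      · exact hA s ⟨hsK, hs1⟩ hsA t ⟨htK, ht1⟩ (h.adj_left s t ⟨hs1, hs2⟩ ⟨ht1, ht2⟩ hst)
    have := hK.2 (A ∪ U₁ᶜ) ⟨u, huK, Or.inl huA⟩ (by
      intro p hpK hp q hqK hpq
      by_cases hq1 : q ∈ U₁
      · by_cases hp1 : p ∈ U₁
        · have hpA : p ∈ A := hp.resolve_right (fun h => h hp1)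
          exact Or.inl (hA p ⟨hpK, hp1⟩ hpA q ⟨hqK, hq1⟩ (h.adj_of_mem hpq hp1 hq1))
        · exact Or.inl (hSA q hqK hq1 (h.right.right (h.adj_of_notMem hpq hp1)))
      · exact Or.inr hq1)
    rintro z ⟨hzK, hz1⟩
    exact (this hzK).resolve_right (fun h => h hz1)
  · push Not at hS
    have := hK.2 (A ∩ U₁) ⟨u, huK, huA, huU⟩ (by
      rintro p hpK ⟨hpA, hp1⟩ q hqK hpq
      have hp2 := hS p hpA hpK hp1
      have hpq' : H₁.Adj p q := h.symm.adj_of_notMem (by rwa [sup_comm]) hp2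
      exact ⟨hA p ⟨hpK, hp1⟩ hpA q ⟨hqK, h.left.right hpq'⟩ hpq', h.left.right hpq'⟩)
    exact fun z hz => (this hz.1).1

/-- If `K` meets `U₁`, replace it by `K ∩ U₁`; a vertex attached to `K` only outside `U₁` is in the
clique, as is some vertex of `K`. If `K` misses `U₁`, both `x` and `y` are in the clique and
chordality of `H₂` applies. -/
theorem IsGluing.chordal_of_left (h : IsGluing H₁ H₂ U₁ U₂) (h₁ : IsMarkedTame H₁ M)
    (h₂ : IsMarkedTame H₂ M) {x y : V} {K : Set V} (hxy : H₁.Adj x y) (hK : Conn (H₁ ⊔ H₂) K)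
    (hx : x ∉ K) (hy : y ∉ K) (ax : Att (H₁ ⊔ H₂) K x) (ay : Att (H₁ ⊔ H₂) K y) :
    ∃ z ∈ K, (H₁ ⊔ H₂).Adj x z ∧ (H₁ ⊔ H₂).Adj y z := by
  by_cases hne : (K ∩ U₁).Nonempty
  · have hatt : ∀ x ∈ U₁, x ∉ K → Att (H₁ ⊔ H₂) K x → Att H₁ (K ∩ U₁) x := by
      rintro x hx hxK ⟨s, hsK, hxs⟩
      by_cases hs : s ∈ U₁
      · exact ⟨s, ⟨hsK, hs⟩, h.adj_of_mem hxs hx hs⟩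
      · obtain ⟨t, htK, ht1⟩ := hne
        obtain ⟨p, hpK, hp1, q, hqK, hq1, hpq⟩ := hK.exists_adj htK ht1 hsK hs
        have hx2 := h.right.right (h.adj_of_notMem hxs.symm hs)
        have hp2 := h.right.right (h.adj_of_notMem hpq.symm hq1)
        exact ⟨p, ⟨hpK, hp1⟩, h.adj_left x p ⟨hx, hx2⟩ ⟨hp1, hp2⟩ fun h => hxK (h ▸ hpK)⟩
    obtain ⟨z, hz, h1, h2⟩ := h₁.chordal x y (K ∩ U₁) hxy (h.conn_inter hK hne)
      (fun h => hx h.1) (fun h => hy h.1) (hatt x (h.left.left hxy) hx ax)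
      (hatt y (h.left.right hxy) hy ay)
    exact ⟨z, hz.1, Or.inl h1, Or.inl h2⟩
  · have hK1 : ∀ z ∈ K, z ∉ U₁ := fun z hz hz1 => hne ⟨z, hz, hz1⟩
    obtain ⟨s, hs, hxs⟩ := ax
    obtain ⟨t, ht, hyt⟩ := ay
    have hxs := h.adj_of_notMem hxs.symm (hK1 s hs)
    have hyt := h.adj_of_notMem hyt.symm (hK1 t ht)
    have hK2 : Conn H₂ K := ⟨hK.1, fun A hA hcl => hK.2 A hA fun p hp hpA q hq hpq =>
      hcl p hp hpA q hq (h.adj_of_notMem hpq (hK1 p hp))⟩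
    obtain ⟨z, hz, h1, h2⟩ := h₂.chordal x y K
      (h.adj_right x y ⟨h.left.left hxy, h.right.right hxs⟩ ⟨h.left.right hxy, h.right.right hyt⟩
        hxy.ne) hK2 hx hy ⟨s, hs, hxs.symm⟩ ⟨t, ht, hyt.symm⟩
    exact ⟨z, hz, Or.inr h1, Or.inr h2⟩

/-- The purpose of marks: a triangle over `xy` with apex outside `U₁` puts `xy` into the common
clique, whose edges are marked. So busyness is visible on one side. -/
theorem IsGluing.isBusy (h : IsGluing H₁ H₂ U₁ U₂)
    (hM : ∀ x y, x ∈ U₁ ∩ U₂ → y ∈ U₁ ∩ U₂ → x ≠ y → s(x, y) ∈ M) {x y z : V}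
    (hxy : H₁.Adj x y) (hb : IsBusy (H₁ ⊔ H₂) M x y z) : IsBusy H₁ M x y z := by
  rcases hb with hb | ⟨p, hp, h1, h2⟩
  · exact Or.inl hb
  · by_cases hp1 : p ∈ U₁
    · exact Or.inr ⟨p, hp, h.adj_of_mem h1 (h.left.left hxy) hp1,
        h.adj_of_mem h2 (h.left.right hxy) hp1⟩
    · exact Or.inl (hM x y
        ⟨h.left.left hxy, h.right.right (h.adj_of_notMem h1.symm hp1)⟩
        ⟨h.left.right hxy, h.right.right (h.adj_of_notMem h2.symm hp1)⟩ hxy.ne)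

theorem IsGluing.isMarkedTame (h : IsGluing H₁ H₂ U₁ U₂) (h₁ : IsMarkedTame H₁ M)
    (h₂ : IsMarkedTame H₂ M)
    (hM : ∀ x y, x ∈ U₁ ∩ U₂ → y ∈ U₁ ∩ U₂ → x ≠ y → s(x, y) ∈ M) :
    IsMarkedTame (H₁ ⊔ H₂) M := by
  have hM' : ∀ x y, x ∈ U₂ ∩ U₁ → y ∈ U₂ ∩ U₁ → x ≠ y → s(x, y) ∈ M :=
    fun x y hx hy => hM x y hx.symm hy.symm
  have hl : ∀ {x y}, (H₁ ⊔ H₂).Adj x y → x ∈ U₁ → y ∈ U₁ → H₁.Adj x y :=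
    fun hxy => h.adj_of_mem hxy
  have hr : ∀ {x y}, (H₁ ⊔ H₂).Adj x y → x ∈ U₂ → y ∈ U₂ → H₂.Adj x y :=
    fun hxy => h.symm.adj_of_mem (by rwa [sup_comm])
  have hmem : ∀ {x y}, (H₁ ⊔ H₂).Adj x y → (x ∈ U₁ ∧ y ∈ U₁) ∨ (x ∈ U₂ ∧ y ∈ U₂) := by
    rintro x y (hxy | hxy)
    · exact Or.inl ⟨h.left.left hxy, h.left.right hxy⟩
    · exact Or.inr ⟨h.right.left hxy, h.right.right hxy⟩
  refine ⟨?_, ?_, ?_⟩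
  · rintro x y K (hxy | hxy) hK hx hy ax ay
    · exact h.chordal_of_left h₁ h₂ hxy hK hx hy ax ay
    · rw [sup_comm] at hK ax ay ⊢
      exact h.symm.chordal_of_left h₂ h₁ hxy hK hx hy ax ay
  · intro x y z w hxy hxz hxw hyz hyw hzw
    have hall : (x ∈ U₁ ∧ y ∈ U₁ ∧ z ∈ U₁ ∧ w ∈ U₁) ∨ (x ∈ U₂ ∧ y ∈ U₂ ∧ z ∈ U₂ ∧ w ∈ U₂) := by
      have := hmem hxy
      have := hmem hxz
      have := hmem hxw
      have := hmem hyz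
      have := hmem hyw
      have := hmem hzw
      tauto
    rcases hall with ⟨hx, hy, hz, hw⟩ | ⟨hx, hy, hz, hw⟩
    · exact h₁.cliqueFree x y z w (hl hxy hx hy) (hl hxz hx hz) (hl hxw hx hw) (hl hyz hy hz)
        (hl hyw hy hw) (hl hzw hz hw)
    · exact h₂.cliqueFree x y z w (hr hxy hx hy) (hr hxz hx hz) (hr hxw hx hw) (hr hyz hy hz)
        (hr hyw hy hw) (hr hzw hz hw)
  · intro x y z hxy hyz hxz b1 b2 b3
    have hall : (x ∈ U₁ ∧ y ∈ U₁ ∧ z ∈ U₁) ∨ (x ∈ U₂ ∧ y ∈ U₂ ∧ z ∈ U₂) := by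
      have := hmem hxy
      have := hmem hxz
      have := hmem hyz
      tauto
    rcases hall with ⟨hx, hy, hz⟩ | ⟨hx, hy, hz⟩
    · have hxy := hl hxy hx hy
      have hyz := hl hyz hy hz
      have hxz := hl hxz hx hz
      exact h₁.sunFree x y z hxy hyz hxz (h.isBusy hM hxy b1) (h.isBusy hM hyz b2)
        (h.isBusy hM hxz b3)
    · have hxy := hr hxy hx hy
      have hyz := hr hyz hy hz
      have hxz := hr hxz hx hz
      rw [sup_comm] at b1 b2 b3
      exact h₂.sunFree x y z hxy hyz hxz (h.symm.isBusy hM' hxy b1) (h.symm.isBusy hM' hyz b2)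
        (h.symm.isBusy hM' hxz b3)

theorem IsSupportedOn.sup (h₁ : IsSupportedOn H₁ U₁) (h₂ : IsSupportedOn H₂ U₂) :
    IsSupportedOn (H₁ ⊔ H₂) (U₁ ∪ U₂) := by
  rintro x y (h | h)
  · exact Or.inl (h₁.left h)
  · exact Or.inr (h₂.left h)

/-! ### Triangulating trees of two-boundaried cycles -/

/-- The triangle with vertices `a`, `b`, `c`. -/
def triangle (a b c : V) : SimpleGraph V where
  Adj x y := x ≠ y ∧ x ∈ ({a, b, c} : Set V) ∧ y ∈ ({a, b, c} : Set V)
  symm := ⟨fun _ _ h => ⟨h.1.symm, h.2.2, h.2.1⟩⟩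
  loopless := ⟨fun _ h => h.1 rfl⟩

theorem isSupportedOn_triangle (a b c : V) : IsSupportedOn (triangle a b c) {a, b, c} :=
  fun _ _ h => h.2.1

/-- The unmarked edge `ab` is the required one, as there is no second triangle. -/
theorem isMarkedTame_triangle {a b c : V} (hab : a ≠ b) (hac : a ≠ c) (hbc : b ≠ c)
    (hM : s(a, b) ∉ M) : IsMarkedTame (triangle a b c) M := by
  have hnb : ∀ {u v}, ({u, v} : Set V) = {a, b} → u ≠ v → ¬ IsBusy (triangle a b c) M u v c := by
    rintro u v h hne (hb | ⟨p, hp, h1, h2⟩)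
    · have : s(u, v) = s(a, b) := by
        have hu : u ∈ ({a, b} : Set V) := h ▸ Set.mem_insert _ _
        have hv : v ∈ ({a, b} : Set V) := h ▸ (by simp)
        rcases hu with rfl | rfl <;> rcases hv with rfl | rfl <;> simp_all [Sym2.eq_swap]
      exact hM (this ▸ hb)
    · have hpab : p ∈ ({a, b} : Set V) := by
        rcases h1.2.2 with h | h | h
        · exact Or.inl h
        · exact Or.inr h
        · exact absurd h hp
      rw [← h] at hpab
      rcases hpab with rfl | rfl
      · exact h1.1 rfl
      · exact h2.1 rfl
  refine ⟨?_, ?_, ?_⟩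
  · rintro x y K hxy hK hx hy ⟨s, hs, hxs⟩ -
    refine ⟨s, hs, hxs, ?_, hxy.2.2, hxs.2.2⟩
    rintro rfl
    exact hy hs
  · rintro x y z w ⟨hxy, hx, hy⟩ ⟨hxz, -, hz⟩ ⟨hxw, -, hw⟩ ⟨hyz, -⟩ ⟨hyw, -⟩ ⟨hzw, -⟩
    simp only [Set.mem_insert_iff, Set.mem_singleton_iff] at hx hy hz hw
    grind
  · rintro x y z ⟨hxy, hx, hy⟩ ⟨hyz, -, hz⟩ ⟨hxz, -⟩ b1 b2 b3
    simp only [Set.mem_insert_iff, Set.mem_singleton_iff] at hx hy hz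
    have hcases : z = c ∨ x = c ∨ y = c := by grind
    rcases hcases with rfl | rfl | rfl
    · exact hnb (by ext t; simp only [Set.mem_insert_iff, Set.mem_singleton_iff]; grind) hxy b1
    · exact hnb (by ext t; simp only [Set.mem_insert_iff, Set.mem_singleton_iff]; grind) hyz b2
    · exact hnb (by ext t; simp only [Set.mem_insert_iff, Set.mem_singleton_iff]; grind) hxz b3

/-- Gluing along an edge. -/
theorem IsMarkedTame.sup_of_edge {a b : V} (h₁ : IsMarkedTame H₁ (insert s(a, b) M))
    (h₂ : IsMarkedTame H₂ (insert s(a, b) M)) (hU₁ : IsSupportedOn H₁ U₁)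
    (hU₂ : IsSupportedOn H₂ U₂) (hU : U₁ ∩ U₂ ⊆ {a, b}) (hab₁ : H₁.Adj a b) (hab₂ : H₂.Adj a b) :
    IsMarkedTame (H₁ ⊔ H₂) M := by
  have key : ∀ x y, x ∈ U₁ ∩ U₂ → y ∈ U₁ ∩ U₂ → x ≠ y → s(x, y) = s(a, b) := by
    intro x y hx hy hxy
    rcases hU hx with rfl | rfl <;> rcases hU hy with rfl | rfl
    · exact absurd rfl hxy
    · rfl
    · exact Sym2.eq_swap
    · exact absurd rfl hxy
  have hg : IsGluing H₁ H₂ U₁ U₂ := by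
    refine ⟨hU₁, hU₂, fun x y hx hy hxy => ?_, fun x y hx hy hxy => ?_⟩
    · rw [← mem_edgeSet, key x y hx hy hxy]
      exact hab₁
    · rw [← mem_edgeSet, key x y hx hy hxy]
      exact hab₂
  -- Once the two sides are glued, their triangles are counted directly and the mark on `ab` can be
  -- dropped.
  refine (hg.isMarkedTame h₁ h₂ fun x y hx hy hxy => ?_).anti (Set.subset_insert _ _)
  rw [key x y hx hy hxy]
  exact Set.mem_insert _ _

/-- Triangulates the polygon formed by a path and its closing edge. At most one path edge is marked,
while the closing edge is unrestricted; this asymmetry makes the induction work, since each cut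
creates a marked closing edge. -/
theorem exists_isMarkedTame_path (c : ℕ → V) (d : ℕ) : ∀ (l : ℕ) (M : Set (Sym2 V)), 2 ≤ d →
    (∀ i j, l ≤ i → i ≤ l + d → l ≤ j → j ≤ l + d → c i = c j → i = j) →
    (∀ i j, l ≤ i → i < l + d → l ≤ j → j < l + d → s(c i, c (i + 1)) ∈ M →
      s(c j, c (j + 1)) ∈ M → i = j) →
    ∃ H : SimpleGraph V, IsMarkedTame H M ∧ IsSupportedOn H (c '' Set.Icc l (l + d)) ∧
      H.Adj (c l) (c (l + d)) ∧ ∀ i, l ≤ i → i < l + d → H.Adj (c i) (c (i + 1)) := by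
  induction d with
  | zero => intro _ _ h; omega
  | succ d ih =>
  intro l M hd hinj hM
  have hne : ∀ i j, l ≤ i → i ≤ l + (d + 1) → l ≤ j → j ≤ l + (d + 1) → i ≠ j → c i ≠ c j :=
    fun i j h1 h2 h3 h4 hij h => hij (hinj i j h1 h2 h3 h4 h)
  have hsne : ∀ i j k m, l ≤ i → i ≤ l + (d + 1) → l ≤ j → j ≤ l + (d + 1) → l ≤ k →
      k ≤ l + (d + 1) → l ≤ m → m ≤ l + (d + 1) → ¬ (i = k ∧ j = m) → ¬ (i = m ∧ j = k) →
      s(c i, c j) ≠ s(c k, c m) := by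
    intro i j k m h1 h2 h3 h4 h5 h6 h7 h8 hn1 hn2 h
    rcases Sym2.eq_iff.1 h with ⟨e1, e2⟩ | ⟨e1, e2⟩
    · exact hn1 ⟨hinj _ _ h1 h2 h5 h6 e1, hinj _ _ h3 h4 h7 h8 e2⟩
    · exact hn2 ⟨hinj _ _ h1 h2 h7 h8 e1, hinj _ _ h3 h4 h5 h6 e2⟩
  have hmem : ∀ i, l ≤ i → i ≤ l + (d + 1) → c i ∈ c '' Set.Icc l (l + (d + 1)) :=
    fun i h1 h2 => ⟨i, ⟨h1, h2⟩, rfl⟩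
  have hor : s(c l, c (l + 1)) ∉ M ∨ s(c (l + d), c (l + d + 1)) ∉ M := by
    by_contra! h
    have := hM l (l + d) (by omega) (by omega) (by omega) (by omega) h.1 h.2
    omega
  by_cases hd2 : d = 1
  · subst hd2
    have hsupp : ({c l, c (l + 1), c (l + 2)} : Set V) ⊆ c '' Set.Icc l (l + (1 + 1)) := by
      rintro _ (rfl | rfl | rfl) <;> exact hmem _ (by omega) (by omega)
    have h01 := hne l (l + 1) (by omega) (by omega) (by omega) (by omega) (by omega)
    have h02 := hne l (l + 2) (by omega) (by omega) (by omega) (by omega) (by omega)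
    have h12 := hne (l + 1) (l + 2) (by omega) (by omega) (by omega) (by omega) (by omega)
    obtain ⟨H, hH, hT⟩ : ∃ H, IsMarkedTame H M ∧ H = triangle (c l) (c (l + 1)) (c (l + 2)) := by
      rcases hor with hor | hor
      · exact ⟨_, isMarkedTame_triangle h01 h02 h12 hor, rfl⟩
      · refine ⟨_, isMarkedTame_triangle h12 h01.symm h02.symm hor, ?_⟩
        ext x y
        simp only [triangle, Set.mem_insert_iff, Set.mem_singleton_iff]
        tauto
    subst hT
    refine ⟨_, hH, fun x y h => hsupp (isSupportedOn_triangle _ _ _ x y h), ⟨h02, by simp, by simp⟩,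
      fun i hi1 hi2 => ?_⟩
    have : i = l ∨ i = l + 1 := by omega
    rcases this with rfl | rfl
    · exact ⟨h01, by simp, by simp⟩
    · exact ⟨h12, by simp, by simp⟩
  -- One of the two end edges of the path is unmarked. The triangle over it and the closing edge is
  -- cut off, and its third side, now marked, closes the shorter path.
  rcases hor with hor | hor
  · obtain ⟨H, hH, hsupp, hadj, hpath⟩ := ih (l + 1) (insert s(c (l + 1), c (l + (d + 1))) M)
      (by omega) (fun i j h1 h2 h3 h4 => hinj i j (by omega) (by omega) (by omega) (by omega)) (by
        intro i j h1 h2 h3 h4 hi hj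
        refine hM i j (by omega) (by omega) (by omega) (by omega) (hi.resolve_left ?_)
          (hj.resolve_left ?_)
        · apply hsne <;> omega
        · apply hsne <;> omega)
    rw [show l + 1 + d = l + (d + 1) by omega] at hsupp hadj hpath
    have h01 := hne l (l + 1) (by omega) (by omega) (by omega) (by omega) (by omega)
    have h02 := hne l (l + (d + 1)) (by omega) (by omega) (by omega) (by omega) (by omega)
    have h12 := hne (l + 1) (l + (d + 1)) (by omega) (by omega) (by omega) (by omega) (by omega)
    refine ⟨triangle (c l) (c (l + 1)) (c (l + (d + 1))) ⊔ H,
      IsMarkedTame.sup_of_edge (isMarkedTame_triangle h01 h02 h12 ?_) hH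
        (isSupportedOn_triangle _ _ _) hsupp ?_ ⟨h12, by simp, by simp⟩ hadj, ?_,
      Or.inl ⟨h02, by simp, by simp⟩, fun i hi1 hi2 => ?_⟩
    · rintro (h | h)
      · revert h
        apply hsne <;> omega
      · exact hor h
    · rintro x ⟨rfl | rfl | rfl, hx⟩
      · obtain ⟨i, ⟨hi1, hi2⟩, hi⟩ := hx
        have := hinj i l (by omega) (by omega) (by omega) (by omega) hi
        omega
      · simp
      · simp
    · intro x y h
      rcases (isSupportedOn_triangle _ _ _).sup hsupp x y h with (rfl | rfl | rfl) | ⟨i, hi, rfl⟩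
      · exact hmem _ (by omega) (by omega)
      · exact hmem _ (by omega) (by omega)
      · exact hmem _ (by omega) (by omega)
      · exact hmem _ (by have := hi.1; omega) hi.2
    · rcases hi1.eq_or_lt with rfl | hlt
      · exact Or.inl ⟨h01, by simp, by simp⟩
      · exact Or.inr (hpath i (by omega) (by omega))
  · obtain ⟨H, hH, hsupp, hadj, hpath⟩ := ih l (insert s(c l, c (l + d)) M)
      (by omega) (fun i j h1 h2 h3 h4 => hinj i j (by omega) (by omega) (by omega) (by omega)) (by
        intro i j h1 h2 h3 h4 hi hj
        refine hM i j (by omega) (by omega) (by omega) (by omega) (hi.resolve_left ?_)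
          (hj.resolve_left ?_)
        · apply hsne <;> omega
        · apply hsne <;> omega)
    have h01 := hne (l + d) (l + d + 1) (by omega) (by omega) (by omega) (by omega) (by omega)
    have h02 := hne l (l + d + 1) (by omega) (by omega) (by omega) (by omega) (by omega)
    have h12 := hne l (l + d) (by omega) (by omega) (by omega) (by omega) (by omega)
    refine ⟨triangle (c (l + d)) (c (l + d + 1)) (c l) ⊔ H,
      IsMarkedTame.sup_of_edge (isMarkedTame_triangle h01 h12.symm h02.symm ?_) hH
        (isSupportedOn_triangle _ _ _) hsupp ?_ ⟨h12, by simp, by simp⟩ hadj, ?_,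
      Or.inl ⟨h02, by simp, by simp [add_assoc]⟩, fun i hi1 hi2 => ?_⟩
    · rintro (h | h)
      · revert h
        apply hsne <;> omega
      · exact hor h
    · rintro x ⟨rfl | rfl | rfl, hx⟩
      · simp
      · obtain ⟨i, ⟨hi1, hi2⟩, hi⟩ := hx
        have := hinj i (l + d + 1) (by omega) (by omega) (by omega) (by omega) hi
        omega
      · simp
    · intro x y h
      rcases (isSupportedOn_triangle _ _ _).sup hsupp x y h with (rfl | rfl | rfl) | ⟨i, hi, rfl⟩
      · exact hmem _ (by omega) (by omega)
      · exact hmem _ (by omega) (by omega)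
      · exact hmem _ (by omega) (by omega)
      · exact hmem _ hi.1 (by have := hi.2; omega)
    · by_cases hid : i = l + d
      · subst hid
        exact Or.inl ⟨h01, by simp, by simp⟩
      · exact Or.inr (hpath i (by omega) (by omega))

variable {G : SimpleGraph V} {S C D : G.Subgraph} {a b : V}

/-- A marked edge, if there is one, is made the closing edge; then at most one path edge is marked.
-/
theorem IsCycleSubgraph.exists_isMarkedTame (hC : IsCycleSubgraph C)
    (hM : {e ∈ C.edgeSet | e ∈ M}.encard ≤ 2) :
    ∃ H : SimpleGraph V, IsMarkedTame H M ∧ IsSupportedOn H C.verts ∧ C.spanningCoe ≤ H := by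
  obtain ⟨x, y, hxy, hmarked⟩ : ∃ x y, C.Adj x y ∧ (s(x, y) ∈ M ∨ ∀ e ∈ C.edgeSet, e ∉ M) := by
    by_cases h : ∃ e ∈ C.edgeSet, e ∈ M
    · obtain ⟨e, he, heM⟩ := h
      induction e with
      | _ x y => exact ⟨x, y, he, Or.inl heM⟩
    · push Not at h
      obtain ⟨x, y, hxy⟩ := hC.exists_adj
      exact ⟨x, y, hxy, Or.inr h⟩
  obtain ⟨n, c, hc, rfl, rfl⟩ := hC.exists_isPolygon hxy
  have h3 := hc.three
  have hsne : ∀ i j k m, i < n → j < n → k < n → m < n → ¬ (i = k ∧ j = m) → ¬ (i = m ∧ j = k) →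
      s(c i, c j) ≠ s(c k, c m) := by
    intro i j k m h1 h2 h3 h4 hn1 hn2 h
    rcases Sym2.eq_iff.1 h with ⟨e1, e2⟩ | ⟨e1, e2⟩
    · exact hn1 ⟨hc.inj _ _ h1 h3 e1, hc.inj _ _ h2 h4 e2⟩
    · exact hn2 ⟨hc.inj _ _ h1 h4 e1, hc.inj _ _ h2 h3 e2⟩
  obtain ⟨H, hH, hsupp, hadj, hpath⟩ := exists_isMarkedTame_path c (n - 1) 0 M (by omega)
    (fun i j _ hi _ hj h => hc.inj i j (by omega) (by omega) h) (by
      intro i j _ hi _ hj hiM hjM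
      by_contra hij
      rcases hmarked with hm | hm
      · have h3 : 2 < {e ∈ C.edgeSet | e ∈ M}.encard := by
          refine lt_of_lt_of_le ?_ (three_le_encard_iff.2 ⟨s(c i, c (i + 1)), ?_,
            s(c j, c (j + 1)), ?_, s(c (n - 1), c 0), ?_, ?_, ?_, ?_⟩)
          · norm_num
          · exact ⟨hc.adj_succ (by omega), hiM⟩
          · exact ⟨hc.adj_succ (by omega), hjM⟩
          · exact ⟨hc.adj_last, hm⟩
          · apply hsne <;> omega
          · apply hsne <;> omega
          · apply hsne <;> omega
        exact absurd hM (not_le.2 h3)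
      · exact hm _ (hc.adj_succ (by omega)) hiM)
  rw [Nat.zero_add] at hsupp hadj hpath
  refine ⟨H, hH, fun x y h => ?_, fun x y h => ?_⟩
  · obtain ⟨i, hi, rfl⟩ := hsupp x y h
    exact hc.mem (by have := hi.2; omega)
  · rw [Subgraph.spanningCoe_adj, hc.adj] at h
    rw [← mem_edgeSet]
    rcases h with ⟨i, hi, h⟩ | h
    · rw [← h]
      exact hpath i (by omega) (by omega)
    · rw [← h]
      exact hadj.symm

/-- The cycle `D` is contained in the subgraph `S` and has no chord in `S`. -/
structure IsInducedCycleOf (S D : G.Subgraph) : Prop where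
  isCycle : IsCycleSubgraph D
  le : D ≤ S
  adj : ∀ x ∈ D.verts, ∀ y ∈ D.verts, S.Adj x y → D.Adj x y

theorem IsCycleSubgraph.isInducedCycleOf_self (hC : IsCycleSubgraph C) : IsInducedCycleOf C C :=
  ⟨hC, le_rfl, fun _ _ _ _ h => h⟩

theorem mk_eq_of_mem_inf {hab : G.Adj a b} (hSC : S ⊓ C = G.subgraphOfAdj hab) {x y : V}
    (hx : x ∈ S.verts) (hx' : x ∈ C.verts) (hy : y ∈ S.verts) (hy' : y ∈ C.verts) (hxy : x ≠ y) :
    s(x, y) = s(a, b) := by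
  have hv : ∀ z, z ∈ S.verts → z ∈ C.verts → z = a ∨ z = b := by
    intro z hz hz'
    have : z ∈ (S ⊓ C).verts := ⟨hz, hz'⟩
    rw [hSC] at this
    exact this
  rcases hv x hx hx' with rfl | rfl <;> rcases hv y hy hy' with rfl | rfl
  · exact absurd rfl hxy
  · rfl
  · exact Sym2.eq_swap
  · exact absurd rfl hxy

theorem adj_of_inf_eq {hab : G.Adj a b} (hSC : S ⊓ C = G.subgraphOfAdj hab) :
    S.Adj a b ∧ C.Adj a b := by
  have : (S ⊓ C).Adj a b := by
    rw [hSC]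
    simp
  exact this

/-- An edge of `C` with both ends in `S` is `ab`, which belongs to `S` already. -/
theorem IsInducedCycleOf.sup (hD : IsInducedCycleOf S D) {hab : G.Adj a b}
    (hSC : S ⊓ C = G.subgraphOfAdj hab) : IsInducedCycleOf (S ⊔ C) D := by
  refine ⟨hD.isCycle, hD.le.trans le_sup_left, ?_⟩
  rintro x hx y hy (hxy | hxy)
  · exact hD.adj x hx y hy hxy
  · refine hD.adj x hx y hy ?_
    have h := mk_eq_of_mem_inf hSC (hD.le.1 hx) hxy.fst_mem (hD.le.1 hy) hxy.snd_mem hxy.ne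
    rw [← Subgraph.mem_edgeSet, h]
    exact (adj_of_inf_eq hSC).1

theorem IsCycleSubgraph.not_le_of_inf_eq (hC : IsCycleSubgraph C) {hab : G.Adj a b}
    (hSC : S ⊓ C = G.subgraphOfAdj hab) : ¬ C ≤ S := by
  intro h
  obtain ⟨x, hx, y, hy, z, hz, hxy, hxz, hyz⟩ := hC.twoConn.three
  have h1 := mk_eq_of_mem_inf hSC (h.1 hx) hx (h.1 hy) hy hxy
  have h2 := mk_eq_of_mem_inf hSC (h.1 hx) hx (h.1 hz) hz hxz
  have := Sym2.congr_right.1 (h1.trans h2.symm)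
  exact hyz this

theorem IsTreeOfCyclesSubgraph.exists_isInducedCycleOf (hS : IsTreeOfCyclesSubgraph S) :
    ∀ e ∈ S.edgeSet, ∃ D, IsInducedCycleOf S D ∧ e ∈ D.edgeSet := by
  induction hS with
  | cycle C hC => exact fun e he => ⟨C, hC.isInducedCycleOf_self, he⟩
  | glue S C hS hC a b hab hSC ih =>
    intro e he
    rw [Subgraph.edgeSet_sup] at he
    rcases he with he | he
    · obtain ⟨D, hD, heD⟩ := ih e he
      exact ⟨D, hD.sup hSC, heD⟩
    · refine ⟨C, ?_, he⟩
      rw [sup_comm]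
      exact hC.isInducedCycleOf_self.sup (by rwa [inf_comm])

/-- `M` collects the edges at which further pieces are to be attached. Splitting off `C` marks `ab`
on both sides. No count increases: `ab` lies in `C` and in an induced cycle of `S`, so it was
counted before as a common edge of two induced cycles. -/
theorem IsTreeOfCyclesSubgraph.exists_isMarkedTame (hS : IsTreeOfCyclesSubgraph S) :
    ∀ M : Set (Sym2 V), (∀ D, IsInducedCycleOf S D →
      {e ∈ D.edgeSet | e ∈ M ∨ ∃ D', IsInducedCycleOf S D' ∧ D ≠ D' ∧ e ∈ D'.edgeSet}.encard ≤ 2) →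
    ∃ H : SimpleGraph V, IsMarkedTame H M ∧ IsSupportedOn H S.verts ∧ S.spanningCoe ≤ H := by
  induction hS with
  | cycle C hC =>
    intro M hM
    refine hC.exists_isMarkedTame ((Set.encard_le_encard ?_).trans
      (hM C hC.isInducedCycleOf_self))
    exact fun e he => ⟨he.1, Or.inl he.2⟩
  | glue S C hS hC a b hab hSC ih =>
    intro M hM
    have hCi : IsInducedCycleOf (S ⊔ C) C := by
      rw [sup_comm]
      exact hC.isInducedCycleOf_self.sup (by rwa [inf_comm])
    have hCS := hC.not_le_of_inf_eq hSC
    obtain ⟨habS, habC⟩ := adj_of_inf_eq hSC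
    obtain ⟨H₁, h₁, hU₁, hle₁⟩ := ih (insert s(a, b) M) (by
      intro D hD
      refine (Set.encard_le_encard ?_).trans (hM D (hD.sup hSC))
      rintro e ⟨he, (rfl | h) | ⟨D', hD', hne, heD⟩⟩
      · refine ⟨he, Or.inr ⟨C, hCi, ?_, habC⟩⟩
        rintro rfl
        exact hCS hD.le
      · exact ⟨he, Or.inl h⟩
      · exact ⟨he, Or.inr ⟨D', hD'.sup hSC, hne, heD⟩⟩)
    obtain ⟨H₂, h₂, hU₂, hle₂⟩ := hC.exists_isMarkedTame (M := insert s(a, b) M) (by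
      refine (Set.encard_le_encard ?_).trans (hM C hCi)
      rintro e ⟨he, rfl | h⟩
      · obtain ⟨D, hD, heD⟩ := hS.exists_isInducedCycleOf s(a, b) habS
        refine ⟨he, Or.inr ⟨D, hD.sup hSC, ?_, heD⟩⟩
        rintro rfl
        exact hCS hD.le
      · exact ⟨he, Or.inl h⟩)
    refine ⟨H₁ ⊔ H₂, h₁.sup_of_edge h₂ hU₁ hU₂ ?_ (hle₁ habS) (hle₂ habC), hU₁.sup hU₂, ?_⟩
    · rintro z ⟨hz, hz'⟩
      have : z ∈ (S ⊓ C).verts := ⟨hz, hz'⟩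
      rw [hSC] at this
      exact this
    · rintro x y (h | h)
      · exact Or.inl (hle₁ h)
      · exact Or.inr (hle₂ h)

theorem IsTreeOfTwoBoundariedCycles.exists_isTame (hG : G.IsTreeOfTwoBoundariedCycles) :
    ∃ H, IsTame H ∧ G ≤ H := by
  have key : ∀ D : G.Subgraph, IsInducedCycleOf ⊤ D → IsChordlessCycle D := by
    intro D hD
    rw [isChordlessCycle_iff]
    refine ⟨hD.isCycle, ?_⟩
    intro x hx y hy hxy
    exact hD.adj x hx y hy hxy
  obtain ⟨H, hH, -, hle⟩ := IsTreeOfCyclesSubgraph.exists_isMarkedTame hG.1 ∅ (by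
    intro D hD
    refine (Set.encard_le_encard ?_).trans (hG.2 D (key D hD))
    rintro e ⟨he, h | ⟨D', hD', hne, heD⟩⟩
    · exact h.elim
    · exact ⟨he, D, D', key D hD, key D' hD', hne, he, heD⟩)
  exact ⟨H, hH.isTame, fun x y h => hle h⟩

end

/-! ### Blocks -/

section

variable {V : Type u} {W : Type v} {G : SimpleGraph V}

theorem IsTame.map {H : SimpleGraph W} (f : W ↪ V) (hH : IsTame H) : IsTame (H.map f) := by
  have hrange : ∀ {x y}, (H.map f).Adj x y → x ∈ Set.range f := by
    intro x y h
    obtain ⟨x', _, _, rfl, _⟩ := (map_adj f H _ _).1 h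
    exact ⟨x', rfl⟩
  refine ⟨?_, ?_, ?_⟩
  · rintro x y K hxy hK hx hy ⟨s, hs, hxs⟩ ⟨t, ht, hyt⟩
    have hKr : K ⊆ Set.range f :=
      hK.2 _ ⟨s, hs, hrange hxs.symm⟩ fun p _ _ q _ hpq => hrange hpq.symm
    obtain ⟨x, rfl⟩ := hrange hxy
    obtain ⟨y, rfl⟩ := hrange hxy.symm
    obtain ⟨s, rfl⟩ := hKr hs
    obtain ⟨t, rfl⟩ := hKr ht
    rw [map_adj_apply] at hxy hxs hyt
    have hK' : Conn H (f ⁻¹' K) := by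
      refine ⟨⟨s, hs⟩, ?_⟩
      rintro A ⟨a, haK, haA⟩ hcl z hz
      obtain ⟨z', hz'A, hz'⟩ := hK.2 (f '' A) ⟨f a, haK, a, haA, rfl⟩ (by
        rintro _ hp ⟨p, hpA, rfl⟩ q hq hpq
        obtain ⟨q, rfl⟩ := hKr hq
        exact ⟨q, hcl p hp hpA q hq (map_adj_apply.1 hpq), rfl⟩) hz
      rwa [← f.injective hz']
    obtain ⟨z, hz, h1, h2⟩ := hH.chordal x y (f ⁻¹' K) hxy hK' hx hy ⟨s, hs, hxs⟩ ⟨t, ht, hyt⟩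
    exact ⟨f z, hz, map_adj_apply.2 h1, map_adj_apply.2 h2⟩
  · intro x y z w hxy hxz hxw hyz hyw hzw
    obtain ⟨x, rfl⟩ := hrange hxy
    obtain ⟨y, rfl⟩ := hrange hyz
    obtain ⟨z, rfl⟩ := hrange hzw
    obtain ⟨w, rfl⟩ := hrange hzw.symm
    rw [map_adj_apply] at *
    exact hH.cliqueFree x y z w hxy hxz hxw hyz hyw hzw
  · intro x y z p q r hxy hyz hxz hp h1 h2 hq h3 h4 hr h5 h6
    obtain ⟨x, rfl⟩ := hrange hxy
    obtain ⟨y, rfl⟩ := hrange hyz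
    obtain ⟨z, rfl⟩ := hrange hxz.symm
    obtain ⟨p, rfl⟩ := hrange h1.symm
    obtain ⟨q, rfl⟩ := hrange h3.symm
    obtain ⟨r, rfl⟩ := hrange h5.symm
    rw [map_adj_apply] at *
    exact hH.sunFree x y z p q r hxy hyz hxz (fun h => hp (h ▸ rfl)) h1 h2 (fun h => hq (h ▸ rfl))
      h3 h4 (fun h => hr (h ▸ rfl)) h5 h6

theorem isTame_of_isSupportedOn_pair {H : SimpleGraph V} {a b : V} (h : IsSupportedOn H {a, b}) :
    IsTame H := by
  have key : ∀ x y z, H.Adj x y → H.Adj x z → y = z := by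
    intro x y z hxy hxz
    have := hxy.ne
    have := hxz.ne
    rcases h.left hxy with rfl | rfl <;> rcases h.right hxy with rfl | rfl <;>
      rcases h.right hxz with rfl | rfl <;> first | rfl | contradiction
  refine ⟨?_, ?_, ?_⟩
  · rintro x y K hxy - - hy ⟨s, hs, hxs⟩ -
    exact absurd (key x y s hxy hxs ▸ hs) hy
  · intro x y z w hxy hxz _ hyz
    exact absurd (key x y z hxy hxz) hyz.ne
  · intro x y z p q r hxy hyz hxz
    exact absurd (key x y z hxy hxz) hyz.ne

/-- The set `U` is not a union of two smaller sets that share at most one vertex and contain all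
edges inside `U`. -/
def Inseparable (G : SimpleGraph V) (U : Set V) : Prop :=
  ∀ U₁ U₂ : Set V, U₁ ⊂ U → U₂ ⊂ U → (U₁ ∩ U₂).Subsingleton →
    ∃ x ∈ U, ∃ y ∈ U, G.Adj x y ∧ ¬ (x ∈ U₁ ∧ y ∈ U₁) ∧ ¬ (x ∈ U₂ ∧ y ∈ U₂)

theorem Inseparable.conn {U : Set V} (h : Inseparable G U) (hne : U.Nonempty) : Conn G U := by
  refine ⟨hne, ?_⟩
  rintro A ⟨p, hp, hpA⟩ hcl q hq
  by_contra hqA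
  obtain ⟨x, hx, y, hy, hxy, h1, h2⟩ := h (U ∩ A) (U \ A)
    ⟨Set.inter_subset_left, fun h => hqA (h hq).2⟩ ⟨Set.sdiff_subset, fun h => (h hp).2 hpA⟩
    (fun x hx => absurd hx.1.2 hx.2.2)
  by_cases hxA : x ∈ A
  · exact h1 ⟨⟨hx, hxA⟩, hy, hcl x hx hxA y hy hxy⟩
  · by_cases hyA : y ∈ A
    · exact hxA (hcl y hy hyA x hx hxy.symm)
    · exact h2 ⟨⟨hx, hxA⟩, hy, hyA⟩

/-- A closed proper part of `U \ {a}`, with `a` added, and the rest of `U` would be a separation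
sharing only `a`. -/
theorem Inseparable.conn_diff {U : Set V} (h : Inseparable G U) {a : V} (ha : a ∈ U)
    (hne : (U \ {a}).Nonempty) : Conn G (U \ {a}) := by
  refine ⟨hne, ?_⟩
  rintro A ⟨p, hp, hpA⟩ hcl q hq
  by_contra hqA
  have hP : ∀ x, x ∈ (U \ {a}) ∩ A → ∀ y ∈ U, G.Adj x y → y = a ∨ y ∈ (U \ {a}) ∩ A := by
    rintro x ⟨hx, hxA⟩ y hy hxy
    by_cases hya : y = a
    · exact Or.inl hya
    · exact Or.inr ⟨⟨hy, hya⟩, hcl x hx hxA y ⟨hy, hya⟩ hxy⟩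
  obtain ⟨x, hx, y, hy, hxy, h1, h2⟩ := h (insert a ((U \ {a}) ∩ A)) (U \ ((U \ {a}) ∩ A))
    ⟨Set.insert_subset ha fun x hx => hx.1.1, fun h => by
      rcases h hq.1 with h | h
      · exact hq.2 h
      · exact hqA h.2⟩
    ⟨Set.sdiff_subset, fun h => (h hp.1).2 ⟨hp, hpA⟩⟩ (by
      have key : ∀ x, x ∈ insert a ((U \ {a}) ∩ A) ∩ (U \ ((U \ {a}) ∩ A)) → x = a :=
        fun x hx => hx.1.resolve_right hx.2.2
      intro x hx y hy
      rw [key x hx, key y hy])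
  by_cases hxA : x ∈ (U \ {a}) ∩ A
  · exact h1 ⟨Or.inr hxA, hP x hxA y hy hxy⟩
  · by_cases hyA : y ∈ (U \ {a}) ∩ A
    · exact h1 ⟨hP y hyA x hx hxy.symm, Or.inr hyA⟩
    · exact h2 ⟨⟨hx, hxA⟩, hy, hyA⟩

/-- An inseparable set induces a connected subgraph without cut vertices, and by finiteness such a
subgraph extends to a maximal one. -/
theorem Inseparable.exists_isBlock [Finite V] {U : Set V} (h : Inseparable G U)
    (hne : U.Nonempty) : ∃ B, G.IsBlock B ∧ (⊤ : G.Subgraph).induce U ≤ B := by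
  have hU : (G.induce U).Connected ∧ ∀ a : U, ¬ (G.induce U).IsCutVertex a := by
    refine ⟨conn_iff_connected_induce.1 (h.conn hne), fun a ha => ha ?_⟩
    intro x y
    have hc : Conn (G.induce U) ({a}ᶜ : Set U) := by
      have := (h.conn_diff a.2 ⟨x.1.1, x.1.2, fun h => x.2 (Subtype.ext h)⟩).preimage_val
        (Set.sdiff_subset (s := U))
      convert this using 1
      ext z
      simp [Subtype.ext_iff]
    exact (conn_iff_connected_induce.1 hc).preconnected x y
  rw [induce_eq_coe_induce_top] at hU
  obtain ⟨B, hle, hB⟩ := Finite.exists_le_maximal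
    (p := fun C : G.Subgraph => C.coe.Connected ∧ ∀ a : C.verts, ¬ C.coe.IsCutVertex a) hU
  exact ⟨B, hB, hle⟩

/-- Induction on the size of `U`, in place of the block tree: an inseparable set lies in a block,
and any other set splits into two smaller ones whose hosts are glued at no more than one vertex. -/
theorem exists_isTame_of_isBlock_aux [Finite V]
    (h : ∀ B : G.Subgraph, G.IsBlock B → ∃ H, IsTame H ∧ B.spanningCoe ≤ H) (U : Set V) :
    ∃ H, IsTame H ∧ IsSupportedOn H U ∧ ∀ x ∈ U, ∀ y ∈ U, G.Adj x y → H.Adj x y := by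
  induction hn : U.ncard using Nat.strong_induction_on generalizing U with
  | _ n ih =>
  by_cases hU : Inseparable G U
  · rcases U.eq_empty_or_nonempty with rfl | hne
    · exact ⟨⊥, isTame_bot, fun _ _ h => h.elim, fun x hx => hx.elim⟩
    · obtain ⟨B, hB, hle⟩ := hU.exists_isBlock hne
      obtain ⟨H, hH, hBH⟩ := h B hB
      -- The host of the block is cut down to `U`, so that supports of later pieces meet only where
      -- their sets do.
      refine ⟨(H.comap ((↑) : U → V)).map (Function.Embedding.subtype _),
        (hH.comap Subtype.val_injective).map _, ?_, ?_⟩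
      · intro x y hxy
        obtain ⟨x', -, -, rfl, -⟩ := (map_adj _ _ _ _).1 hxy
        exact x'.2
      · intro x hx y hy hxy
        exact (map_adj _ _ _ _).2 ⟨⟨x, hx⟩, ⟨y, hy⟩, hBH (hle.2 ⟨hx, hy, hxy⟩), rfl, rfl⟩
  · rw [Inseparable] at hU
    push Not at hU
    obtain ⟨U₁, U₂, hU₁, hU₂, hs, hadj⟩ := hU
    obtain ⟨H₁, h₁, hs₁, ha₁⟩ := ih _ (hn ▸ Set.ncard_lt_ncard hU₁) U₁ rfl
    obtain ⟨H₂, h₂, hs₂, ha₂⟩ := ih _ (hn ▸ Set.ncard_lt_ncard hU₂) U₂ rfl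
    have hg : IsGluing H₁ H₂ U₁ U₂ :=
      ⟨hs₁, hs₂, fun x y hx hy hxy => absurd (hs hx hy) hxy,
        fun x y hx hy hxy => absurd (hs hx hy) hxy⟩
    refine ⟨H₁ ⊔ H₂, (hg.isMarkedTame h₁.isMarkedTame h₂.isMarkedTame
      fun x y hx hy hxy => absurd (hs hx hy) hxy).isTame, fun x y hxy => ?_, ?_⟩
    · rcases hs₁.sup hs₂ x y hxy with hx | hx
      · exact hU₁.1 hx
      · exact hU₂.1 hx
    · intro x hx y hy hxy
      by_cases hxy1 : x ∈ U₁ ∧ y ∈ U₁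
      · exact Or.inl (ha₁ x hxy1.1 y hxy1.2 hxy)
      · have := hadj x hx y hy hxy fun hx hy => hxy1 ⟨hx, hy⟩
        exact Or.inr (ha₂ x this.1 y this.2 hxy)

/-- If every block is a subgraph of a tame graph, then so is the graph. -/
theorem exists_isTame_of_isBlock [Finite V]
    (h : ∀ B : G.Subgraph, G.IsBlock B → ∃ H, IsTame H ∧ B.spanningCoe ≤ H) :
    ∃ H, IsTame H ∧ G ≤ H := by
  obtain ⟨H, hH, -, hadj⟩ := exists_isTame_of_isBlock_aux h Set.univ
  exact ⟨H, hH, fun x y hxy => hadj x trivial y trivial hxy⟩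

/-- A single edge is connected and has no cut vertex, so maximality applies. Hence the vertex of a
one-vertex block is isolated. -/
theorem IsBlock.subgraphOfAdj_le {B : G.Subgraph} (hB : G.IsBlock B) {a b : V} (hab : G.Adj a b)
    (hle : B ≤ G.subgraphOfAdj hab) : G.subgraphOfAdj hab ≤ B := by
  refine hB.2 ⟨(Subgraph.subgraphOfAdj_connected hab).coe, fun c hc => hc ?_⟩ hle
  rintro ⟨⟨x, hx⟩, hxc⟩ ⟨⟨y, hy⟩, hyc⟩
  obtain ⟨c, hcm⟩ := c
  have hxc : x ≠ c := fun h => hxc (Subtype.ext h)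
  have hyc : y ≠ c := fun h => hyc (Subtype.ext h)
  have hxy : x = y := by
    rcases hx with rfl | rfl <;> rcases hy with rfl | rfl <;> rcases hcm with rfl | rfl <;>
      first | rfl | contradiction
  subst hxy
  exact Reachable.refl _

/-- The cases are three or more vertices, two, and one; a connected graph on two vertices is an
edge. -/
theorem IsBlock.cases {B : G.Subgraph} (hB : G.IsBlock B) :
    B.coe.IsTwoConnected ∨ (∃ (a b : V) (hab : G.Adj a b), B = G.subgraphOfAdj hab) ∨
      (∃ a : V, G.IsIsolated a ∧ B = G.singletonSubgraph a) := by
  obtain ⟨⟨hconn, hcut⟩, hmax⟩ := hB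
  by_cases h3 : 3 ≤ ENat.card B.verts
  · refine Or.inl ⟨h3, fun X hX => ?_⟩
    obtain ⟨x, -, y, -, z, -, hxy, hxz, hyz⟩ :=
      three_le_encard_iff.1 (by rwa [Set.encard_univ] : 3 ≤ (Set.univ : Set B.verts).encard)
    rcases Set.encard_le_one_iff_eq.1 hX with rfl | ⟨a, rfl⟩
    · rw [Set.compl_empty]
      exact conn_iff_connected_induce.1 (conn_univ_iff.2 hconn)
    · have hpre := not_not.1 (hcut a)
      by_cases hxa : x = a
      · have : Nonempty ({a}ᶜ : Set B.verts) := ⟨⟨y, fun h => hxy (hxa.trans h.symm)⟩⟩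
        exact ⟨hpre⟩
      · have : Nonempty ({a}ᶜ : Set B.verts) := ⟨⟨x, hxa⟩⟩
        exact ⟨hpre⟩
  · rw [← Set.encard_univ, three_le_encard_iff] at h3
    push Not at h3
    have hcard : ∀ {x y z}, x ∈ B.verts → y ∈ B.verts → z ∈ B.verts → x ≠ y → x ≠ z → y = z := by
      intro x y z hx hy hz hxy hxz
      exact congrArg Subtype.val (h3 ⟨x, hx⟩ trivial ⟨y, hy⟩ trivial ⟨z, hz⟩ trivial
        (fun h => hxy (congrArg Subtype.val h)) (fun h => hxz (congrArg Subtype.val h)))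
    obtain ⟨⟨a, ha⟩⟩ := hconn.nonempty
    right
    by_cases hb : ∃ b ∈ B.verts, a ≠ b
    · obtain ⟨b, hb, hab⟩ := hb
      obtain ⟨⟨c, hc⟩, -, hac⟩ := (conn_univ_iff.2 hconn).exists_adj_of_ne
        (x := ⟨a, ha⟩) (y := ⟨b, hb⟩) trivial trivial (fun h => hab (congrArg Subtype.val h))
      have hac : B.Adj a c := hac
      have hab' : B.Adj a b := by rwa [hcard ha hb hc hab hac.ne]
      refine Or.inl ⟨a, b, hab'.adj_sub, le_antisymm (And.intro ?_ ?_) ?_⟩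
      · intro z hz
        by_cases haz : a = z
        · exact Or.inl haz.symm
        · exact Or.inr (hcard ha hz hb haz hab)
      · intro x y hxy
        have key : ∀ z ∈ B.verts, z = a ∨ z = b := fun z hz => by
          by_cases haz : a = z
          · exact Or.inl haz.symm
          · exact Or.inr (hcard ha hz hb haz hab)
        rw [subgraphOfAdj_adj]
        rcases key x hxy.fst_mem with rfl | rfl <;> rcases key y hxy.snd_mem with rfl | rfl
        · exact absurd rfl hxy.ne
        · rfl
        · exact Sym2.eq_swap
        · exact absurd rfl hxy.ne
      · exact subgraphOfAdj_le_of_adj B hab'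
    · push Not at hb
      have hBa : B = G.singletonSubgraph a := by
        refine le_antisymm (And.intro (fun z hz => (hb z hz).symm) fun x y hxy => ?_)
          ((singletonSubgraph_le_iff a B).2 ha)
        exact absurd ((hb x hxy.fst_mem).symm.trans (hb y hxy.snd_mem)) hxy.ne
      refine Or.inr ⟨a, fun b hab => ?_, hBa⟩
      have hle : B ≤ G.subgraphOfAdj hab := by
        rw [hBa, singletonSubgraph_le_iff]
        simp
      have := (IsBlock.subgraphOfAdj_le ⟨⟨hconn, hcut⟩, hmax⟩ hab hle).1
      exact hab.ne (hb b (this (by simp)))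

end

end SimpleGraph

/-! ### The main theorem. -/

theorem mainTheorem5 {V : Type*} [Finite V] (G : SimpleGraph V) :
    [ G.sctw ≤ 2,
      ∀ B : G.Subgraph, G.IsBlock B →
        (B.coe.IsTwoConnected ∧ B.coe.cellCompletion.IsTreeOfTwoBoundariedCycles) ∨
        (∃ (a b : V) (hab : G.Adj a b), B = G.subgraphOfAdj hab) ∨
        (∃ a : V, G.IsIsolated a ∧ B = G.singletonSubgraph a),
      ¬ SimpleGraph.HasMinor SimpleGraph.K4 V G ∧
        ¬ SimpleGraph.HasMinor SimpleGraph.S3 V G ].TFAE ∧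
    (G.IsTwoConnected →
      (G.sctw = 2 ↔ G.cellCompletion.IsTreeOfTwoBoundariedCycles) ∧
      (G.sctw = 2 ↔
        ¬ SimpleGraph.HasMinor SimpleGraph.K4 V G ∧
          ¬ SimpleGraph.HasMinor SimpleGraph.S3 V G)) := by
  have h13 : G.sctw ≤ 2 →
      ¬ SimpleGraph.HasMinor SimpleGraph.K4 V G ∧ ¬ SimpleGraph.HasMinor SimpleGraph.S3 V G :=
    fun h => ⟨fun h4 => SimpleGraph.not_isSubTame_K4 (.of_hasMinor h4 (SimpleGraph.sctw_le_two_iff.1 h)),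
      fun h3 => SimpleGraph.not_isSubTame_S3 (.of_hasMinor h3 (SimpleGraph.sctw_le_two_iff.1 h))⟩
  have h32 : ¬ SimpleGraph.HasMinor SimpleGraph.K4 V G ∧ ¬ SimpleGraph.HasMinor SimpleGraph.S3 V G →
      ∀ B : G.Subgraph, G.IsBlock B →
      (B.coe.IsTwoConnected ∧ B.coe.cellCompletion.IsTreeOfTwoBoundariedCycles) ∨
      (∃ (a b : V) (hab : G.Adj a b), B = G.subgraphOfAdj hab) ∨
      (∃ a : V, G.IsIsolated a ∧ B = G.singletonSubgraph a) := by
    rintro ⟨h4, h3⟩ B hB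
    refine hB.cases.imp_left fun h => ⟨h, h.isTreeOfTwoBoundariedCycles_cellCompletion ?_ ?_⟩
    · exact fun hm => h4 (hm.map _ Subtype.val_injective fun _ _ h => h.adj_sub).hasMinor
    · exact fun hm => h3 (hm.map _ Subtype.val_injective fun _ _ h => h.adj_sub).hasMinor
  have h21 : (∀ B : G.Subgraph, G.IsBlock B →
      (B.coe.IsTwoConnected ∧ B.coe.cellCompletion.IsTreeOfTwoBoundariedCycles) ∨
      (∃ (a b : V) (hab : G.Adj a b), B = G.subgraphOfAdj hab) ∨
      (∃ a : V, G.IsIsolated a ∧ B = G.singletonSubgraph a)) → G.sctw ≤ 2 := by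
    intro h
    obtain ⟨H, hH, hle⟩ := SimpleGraph.exists_isTame_of_isBlock fun B hB => by
      rcases h B hB with ⟨-, hT⟩ | ⟨a, b, hab, rfl⟩ | ⟨a, -, rfl⟩
      · obtain ⟨H, hH, hle⟩ := hT.exists_isTame
        refine ⟨H.map (Function.Embedding.subtype _), hH.map _, fun x y hxy => ?_⟩
        exact (SimpleGraph.map_adj _ _ _ _).2 ⟨⟨x, B.edge_vert hxy⟩, ⟨y, B.edge_vert hxy.symm⟩,
          hle (SimpleGraph.le_cellCompletion hxy), rfl, rfl⟩
      · exact ⟨_, SimpleGraph.isTame_of_isSupportedOn_pair (a := a) (b := b) fun x y hxy =>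
          (G.subgraphOfAdj hab).edge_vert hxy, le_rfl⟩
      · exact ⟨_, SimpleGraph.isTame_bot, fun x y hxy => hxy⟩
    exact hH.sctw_le_two hle
  refine ⟨?_, fun hG => ?_⟩
  · tfae_have 1 → 3 := h13
    tfae_have 3 → 2 := h32
    tfae_have 2 → 1 := h21
    tfae_finish
  -- `G` itself need not be its only block by the definition at hand; the cell completion of `G` is
  -- used directly, with the lower bound two to reach equality.
  · have hT1 : G.cellCompletion.IsTreeOfTwoBoundariedCycles → G.sctw = 2 := by
      intro hT
      obtain ⟨H, hH, hle⟩ := hT.exists_isTame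
      exact le_antisymm (hH.sctw_le_two (SimpleGraph.le_cellCompletion.trans hle)) hG.two_le_sctw
    have hMT :
        ¬ SimpleGraph.HasMinor SimpleGraph.K4 V G ∧ ¬ SimpleGraph.HasMinor SimpleGraph.S3 V G →
        G.cellCompletion.IsTreeOfTwoBoundariedCycles := fun h =>
      hG.isTreeOfTwoBoundariedCycles_cellCompletion (fun hm => h.1 hm.hasMinor)
        (fun hm => h.2 hm.hasMinor)
    exact ⟨⟨fun h => hMT (h13 h.le), hT1⟩, fun h => h13 h.le, fun h => hT1 (hMT h)⟩
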